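/- Let $N\ge 2$ and $0<\alpha<\beta<1$. For $k\in\{0,1\}$ and $\gamma\in(0,1)$ let $C^{k,\gamma}(\mathbb R)$ be the space of bounded $C^k$ functions $u:\mathbb R\to\mathbb R$ with bounded derivatives up to order $k$ and finite norm $$\|u\|_{C^{k,\gamma}}=\sum_{j=0}^{k}\|u^{(j)}\|_{L^\infty(\mathbb R)}+\sup_{s\ne t}\frac{|u^{(k)}(s)-u^{(k)}(t)|}{|s-t|^\gamma}.$$ Let $\mathcal O=\{u\in C^{1,\beta}(\mathbb R):\inf_{\mathbb R}u>0\}$, an open subset of $C^{1,\beta}(\mathbb R)$. For $u\in\mathcal O$ let $E_u=\{(s,\zeta)\in\mathbb R\times\mathbb R^{N-1}:|\zeta|<u(s)\}$, and let $$H(u)(s)=H_{E_u}(x)=PV\int_{\mathbb R^N}\frac{1_{E_u^c}(y)-1_{E_u}(y)}{|x-y|^{N+\alpha}}\,dy=\lim_{\varepsilon\to0^+}\int_{|y-x|\ge\varepsilon}\frac{1_{E_u^c}(y)-1_{E_u}(y)}{|x-y|^{N+\alpha}}\,dy,\qquad x=(s,u(s)\theta),\ \theta\in S^{N-2},$$ be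 the nonlocal mean curvature of $\partial E_u$ at $x$. Here $S^{N-2}$ is the unit sphere of $\mathbb R^{N-1}$ with its surface measure $d\sigma$, and $\sigma_1$ is the first coordinate of $\sigma\in S^{N-2}$. Then: 1. For every $u\in\mathcal O$ and $s\in\mathbb R$ the limit exists and does not depend on $\theta\in S^{N-2}$; moreover $H(u)\in C^{0,\beta-\alpha}(\mathbb R)$, and the map $H:\mathcal O\subset C^{1,\beta}(\mathbb R)\to C^{0,\beta-\alpha}(\mathbb R)$ is of class $C^\infty$ (in the Fréchet sense). 2. Suppose $N\ge3$. For every constant $\kappa>0$, every $v\in C^{1,\beta}(\mathbb R)$ and every $s\in\mathbb R$, $$DH(\kappa)v(s)=\kappa^{-1-\alpha}\Bigl(PV\int_{\mathbb R}\bigl(v(s)-v(s-\kappa\tau)\bigr)G_\alpha(\tau)\,d\tau-b_\alpha v(s)\Bigr),$$ where the principal value $\lim_{\varepsilon\to0^+}\int_{|\tau|\ge\varepsilon}$ exists, $$G_\alpha(\tau)=2\int_{S^{N-2}}\frac{d\sigma}{(\tau^2+2(1-\sigma_1))^{\frac{N+\alpha}{2}}}\quad(\tau\neq0),\qquad b_\alpha=2\int_{\mathbb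 R}\int_{S^{N-2}}\frac{1-\sigma_1}{(\tau^2+2(1-\sigma_1))^{\frac{N+\alpha}{2}}}\,d\sigma\,d\tau,$$ and the double integral defining $b_\alpha$ converges absolutely. -/

import Mathlib

open MeasureTheory Filter Topology Set
open scoped ContDiff

noncomputable section

/-! ### Hölder spaces on the real line -/

/-- `u ∈ C^{k,γ}(ℝ)`: `u` is of class `C^k`, `u, u', …, u^{(k)}` are bounded, and `u^{(k)}` has
finite Hölder seminorm of order `γ`. -/
def IsHolder (k : ℕ) (γ : ℝ) (u : ℝ → ℝ) : Prop :=
  ContDiff ℝ k u ∧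
  (∀ j ≤ k, ∃ C, ∀ x, |iteratedDeriv j u x| ≤ C) ∧
  ∃ C, ∀ x y, |iteratedDeriv k u x - iteratedDeriv k u y| ≤ C * |x - y| ^ γ

theorem IsHolder.add {k : ℕ} {γ : ℝ} {u v : ℝ → ℝ} (hu : IsHolder k γ u) (hv : IsHolder k γ v) :
    IsHolder k γ (u + v) := by
  have key : ∀ j ≤ k, ∀ x, iteratedDeriv j (u + v) x = iteratedDeriv j u x + iteratedDeriv j v x :=
    fun j hj x => iteratedDeriv_add
      ((hu.1.of_le (by exact_mod_cast hj)).contDiffAt) ((hv.1.of_le (by exact_mod_cast hj)).contDiffAt)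
  refine ⟨hu.1.add hv.1, fun j hj => ?_, ?_⟩
  · obtain ⟨C, hC⟩ := hu.2.1 j hj
    obtain ⟨D, hD⟩ := hv.2.1 j hj
    refine ⟨C + D, fun x => ?_⟩
    rw [key j hj]
    exact (abs_add_le _ _).trans (add_le_add (hC x) (hD x))
  · obtain ⟨C, hC⟩ := hu.2.2
    obtain ⟨D, hD⟩ := hv.2.2
    refine ⟨C + D, fun x y => ?_⟩
    rw [key k le_rfl, key k le_rfl, add_mul, add_sub_add_comm]
    exact (abs_add_le _ _).trans (add_le_add (hC x y) (hD x y))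

theorem IsHolder.smul {k : ℕ} {γ : ℝ} {u : ℝ → ℝ} (c : ℝ) (hu : IsHolder k γ u) :
    IsHolder k γ (c • u) := by
  have key : ∀ j ≤ k, ∀ x, iteratedDeriv j (c • u) x = c * iteratedDeriv j u x :=
    fun j hj x => by
      rw [iteratedDeriv_const_smul ((hu.1.of_le (by exact_mod_cast hj)).contDiffAt) c, smul_eq_mul]
  refine ⟨contDiff_const.smul hu.1, fun j hj => ?_, ?_⟩
  · obtain ⟨C, hC⟩ := hu.2.1 j hj
    refine ⟨|c| * C, fun x => ?_⟩
    rw [key j hj, abs_mul]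
    exact mul_le_mul_of_nonneg_left (hC x) (abs_nonneg c)
  · obtain ⟨C, hC⟩ := hu.2.2
    refine ⟨|c| * C, fun x y => ?_⟩
    rw [key k le_rfl, key k le_rfl, ← mul_sub, abs_mul, mul_assoc]
    exact mul_le_mul_of_nonneg_left (hC x y) (abs_nonneg c)

theorem isHolder_const (k : ℕ) (γ c : ℝ) : IsHolder k γ (fun _ => c) := by
  refine ⟨contDiff_const, fun j _ => ⟨|c|, fun x => ?_⟩, 0, fun x y => ?_⟩
  · rw [iteratedDeriv_const]
    split_ifs <;> simp
  · simp [iteratedDeriv_const]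

/-- The vector space underlying `C^{k,γ}(ℝ)`. -/
def holderSubmodule (k : ℕ) (γ : ℝ) : Submodule ℝ (ℝ → ℝ) where
  carrier := {u | IsHolder k γ u}
  add_mem' := IsHolder.add
  zero_mem' := isHolder_const k γ 0
  smul_mem' c _ hu := hu.smul c

/-- The space `C^{k,γ}(ℝ)`. It is kept apart from the submodule of `ℝ → ℝ`, so that its only
topology is the one of the Hölder norm below. -/
def HolderSpace (k : ℕ) (γ : ℝ) : Type := ↥(holderSubmodule k γ)

namespace HolderSpace

variable {k : ℕ} {γ : ℝ}

instance : AddCommGroup (HolderSpace k γ) := inferInstanceAs (AddCommGroup ↥(holderSubmodule k γ))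

instance : Module ℝ (HolderSpace k γ) := inferInstanceAs (Module ℝ ↥(holderSubmodule k γ))

instance : CoeFun (HolderSpace k γ) (fun _ => ℝ → ℝ) := ⟨Subtype.val⟩

/-- A constant function, as an element of `C^{k,γ}(ℝ)`. -/
def const (k : ℕ) (γ c : ℝ) : HolderSpace k γ := ⟨fun _ => c, isHolder_const k γ c⟩

theorem isHolder (u : HolderSpace k γ) : IsHolder k γ u := u.2

theorem ext {u v : HolderSpace k γ} (h : ∀ x, u x = v x) : u = v := Subtype.ext (funext h)

theorem coe_add (u v : HolderSpace k γ) : ⇑(u + v) = (u : ℝ → ℝ) + v := rfl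

theorem coe_smul (c : ℝ) (u : HolderSpace k γ) : ⇑(c • u) = c • (u : ℝ → ℝ) := rfl

/-- `‖u^{(j)}‖_{L^∞(ℝ)}` (a genuine supremum, as `u^{(j)}` is continuous). -/
def supNorm (j : ℕ) (u : HolderSpace k γ) : ℝ := ⨆ x : ℝ, |iteratedDeriv j u x|

/-- The Hölder seminorm of order `γ` of `u^{(k)}`, i.e. the supremum of
`|u^{(k)}(s) - u^{(k)}(t)| / |s - t|^γ` over `s ≠ t`; the pairs `s = t` contribute `0`. -/
def seminorm (u : HolderSpace k γ) : ℝ :=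
  ⨆ p : ℝ × ℝ, |iteratedDeriv k u p.1 - iteratedDeriv k u p.2| / |p.1 - p.2| ^ γ

theorem bddAbove_sup {j : ℕ} (hj : j ≤ k) (u : HolderSpace k γ) :
    BddAbove (range fun x : ℝ => |iteratedDeriv j u x|) := by
  obtain ⟨C, hC⟩ := u.isHolder.2.1 j hj
  exact ⟨C, by rintro _ ⟨x, rfl⟩; exact hC x⟩

theorem bddAbove_seminorm (u : HolderSpace k γ) :
    BddAbove (range fun p : ℝ × ℝ =>
      |iteratedDeriv k u p.1 - iteratedDeriv k u p.2| / |p.1 - p.2| ^ γ) := by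
  obtain ⟨C, hC⟩ := u.isHolder.2.2
  refine ⟨max C 0, ?_⟩
  rintro _ ⟨p, rfl⟩
  refine div_le_of_le_mul₀ (Real.rpow_nonneg (abs_nonneg _) _) (le_max_right _ _) ?_
  exact (hC p.1 p.2).trans
    (mul_le_mul_of_nonneg_right (le_max_left _ _) (Real.rpow_nonneg (abs_nonneg _) _))

theorem iteratedDeriv_coe_add {j : ℕ} (hj : j ≤ k) (u v : HolderSpace k γ) (x : ℝ) :
    iteratedDeriv j (u + v : HolderSpace k γ) x = iteratedDeriv j u x + iteratedDeriv j v x := by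
  rw [coe_add]
  exact iteratedDeriv_add ((u.isHolder.1.of_le (by exact_mod_cast hj)).contDiffAt)
    ((v.isHolder.1.of_le (by exact_mod_cast hj)).contDiffAt)

theorem iteratedDeriv_coe_smul {j : ℕ} (hj : j ≤ k) (c : ℝ) (u : HolderSpace k γ) (x : ℝ) :
    iteratedDeriv j (c • u : HolderSpace k γ) x = c * iteratedDeriv j u x := by
  rw [coe_smul, iteratedDeriv_const_smul
    ((u.isHolder.1.of_le (by exact_mod_cast hj)).contDiffAt) c, smul_eq_mul]

theorem supNorm_nonneg (j : ℕ) (u : HolderSpace k γ) : 0 ≤ supNorm j u :=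
  Real.iSup_nonneg fun _ => abs_nonneg _

theorem seminorm_nonneg (u : HolderSpace k γ) : 0 ≤ seminorm u :=
  Real.iSup_nonneg fun _ => div_nonneg (abs_nonneg _) (Real.rpow_nonneg (abs_nonneg _) _)

theorem supNorm_add_le {j : ℕ} (hj : j ≤ k) (u v : HolderSpace k γ) :
    supNorm j (u + v) ≤ supNorm j u + supNorm j v := by
  refine ciSup_le fun x => ?_
  rw [iteratedDeriv_coe_add hj]
  exact (abs_add_le _ _).trans
    (add_le_add (le_ciSup (bddAbove_sup hj u) x) (le_ciSup (bddAbove_sup hj v) x))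

theorem seminorm_add_le (u v : HolderSpace k γ) :
    seminorm (u + v) ≤ seminorm u + seminorm v := by
  refine ciSup_le fun p => ?_
  rw [iteratedDeriv_coe_add le_rfl, iteratedDeriv_coe_add le_rfl, add_sub_add_comm]
  refine le_trans ?_
    (add_le_add (le_ciSup (bddAbove_seminorm u) p) (le_ciSup (bddAbove_seminorm v) p))
  rw [← add_div]
  exact div_le_div_of_nonneg_right (abs_add_le _ _) (Real.rpow_nonneg (abs_nonneg _) _)

theorem supNorm_smul {j : ℕ} (hj : j ≤ k) (c : ℝ) (u : HolderSpace k γ) :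
    supNorm j (c • u) = |c| * supNorm j u := by
  simp only [supNorm, iteratedDeriv_coe_smul hj, abs_mul]
  exact (Real.mul_iSup_of_nonneg (abs_nonneg c) _).symm

theorem seminorm_smul (c : ℝ) (u : HolderSpace k γ) : seminorm (c • u) = |c| * seminorm u := by
  simp only [seminorm, iteratedDeriv_coe_smul le_rfl, ← mul_sub, abs_mul, mul_div_assoc]
  exact (Real.mul_iSup_of_nonneg (abs_nonneg c) _).symm

/-- The norm `∑_{j=0}^{k} ‖u^{(j)}‖_{L^∞} + [u^{(k)}]_γ` of `C^{k,γ}(ℝ)`. -/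
def holderNorm (u : HolderSpace k γ) : ℝ :=
  (∑ j ∈ Finset.range (k + 1), supNorm j u) + seminorm u

theorem holderNorm_smul (c : ℝ) (u : HolderSpace k γ) :
    holderNorm (c • u) = |c| * holderNorm u := by
  rw [holderNorm, holderNorm, mul_add, seminorm_smul, Finset.mul_sum]
  congr 1
  exact Finset.sum_congr rfl fun j hj =>
    supNorm_smul (Nat.lt_succ_iff.1 (Finset.mem_range.1 hj)) c u

/-- `holderNorm` satisfies the axioms of a norm. -/
def addGroupNorm (k : ℕ) (γ : ℝ) : AddGroupNorm (HolderSpace k γ) where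
  toFun := holderNorm
  map_zero' := by
    have h := holderNorm_smul 0 (0 : HolderSpace k γ)
    rwa [zero_smul, abs_zero, zero_mul] at h
  add_le' u v := by
    have h1 : ∑ j ∈ Finset.range (k + 1), supNorm j (u + v) ≤
        ∑ j ∈ Finset.range (k + 1), (supNorm j u + supNorm j v) :=
      Finset.sum_le_sum fun j hj =>
        supNorm_add_le (Nat.lt_succ_iff.1 (Finset.mem_range.1 hj)) u v
    rw [Finset.sum_add_distrib] at h1
    have h2 := seminorm_add_le u v
    simp only [holderNorm]
    linarith
  neg' u := by
    have h := holderNorm_smul (-1) u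
    rwa [neg_one_smul, abs_neg, abs_one, one_mul] at h
  eq_zero_of_map_eq_zero' u hu := by
    have h0 : supNorm 0 u ≤ ∑ j ∈ Finset.range (k + 1), supNorm j u :=
      Finset.single_le_sum (f := fun j => supNorm j u) (fun j _ => supNorm_nonneg j u)
        (Finset.mem_range.2 k.succ_pos)
    have h1 := seminorm_nonneg u
    have h2 : (∑ j ∈ Finset.range (k + 1), supNorm j u) + seminorm u = 0 := hu
    refine HolderSpace.ext fun x => ?_
    have h3 : |iteratedDeriv 0 u x| ≤ supNorm 0 u := le_ciSup (bddAbove_sup k.zero_le u) x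
    rw [iteratedDeriv_zero] at h3
    exact abs_eq_zero.1 (le_antisymm (by linarith) (abs_nonneg _))

instance : NormedAddCommGroup (HolderSpace k γ) := (addGroupNorm k γ).toNormedAddCommGroup

instance : NormedSpace ℝ (HolderSpace k γ) where
  norm_smul_le c u := (holderNorm_smul c u).le

theorem norm_def (u : HolderSpace k γ) :
    ‖u‖ = (∑ j ∈ Finset.range (k + 1), ⨆ x : ℝ, |iteratedDeriv j u x|) +
      ⨆ p : ℝ × ℝ, |iteratedDeriv k u p.1 - iteratedDeriv k u p.2| / |p.1 - p.2| ^ γ := rfl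

end HolderSpace

/-! ### Principal values, cylindrical graphs and the nonlocal mean curvature -/

/-- The principal value at `x` of `∫ f` exists and equals `L`: `f` is integrable outside of every
ball around `x`, and `∫_{|y-x| ≥ ε} f(y) dy → L` as `ε → 0⁺`. -/
def HasPrincipalValue {F : Type*} [NormedAddCommGroup F] [MeasureSpace F]
    (f : F → ℝ) (x : F) (L : ℝ) : Prop :=
  (∀ ε > 0, IntegrableOn f {y | ε ≤ ‖y - x‖}) ∧
  Tendsto (fun ε : ℝ => ∫ y in {y | ε ≤ ‖y - x‖}, f y) (𝓝[>] 0) (𝓝 L)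

/-- Euclidean space `ℝ^N = ℝ × ℝ^{N-1}`, with its Euclidean norm and Lebesgue measure. -/
abbrev Ambient (N : ℕ) : Type := WithLp 2 (ℝ × EuclideanSpace ℝ (Fin (N - 1)))

/-- The unit sphere `S^{N-2}` of `ℝ^{N-1}`. -/
abbrev UnitSphere (N : ℕ) : Type :=
  ↥(Metric.sphere (0 : EuclideanSpace ℝ (Fin (N - 1))) 1)

/-- The surface measure of `S^{N-2}`. -/
def sphereMeasure (N : ℕ) : Measure (UnitSphere N) :=
  (volume : Measure (EuclideanSpace ℝ (Fin (N - 1)))).toSphere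

/-- The set `E ⊆ ℝ^N` has at `x` the nonlocal mean curvature
`h = PV ∫ (1_{Eᶜ}(y) - 1_E(y)) / |x - y|^{N+α} dy`. -/
def HasNonlocalMeanCurvature (N : ℕ) (α : ℝ) (E : Set (Ambient N)) (x : Ambient N) (h : ℝ) :
    Prop :=
  HasPrincipalValue
    (fun y => (Eᶜ.indicator (fun _ => (1 : ℝ)) y - E.indicator (fun _ => (1 : ℝ)) y) /
      ‖x - y‖ ^ ((N : ℝ) + α)) x h

/-- `E_u = {(s, ζ) ∈ ℝ × ℝ^{N-1} : |ζ| < u(s)}`. -/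
def cylindricalGraph (N : ℕ) (u : ℝ → ℝ) : Set (Ambient N) := {y | ‖y.snd‖ < u y.fst}

/-- The boundary point `(s, u(s) θ)` of `E_u`. -/
def boundaryPoint (N : ℕ) (u : ℝ → ℝ) (s : ℝ) (θ : UnitSphere N) : Ambient N :=
  WithLp.toLp 2 (s, u s • (θ : EuclideanSpace ℝ (Fin (N - 1))))

/-- `𝒪 = {u ∈ C^{1,β}(ℝ) : inf u > 0}`. -/
def positiveCone (β : ℝ) : Set (HolderSpace 1 β) := {u | 0 < ⨅ s : ℝ, u s}

/-- The first coordinate `σ_1` of a point `σ ∈ S^{N-2} ⊆ ℝ^{N-1}`. -/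
def sphereCoord {N : ℕ} (hN : 2 ≤ N) (σ : UnitSphere N) : ℝ := σ.1 ⟨0, by omega⟩

/-- `G_α(τ) = 2 ∫_{S^{N-2}} (τ² + 2(1 - σ_1))^{-(N+α)/2} dσ`. -/
def kernelG {N : ℕ} (hN : 2 ≤ N) (α τ : ℝ) : ℝ :=
  2 * ∫ σ, 1 / (τ ^ 2 + 2 * (1 - sphereCoord hN σ)) ^ (((N : ℝ) + α) / 2) ∂(sphereMeasure N)

/-- The integrand `(1 - σ_1) / (τ² + 2(1 - σ_1))^{(N+α)/2}` of the constant `b_α`. -/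
def integrandB {N : ℕ} (hN : 2 ≤ N) (α τ : ℝ) (σ : UnitSphere N) : ℝ :=
  (1 - sphereCoord hN σ) / (τ ^ 2 + 2 * (1 - sphereCoord hN σ)) ^ (((N : ℝ) + α) / 2)

/-- `b_α = 2 ∫_ℝ ∫_{S^{N-2}} (1 - σ_1) / (τ² + 2(1 - σ_1))^{(N+α)/2} dσ dτ`. -/
def constB {N : ℕ} (hN : 2 ≤ N) (α : ℝ) : ℝ :=
  2 * ∫ τ : ℝ, ∫ σ, integrandB hN α τ σ ∂(sphereMeasure N)

end

set_option linter.unusedSectionVars false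

/-! The field (y - x)|y - x|^{-N-α} has divergence -α|y - x|^{-N-α}, so formally the curvature at x
is 2/α times its flux through the boundary of E_u. Put n = N - 1, V = ℝ^n, p = (N+α)/2, x = (s,
u(s)e), and parametrize the boundary by (s - τ, u(s-τ)σ). The flux density is (τ R(s,τ) + (1 -
⟨σ,e⟩) u(s)) u(s-τ)^{n-1} D^{-p}, where R = u'(s-τ) - (u(s) - u(s-τ))/τ and D is the squared
distance (`surfaceIntegrand`). This integral converges absolutely. Indeed D is comparable to τ² +
2(1-⟨σ,e⟩), R is O(|τ|^β), and the integral over the sphere of (τ² + 2(1-⟨σ,e⟩))^{-p} is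
O(|τ|^{-2-α}) (`exists_integral_ringKernel_le`). The term with 1-⟨σ,e⟩ converges because α < 1
(`integrable_sphereDefect_mul_ringKernel`).

Smoothness. D is τ² + 2(1-⟨σ,e⟩) times `distanceFamily`, a polynomial in bounded linear images of u
in the Banach algebra of families that are Hölder in s uniformly in (τ,σ). It is bounded below by a
positive constant when inf u > 0, and real powers are smooth on such families because the binomial
series converges in the algebra (`HolderFamily.contDiffAt_rpow`). The curvature is then obtained
from a bounded bilinear map in (u, density) and a bounded linear map (`bilinearCLM`, `defectCLM`)
with values in C^{0,β-α}. The exponent β - α comes from |R(s,τ) - R(t,τ)| ≤ C min(|τ|,|s-t|)^β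
integrated against |τ|^{-1-α}.

Identification with the principal value. The kernel is replaced by -1/α times the divergence of
z(|z|²+ε²)^{-p}, which has no singularity and total integral zero. An explicit divergence theorem in
the coordinates (τ,σ,ρ), y = (s-τ, ρu(s-τ)σ), turns its integral over E_u into a flux
(`integral_fluxRadial_eq`), and the flux tends to the surface integral as ε → 0. Sharp truncation
and this regularization have the same limit: both kernels are even, so only the even part of the
sign function matters. Near x that part lives in a region |ℓ(z)| ≤ C|z|^{1+β} around the tangent
hyperplane, where |z|^{-N-α} is integrable (`hasPrincipalValue_of_tendsto_regularKernel`). The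
surface integral depends on e only through ⟨σ,e⟩, so reflections show that it is the same for every
e.

Linearization at κ. The derivative is computed under the integral. After subtracting v(s)·DH(κ)1,
what remains is a τ-derivative of (v(s) - v(s-τ)) τ D^{-p} plus v(s) - v(s-τ) times a coefficient.
Integration by parts on the sphere (`integral_sphere_divergence_eq_zero`) reduces the spherical
integral of this coefficient to α times the kernel. The boundary terms at |τ| = δ are O(δ^{β-α}).
Finally DH(κ)1 follows from the homogeneity H(κ) = cκ^{-α} and produces b_α. -/

noncomputable section

/-! ### The Banach algebra of uniformly Hölder families -/

/-- Families `F : ℝ → Θ → ℝ` that are bounded, measurable in the parameter `θ`, and Hölder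
continuous of order `γ` in the first variable, uniformly in `θ`. -/
def holderFamilySubalgebra (γ : ℝ) (Θ : Type*) [MeasurableSpace Θ] :
    Subalgebra ℝ (ℝ → Θ → ℝ) where
  carrier := {F | (∀ s, Measurable (F s)) ∧ (∃ C, ∀ s θ, |F s θ| ≤ C) ∧
    ∃ C, ∀ s t θ, |F s θ - F t θ| ≤ C * |s - t| ^ γ}
  mul_mem' := by
    rintro F G ⟨hF, ⟨A, hA⟩, B, hB⟩ ⟨hG, ⟨A', hA'⟩, B', hB'⟩
    refine ⟨fun s => (hF s).mul (hG s), ⟨A * A', fun s θ => ?_⟩, A * B' + B * A', fun s t θ => ?_⟩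
    · simp only [Pi.mul_apply, abs_mul]
      exact mul_le_mul (hA s θ) (hA' s θ) (abs_nonneg _) ((abs_nonneg _).trans (hA s θ))
    · have e : (F * G) s θ - (F * G) t θ = F s θ * (G s θ - G t θ) + (F s θ - F t θ) * G t θ := by
        simp only [Pi.mul_apply]; ring
      rw [e]
      refine (abs_add_le _ _).trans ?_
      rw [abs_mul, abs_mul, add_mul]
      refine add_le_add ?_ ?_
      · rw [mul_assoc]
        exact mul_le_mul (hA s θ) (hB' s t θ) (abs_nonneg _) ((abs_nonneg _).trans (hA s θ))
      · rw [mul_right_comm]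
        exact mul_le_mul (hB s t θ) (hA' t θ) (abs_nonneg _) ((abs_nonneg _).trans (hB s t θ))
  add_mem' := by
    rintro F G ⟨hF, ⟨A, hA⟩, B, hB⟩ ⟨hG, ⟨A', hA'⟩, B', hB'⟩
    refine ⟨fun s => (hF s).add (hG s), ⟨A + A', fun s θ => ?_⟩, B + B', fun s t θ => ?_⟩
    · exact (abs_add_le _ _).trans (add_le_add (hA s θ) (hA' s θ))
    · simp only [Pi.add_apply]
      rw [add_sub_add_comm, add_mul]
      exact (abs_add_le _ _).trans (add_le_add (hB s t θ) (hB' s t θ))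
  algebraMap_mem' c := ⟨fun _ => measurable_const, ⟨|c|, fun _ _ => le_rfl⟩, 0, fun s t θ => by
    simp [Pi.algebraMap_apply]⟩

/-- The algebra of uniformly Hölder families, with its own norm. -/
def HolderFamily (γ : ℝ) (Θ : Type*) [MeasurableSpace Θ] : Type _ :=
  ↥(holderFamilySubalgebra γ Θ)

namespace HolderFamily

variable {γ : ℝ} {Θ : Type*} [MeasurableSpace Θ]

instance : CommRing (HolderFamily γ Θ) :=
  inferInstanceAs (CommRing ↥(holderFamilySubalgebra γ Θ))

instance : Algebra ℝ (HolderFamily γ Θ) :=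
  inferInstanceAs (Algebra ℝ ↥(holderFamilySubalgebra γ Θ))

instance : CoeFun (HolderFamily γ Θ) (fun _ => ℝ → Θ → ℝ) := ⟨Subtype.val⟩

theorem ext {F G : HolderFamily γ Θ} (h : ∀ s θ, F s θ = G s θ) : F = G :=
  Subtype.ext (funext fun s => funext fun θ => h s θ)

theorem measurable (F : HolderFamily γ Θ) (s : ℝ) : Measurable (F s) := F.2.1 s

@[simp] theorem add_apply (F G : HolderFamily γ Θ) (s : ℝ) (θ : Θ) :
    (F + G) s θ = F s θ + G s θ := rfl

@[simp] theorem sub_apply (F G : HolderFamily γ Θ) (s : ℝ) (θ : Θ) :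
    (F - G) s θ = F s θ - G s θ := rfl

@[simp] theorem neg_apply (F : HolderFamily γ Θ) (s : ℝ) (θ : Θ) : (-F) s θ = -F s θ := rfl

@[simp] theorem mul_apply (F G : HolderFamily γ Θ) (s : ℝ) (θ : Θ) :
    (F * G) s θ = F s θ * G s θ := rfl

@[simp] theorem smul_apply (c : ℝ) (F : HolderFamily γ Θ) (s : ℝ) (θ : Θ) :
    (c • F) s θ = c * F s θ := rfl

@[simp] theorem zero_apply (s : ℝ) (θ : Θ) : (0 : HolderFamily γ Θ) s θ = 0 := rfl

@[simp] theorem pow_apply (F : HolderFamily γ Θ) (n : ℕ) (s : ℝ) (θ : Θ) :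
    (F ^ n) s θ = F s θ ^ n := rfl

/-- The supremum of a uniformly Hölder family. -/
def supNorm (F : HolderFamily γ Θ) : ℝ := ⨆ p : ℝ × Θ, |F p.1 p.2|

/-- The uniform Hölder seminorm of a family. -/
def seminorm (F : HolderFamily γ Θ) : ℝ :=
  ⨆ p : (ℝ × ℝ) × Θ, |F p.1.1 p.2 - F p.1.2 p.2| / |p.1.1 - p.1.2| ^ γ

theorem supNorm_nonneg (F : HolderFamily γ Θ) : 0 ≤ F.supNorm :=
  Real.iSup_nonneg fun _ => abs_nonneg _

theorem seminorm_nonneg (F : HolderFamily γ Θ) : 0 ≤ F.seminorm :=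
  Real.iSup_nonneg fun _ => div_nonneg (abs_nonneg _) (Real.rpow_nonneg (abs_nonneg _) _)

theorem abs_apply_le_supNorm (F : HolderFamily γ Θ) (s : ℝ) (θ : Θ) : |F s θ| ≤ F.supNorm := by
  obtain ⟨C, hC⟩ := F.2.2.1
  exact le_ciSup (f := fun p : ℝ × Θ => |F p.1 p.2|)
    ⟨C, by rintro _ ⟨p, rfl⟩; exact hC p.1 p.2⟩ (s, θ)

theorem abs_sub_le_seminorm (F : HolderFamily γ Θ) (s t : ℝ) (θ : Θ) :
    |F s θ - F t θ| ≤ F.seminorm * |s - t| ^ γ := by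
  obtain ⟨C, hC⟩ := F.2.2.2
  rcases eq_or_ne s t with rfl | hst
  · simp only [sub_self, abs_zero]
    exact mul_nonneg F.seminorm_nonneg (Real.rpow_nonneg le_rfl _)
  have hp : 0 < |s - t| ^ γ := Real.rpow_pos_of_pos (abs_pos.2 (sub_ne_zero.2 hst)) _
  rw [← div_le_iff₀ hp]
  refine le_ciSup (f := fun p : (ℝ × ℝ) × Θ =>
    |F p.1.1 p.2 - F p.1.2 p.2| / |p.1.1 - p.1.2| ^ γ) ⟨max C 0, ?_⟩ ((s, t), θ)
  rintro _ ⟨p, rfl⟩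
  refine div_le_of_le_mul₀ (Real.rpow_nonneg (abs_nonneg _) _) (le_max_right _ _) ?_
  exact (hC _ _ _).trans
    (mul_le_mul_of_nonneg_right (le_max_left _ _) (Real.rpow_nonneg (abs_nonneg _) _))

theorem supNorm_le {F : HolderFamily γ Θ} {C : ℝ} (hC : 0 ≤ C) (h : ∀ s θ, |F s θ| ≤ C) :
    F.supNorm ≤ C := Real.iSup_le (fun p => h p.1 p.2) hC

theorem seminorm_le {F : HolderFamily γ Θ} {C : ℝ} (hC : 0 ≤ C)
    (h : ∀ s t θ, |F s θ - F t θ| ≤ C * |s - t| ^ γ) : F.seminorm ≤ C :=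
  Real.iSup_le (fun p => div_le_of_le_mul₀ (Real.rpow_nonneg (abs_nonneg _) _) hC
    (h p.1.1 p.1.2 p.2)) hC

theorem supNorm_mul_le (F G : HolderFamily γ Θ) :
    (F * G).supNorm ≤ F.supNorm * G.supNorm := by
  refine supNorm_le (mul_nonneg F.supNorm_nonneg G.supNorm_nonneg) fun s θ => ?_
  rw [mul_apply, abs_mul]
  exact mul_le_mul (F.abs_apply_le_supNorm s θ) (G.abs_apply_le_supNorm s θ) (abs_nonneg _)
    F.supNorm_nonneg

theorem seminorm_mul_le (F G : HolderFamily γ Θ) :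
    (F * G).seminorm ≤ F.supNorm * G.seminorm + F.seminorm * G.supNorm := by
  have h1 := F.supNorm_nonneg
  have h2 := G.supNorm_nonneg
  have h3 := F.seminorm_nonneg
  have h4 := G.seminorm_nonneg
  refine seminorm_le (by positivity) fun s t θ => ?_
  have e : (F * G) s θ - (F * G) t θ = F s θ * (G s θ - G t θ) + (F s θ - F t θ) * G t θ := by
    simp only [mul_apply]; ring
  rw [e]
  refine (abs_add_le _ _).trans ?_
  rw [abs_mul, abs_mul, add_mul]
  refine add_le_add ?_ ?_
  · rw [mul_assoc]
    exact mul_le_mul (F.abs_apply_le_supNorm s θ) (G.abs_sub_le_seminorm s t θ) (abs_nonneg _) h1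
  · rw [mul_right_comm]
    exact mul_le_mul (F.abs_sub_le_seminorm s t θ) (G.abs_apply_le_supNorm t θ) (abs_nonneg _)
      (mul_nonneg h3 (Real.rpow_nonneg (abs_nonneg _) _))

theorem supNorm_add_le (F G : HolderFamily γ Θ) : (F + G).supNorm ≤ F.supNorm + G.supNorm :=
  supNorm_le (add_nonneg F.supNorm_nonneg G.supNorm_nonneg) fun s θ =>
    (abs_add_le _ _).trans (add_le_add (F.abs_apply_le_supNorm s θ) (G.abs_apply_le_supNorm s θ))

theorem seminorm_add_le (F G : HolderFamily γ Θ) :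
    (F + G).seminorm ≤ F.seminorm + G.seminorm := by
  refine seminorm_le (add_nonneg F.seminorm_nonneg G.seminorm_nonneg) fun s t θ => ?_
  rw [add_apply, add_apply, add_sub_add_comm, add_mul]
  exact (abs_add_le _ _).trans
    (add_le_add (F.abs_sub_le_seminorm s t θ) (G.abs_sub_le_seminorm s t θ))

theorem supNorm_smul_le (c : ℝ) (F : HolderFamily γ Θ) : (c • F).supNorm ≤ |c| * F.supNorm :=
  supNorm_le (mul_nonneg (abs_nonneg c) F.supNorm_nonneg) fun s θ => by
    rw [smul_apply, abs_mul]
    exact mul_le_mul_of_nonneg_left (F.abs_apply_le_supNorm s θ) (abs_nonneg c)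

theorem seminorm_smul_le (c : ℝ) (F : HolderFamily γ Θ) :
    (c • F).seminorm ≤ |c| * F.seminorm :=
  seminorm_le (mul_nonneg (abs_nonneg c) F.seminorm_nonneg) fun s t θ => by
    rw [smul_apply, smul_apply, ← mul_sub, abs_mul, mul_assoc]
    exact mul_le_mul_of_nonneg_left (F.abs_sub_le_seminorm s t θ) (abs_nonneg c)

/-- The sum of the supremum and of the Hölder seminorm is a norm. -/
def addGroupNorm (γ : ℝ) (Θ : Type*) [MeasurableSpace Θ] : AddGroupNorm (HolderFamily γ Θ) where
  toFun F := F.supNorm + F.seminorm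
  map_zero' := by
    have h1 : (0 : HolderFamily γ Θ).supNorm ≤ 0 := supNorm_le le_rfl fun s θ => by simp
    have h2 : (0 : HolderFamily γ Θ).seminorm ≤ 0 := seminorm_le le_rfl fun s t θ => by simp
    have h3 := supNorm_nonneg (0 : HolderFamily γ Θ)
    have h4 := seminorm_nonneg (0 : HolderFamily γ Θ)
    linarith
  add_le' F G := by
    have h1 := supNorm_add_le F G
    have h2 := seminorm_add_le F G
    linarith
  neg' F := by
    have h1 : (-F).supNorm = F.supNorm := by simp [supNorm]
    have h2 : (-F).seminorm = F.seminorm := by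
      simp only [seminorm, neg_apply, neg_sub_neg]
      exact iSup_congr fun p => by rw [abs_sub_comm]
    rw [h1, h2]
  eq_zero_of_map_eq_zero' F hF := by
    have h1 := F.supNorm_nonneg
    have h2 := F.seminorm_nonneg
    have hF' : F.supNorm + F.seminorm = 0 := hF
    refine HolderFamily.ext fun s θ => ?_
    exact abs_eq_zero.1 (le_antisymm ((F.abs_apply_le_supNorm s θ).trans (by linarith))
      (abs_nonneg _))

instance : NormedAddCommGroup (HolderFamily γ Θ) := (addGroupNorm γ Θ).toNormedAddCommGroup

theorem norm_def (F : HolderFamily γ Θ) : ‖F‖ = F.supNorm + F.seminorm := rfl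

/-- The Leibniz estimate for the seminorm gives three of the four terms of the product of the norms,
the missing one being the product of the two seminorms. Hence the plain sum of sup norm and seminorm
is submultiplicative with constant 1. -/
instance : NormedCommRing (HolderFamily γ Θ) where
  __ := (inferInstance : CommRing (HolderFamily γ Θ))
  __ := (inferInstance : NormedAddCommGroup (HolderFamily γ Θ))
  norm_mul_le F G := by
    rw [norm_def, norm_def, norm_def]
    have h1 := supNorm_mul_le F G
    have h2 := seminorm_mul_le F G
    have h3 := mul_nonneg F.seminorm_nonneg G.seminorm_nonneg
    linarith

instance : NormedAlgebra ℝ (HolderFamily γ Θ) where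
  norm_smul_le c F := by
    rw [norm_def, norm_def, Real.norm_eq_abs, mul_add]
    exact add_le_add (supNorm_smul_le c F) (seminorm_smul_le c F)

theorem abs_apply_le (F : HolderFamily γ Θ) (s : ℝ) (θ : Θ) : |F s θ| ≤ ‖F‖ :=
  (F.abs_apply_le_supNorm s θ).trans (le_add_of_nonneg_right F.seminorm_nonneg)

theorem abs_sub_le (F : HolderFamily γ Θ) (s t : ℝ) (θ : Θ) :
    |F s θ - F t θ| ≤ ‖F‖ * |s - t| ^ γ :=
  (F.abs_sub_le_seminorm s t θ).trans (mul_le_mul_of_nonneg_right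
    (le_add_of_nonneg_left F.supNorm_nonneg) (Real.rpow_nonneg (abs_nonneg _) _))

theorem norm_le {F : HolderFamily γ Θ} {A B : ℝ} (hA : 0 ≤ A) (hB : 0 ≤ B)
    (h1 : ∀ s θ, |F s θ| ≤ A) (h2 : ∀ s t θ, |F s θ - F t θ| ≤ B * |s - t| ^ γ) :
    ‖F‖ ≤ A + B :=
  add_le_add (supNorm_le hA h1) (seminorm_le hB h2)

/-- A uniformly Hölder family from its bounds. -/
def ofBounds (f : ℝ → Θ → ℝ) (hm : ∀ s, Measurable (f s)) (hb : ∃ C, ∀ s θ, |f s θ| ≤ C)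
    (hh : ∃ C, ∀ s t θ, |f s θ - f t θ| ≤ C * |s - t| ^ γ) : HolderFamily γ Θ := ⟨f, hm, hb, hh⟩

@[simp] theorem ofBounds_apply (f : ℝ → Θ → ℝ) (hm hb hh) (s : ℝ) (θ : Θ) :
    (ofBounds f hm hb hh : HolderFamily γ Θ) s θ = f s θ := rfl

/-- Evaluation at a point, as a continuous linear form. -/
def evalCLM (s : ℝ) (θ : Θ) : HolderFamily γ Θ →L[ℝ] ℝ :=
  LinearMap.mkContinuous
    { toFun := fun F => F s θ
      map_add' := fun _ _ => rfl
      map_smul' := fun _ _ => rfl } 1 fun F => by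
    rw [one_mul]; exact F.abs_apply_le s θ

@[simp] theorem evalCLM_apply (s : ℝ) (θ : Θ) (F : HolderFamily γ Θ) : evalCLM s θ F = F s θ := rfl

/-- A Cauchy sequence converges pointwise, and the bound, the Hölder estimate and measurability in
the parameter all pass to pointwise limits. Completeness is what makes the binomial series below
converge in the algebra. -/
instance : CompleteSpace (HolderFamily γ Θ) := by
  refine Metric.complete_of_cauchySeq_tendsto fun u hu => ?_
  have hev : ∀ s θ, ∃ l, Tendsto (fun n => u n s θ) atTop (𝓝 l) := fun s θ =>
    cauchySeq_tendsto_of_complete (hu.map (evalCLM s θ).uniformContinuous)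
  choose f hf using hev
  obtain ⟨C, hC⟩ : ∃ C, ∀ n, ‖u n‖ ≤ C := by
    obtain ⟨C, hC⟩ := hu.norm_bddAbove
    exact ⟨C, fun n => hC ⟨n, rfl⟩⟩
  refine ⟨ofBounds f (fun s => ?_) ⟨C, fun s θ => ?_⟩ ⟨C, fun s t θ => ?_⟩, ?_⟩
  · exact measurable_of_tendsto_metrizable (fun n => (u n).measurable s)
      (tendsto_pi_nhds.2 fun θ => hf s θ)
  · exact le_of_tendsto (hf s θ).abs (Eventually.of_forall fun n =>
      ((u n).abs_apply_le s θ).trans (hC n))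
  · refine le_of_tendsto ((hf s θ).sub (hf t θ)).abs (Eventually.of_forall fun n =>
      ((u n).abs_sub_le s t θ).trans ?_)
    exact mul_le_mul_of_nonneg_right (hC n) (Real.rpow_nonneg (abs_nonneg _) _)
  rw [Metric.tendsto_atTop]
  intro ε hε
  obtain ⟨N, hN⟩ := Metric.cauchySeq_iff.1 hu (ε / 4) (by positivity)
  refine ⟨N, fun m hm => ?_⟩
  have hb : ∀ n ≥ N, ‖u m - u n‖ ≤ ε / 4 := fun n hn => by
    rw [← dist_eq_norm]; exact (hN m hm n hn).le
  rw [dist_eq_norm]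
  refine lt_of_le_of_lt (norm_le (A := ε / 4) (B := ε / 4) (by positivity) (by positivity)
    (fun s θ => ?_) fun s t θ => ?_) (by linarith)
  · refine le_of_tendsto (tendsto_const_nhds.sub (hf s θ)).abs ?_
    filter_upwards [eventually_ge_atTop N] with n hn
    exact ((u m - u n).abs_apply_le s θ).trans (hb n hn)
  · refine le_of_tendsto ((tendsto_const_nhds.sub (hf s θ)).sub
      (tendsto_const_nhds.sub (hf t θ))).abs ?_
    filter_upwards [eventually_ge_atTop N] with n hn
    exact ((u m - u n).abs_sub_le s t θ).trans
      (mul_le_mul_of_nonneg_right (hb n hn) (Real.rpow_nonneg (abs_nonneg _) _))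

/-! ### Real powers of positive families -/

theorem _root_.exists_lipschitz_rpow (a : ℝ) {c : ℝ} (hc : 0 < c) (C : ℝ) :
    ∃ K, 0 ≤ K ∧ ∀ x ∈ Icc c C, ∀ y ∈ Icc c C, |x ^ a - y ^ a| ≤ K * |x - y| := by
  have hcont : ContinuousOn (fun x : ℝ => a * x ^ (a - 1)) (Icc c C) := by
    refine continuousOn_const.mul (continuousOn_id.rpow_const fun x hx => Or.inl ?_)
    exact (hc.trans_le hx.1).ne'
  obtain ⟨K, hK⟩ := isCompact_Icc.exists_bound_of_continuousOn hcont
  refine ⟨max K 0, le_max_right _ _, fun x hx y hy => ?_⟩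
  have := (convex_Icc c C).norm_image_sub_le_of_norm_hasDerivWithin_le (f := fun x : ℝ => x ^ a)
    (f' := fun x => a * x ^ (a - 1)) (C := max K 0)
    (fun z hz => (Real.hasDerivAt_rpow_const (Or.inl (hc.trans_le hz.1).ne')).hasDerivWithinAt)
    (fun z hz => (hK z hz).trans (le_max_left _ _)) hy hx
  simpa [Real.norm_eq_abs] using this

/-- Families bounded below by a positive constant. -/
def IsPositive (F : HolderFamily γ Θ) : Prop := ∃ c > 0, ∀ s θ, c ≤ F s θ

open Classical in
/-- The pointwise real power of a positive family (and `0` for other families). -/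
def rpow (a : ℝ) (F : HolderFamily γ Θ) : HolderFamily γ Θ :=
  if h : F.IsPositive then
    ofBounds (fun s θ => F s θ ^ a) (fun s => (F.measurable s).pow_const a)
      (by
        obtain ⟨c, hc, hcF⟩ := h
        have hcont : ContinuousOn (fun x : ℝ => x ^ a) (Icc c ‖F‖) :=
          continuousOn_id.rpow_const fun x hx => Or.inl (hc.trans_le hx.1).ne'
        obtain ⟨K, hK⟩ := isCompact_Icc.exists_bound_of_continuousOn hcont
        exact ⟨K, fun s θ => hK _ ⟨hcF s θ, (le_abs_self _).trans (F.abs_apply_le s θ)⟩⟩)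
      (by
        obtain ⟨c, hc, hcF⟩ := h
        obtain ⟨K, hK0, hK⟩ := exists_lipschitz_rpow a hc ‖F‖
        refine ⟨K * ‖F‖, fun s t θ => ?_⟩
        refine (hK _ ⟨hcF s θ, (le_abs_self _).trans (F.abs_apply_le s θ)⟩ _
          ⟨hcF t θ, (le_abs_self _).trans (F.abs_apply_le t θ)⟩).trans ?_
        rw [mul_assoc]
        exact mul_le_mul_of_nonneg_left (F.abs_sub_le s t θ) hK0)
  else 0

theorem rpow_apply (a : ℝ) {F : HolderFamily γ Θ} (h : F.IsPositive) (s : ℝ) (θ : Θ) :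
    rpow a F s θ = F s θ ^ a := by
  rw [rpow, dif_pos h]; rfl

theorem eventually_isPositive {F : HolderFamily γ Θ} (h : F.IsPositive) :
    ∀ᶠ G in 𝓝 F, G.IsPositive := by
  obtain ⟨c, hc, hcF⟩ := h
  filter_upwards [Metric.ball_mem_nhds F (half_pos hc)] with G hG
  refine ⟨c / 2, half_pos hc, fun s θ => ?_⟩
  rw [Metric.mem_ball, dist_eq_norm] at hG
  have h1 := (abs_le.1 ((G - F).abs_apply_le s θ)).1
  rw [sub_apply] at h1
  linarith [hcF s θ]

/-- Each term of positive order has norm at most the absolute value of the scalar binomial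
coefficient, so the radius is at least that of the real series. The term of order zero is left out
of the comparison, since it involves the norm of the unit; one term does not affect summability. -/
theorem one_le_radius_binomialSeries (a : ℝ) :
    1 ≤ (binomialSeries (HolderFamily γ Θ) a).radius := by
  refine ENNReal.le_of_forall_nnreal_lt fun r hr => ?_
  have hr' : (r : ENNReal) < (binomialSeries ℝ a).radius :=
    hr.trans_le (Real.one_add_rpow_hasFPowerSeriesOnBall_zero (a := a)).r_le
  apply FormalMultilinearSeries.le_radius_of_summable_norm
  refine Summable.of_norm_bounded_eventually
    ((binomialSeries ℝ a).summable_norm_mul_pow hr') ?_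
  filter_upwards [eventually_cofinite_ne 0] with n hn
  rw [norm_mul, norm_norm, norm_pow, NNReal.norm_eq]
  refine mul_le_mul_of_nonneg_right ?_ (pow_nonneg r.2 n)
  refine (FormalMultilinearSeries.ofScalars_norm_le _ _ n (Nat.pos_of_ne_zero hn)).trans ?_
  exact (FormalMultilinearSeries.ofScalars_norm ℝ _ n).ge

/-- Evaluation at a point is continuous, linear and multiplicative, so it carries the series in the
algebra to the real binomial series at G(s,θ). -/
theorem sum_binomialSeries_apply (a : ℝ) {G : HolderFamily γ Θ} (hG : ‖G‖ < 1) (s : ℝ) (θ : Θ) :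
    (binomialSeries (HolderFamily γ Θ) a).sum G s θ = (1 + G s θ) ^ a := by
  have hG' : G ∈ Metric.eball (0 : HolderFamily γ Θ) (binomialSeries (HolderFamily γ Θ) a).radius := by
    refine Metric.eball_subset_eball (one_le_radius_binomialSeries a) ?_
    rw [Metric.mem_eball, edist_zero_right, ← ofReal_norm]
    exact ENNReal.ofReal_lt_one.2 hG
  have h1 := ((binomialSeries (HolderFamily γ Θ) a).hasSum hG').mapL (evalCLM s θ)
  have hx : G s θ ∈ Metric.eball (0 : ℝ) 1 := by
    rw [Metric.mem_eball, edist_zero_right, ← ofReal_norm]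
    exact ENNReal.ofReal_lt_one.2 ((G.abs_apply_le s θ).trans_lt hG)
  have h2 := (Real.one_add_rpow_hasFPowerSeriesOnBall_zero (a := a)).hasSum hx
  rw [zero_add] at h2
  refine h1.unique ?_
  have e : ∀ n, evalCLM s θ (binomialSeries (HolderFamily γ Θ) a n fun _ => G) =
      binomialSeries ℝ a n fun _ => G s θ := fun n => by
    rw [binomialSeries_apply, binomialSeries_apply, map_smul]
    simp
  simp_rw [e]
  exact h2

/-- Real powers are smooth on positive families. -/
theorem contDiffAt_rpow (a : ℝ) {F : HolderFamily γ Θ} (hF : F.IsPositive) :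
    ContDiffAt ℝ ∞ (rpow a) F := by
  set p := binomialSeries (HolderFamily γ Θ) a with hp
  have hrad : 0 < p.radius := zero_lt_one.trans_le (one_le_radius_binomialSeries a)
  have hsum : ContDiffAt ℝ ∞ p.sum 0 :=
    (p.hasFPowerSeriesOnBall hrad).analyticAt.contDiffAt
  -- From G = F(1 + (G - F)F⁻¹) one gets G^a = F^a (1 + (G - F)F⁻¹)^a, and the last factor is the
  -- binomial series at a small element when G is close to F.
  set inner : HolderFamily γ Θ → HolderFamily γ Θ := fun G => (G - F) * rpow (-1) F with hinner
  have hin : ContDiff ℝ ∞ inner := (contDiff_id.sub contDiff_const).mul contDiff_const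
  have h0 : inner F = 0 := by simp [hinner]
  have hcomp : ContDiffAt ℝ ∞ (fun G => rpow a F * p.sum (inner G)) F := by
    rw [← h0] at hsum
    exact contDiffAt_const.mul (hsum.comp F hin.contDiffAt)
  refine hcomp.congr_of_eventuallyEq ?_
  have hsmall : ∀ᶠ G in 𝓝 F, ‖inner G‖ < 1 := by
    have := hin.continuous.norm.continuousAt (x := F)
    rw [ContinuousAt, h0, norm_zero] at this
    exact this.eventually (gt_mem_nhds zero_lt_one)
  filter_upwards [eventually_isPositive hF, hsmall] with G hG hG1
  obtain ⟨c, hc, hcF⟩ := hF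
  refine HolderFamily.ext fun s θ => ?_
  have hFpos : 0 < F s θ := hc.trans_le (hcF s θ)
  have h1 := (abs_lt.1 (((inner G).abs_apply_le s θ).trans_lt hG1)).1
  rw [mul_apply, sum_binomialSeries_apply a hG1, rpow_apply a hG, rpow_apply a ⟨c, hc, hcF⟩,
    ← Real.mul_rpow hFpos.le (by linarith)]
  congr 1
  simp only [hinner, mul_apply, sub_apply, rpow_apply (-1) ⟨c, hc, hcF⟩, Real.rpow_neg_one]
  field_simp
  ring

end HolderFamily

/-! ### Polar coordinates and the sphere -/

section Sphere

theorem abs_inner_sphere_le {V : Type*} [NormedAddCommGroup V] [InnerProductSpace ℝ V] {e : V} (he : ‖e‖ = 1) (σ : Metric.sphere (0 : V) 1) :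
    |inner ℝ (σ : V) e| ≤ 1 := by
  have := abs_real_inner_le_norm (σ : V) e
  rwa [he, mul_one, norm_eq_of_mem_sphere] at this

variable {V : Type*} [NormedAddCommGroup V] [InnerProductSpace ℝ V] [FiniteDimensional ℝ V]
  [MeasurableSpace V] [BorelSpace V]

/-- The surface measure of the unit sphere of a Euclidean space. -/
def surfaceMeasure (V : Type*) [NormedAddCommGroup V] [InnerProductSpace ℝ V]
    [FiniteDimensional ℝ V] [MeasurableSpace V] [BorelSpace V] :
    Measure (Metric.sphere (0 : V) 1) := (volume : Measure V).toSphere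

instance : IsFiniteMeasure (surfaceMeasure V) := by unfold surfaceMeasure; infer_instance

/-- The radial measure `r^k dr` on `(0, ∞)`. -/
def radialMeasure (k : ℕ) : Measure ℝ :=
  (volume.restrict (Ioi (0 : ℝ))).withDensity fun r => ENNReal.ofReal (r ^ k)

instance (k : ℕ) : SFinite (radialMeasure k) := by unfold radialMeasure; infer_instance

theorem map_volumeIoiPow (k : ℕ) :
    (Measure.volumeIoiPow k).map Subtype.val = radialMeasure k := by
  refine Measure.ext fun s hs => ?_
  have hemb : MeasurableEmbedding (Subtype.val : Ioi (0 : ℝ) → ℝ) :=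
    MeasurableEmbedding.subtype_coe measurableSet_Ioi
  rw [Measure.map_apply measurable_subtype_coe hs, Measure.volumeIoiPow, radialMeasure,
    withDensity_apply _ (measurable_subtype_coe hs), withDensity_apply _ hs]
  have h1 : volume.restrict (Ioi (0 : ℝ)) =
      (Measure.comap Subtype.val (volume : Measure ℝ)).map (Subtype.val : Ioi (0 : ℝ) → ℝ) := by
    rw [hemb.map_comap, Subtype.range_coe]
  rw [h1, hemb.restrict_map, hemb.lintegral_map]

/-- Polar coordinates push the product of the surface measure and of `r^{n-1} dr` forward to
Lebesgue measure. -/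
theorem measurePreserving_polar [Nontrivial V] :
    MeasurePreserving (fun q : Metric.sphere (0 : V) 1 × ℝ => q.2 • (q.1 : V))
      ((surfaceMeasure V).prod (radialMeasure (Module.finrank ℝ V - 1))) volume := by
  have hmeas : Measurable (fun q : Metric.sphere (0 : V) 1 × ℝ => q.2 • (q.1 : V)) := by fun_prop
  refine ⟨hmeas, ?_⟩
  have hprod : (surfaceMeasure V).prod (radialMeasure (Module.finrank ℝ V - 1)) =
      ((surfaceMeasure V).prod (Measure.volumeIoiPow (Module.finrank ℝ V - 1))).map
        (Prod.map id Subtype.val) := by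
    rw [← Measure.map_prod_map _ _ measurable_id measurable_subtype_coe, Measure.map_id,
      map_volumeIoiPow]
  have hpol := (volume : Measure V).measurePreserving_homeomorphUnitSphereProd.symm
    (homeomorphUnitSphereProd V).toMeasurableEquiv
  rw [hprod, Measure.map_map hmeas (by fun_prop)]
  have hcomp : ((fun q : Metric.sphere (0 : V) 1 × ℝ => q.2 • (q.1 : V)) ∘
      (Prod.map id Subtype.val : Metric.sphere (0 : V) 1 × Ioi (0 : ℝ) → _)) =
      Subtype.val ∘ (homeomorphUnitSphereProd V).toMeasurableEquiv.symm := by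
    funext q; rfl
  rw [hcomp, ← Measure.map_map measurable_subtype_coe (MeasurableEquiv.measurable _)]
  have h2 := hpol.map_eq
  unfold surfaceMeasure
  rw [h2, (MeasurableEmbedding.subtype_coe (measurableSet_singleton (0 : V)).compl).map_comap,
    Subtype.range_coe, restrict_compl_singleton]

theorem integrable_polar_iff [Nontrivial V] {f : V → ℝ} (hf : AEStronglyMeasurable f volume) :
    Integrable (fun q : Metric.sphere (0 : V) 1 × ℝ => f (q.2 • (q.1 : V)))
      ((surfaceMeasure V).prod (radialMeasure (Module.finrank ℝ V - 1))) ↔ Integrable f :=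
  measurePreserving_polar.integrable_comp hf

theorem integral_polar [Nontrivial V] {f : V → ℝ} (hf : AEStronglyMeasurable f volume) :
    ∫ q : Metric.sphere (0 : V) 1 × ℝ, f (q.2 • (q.1 : V))
      ∂((surfaceMeasure V).prod (radialMeasure (Module.finrank ℝ V - 1))) = ∫ y, f y := by
  rw [← measurePreserving_polar.map_eq, integral_map measurePreserving_polar.measurable.aemeasurable]
  rwa [measurePreserving_polar.map_eq]

theorem lintegral_polar [Nontrivial V] {f : V → ENNReal} (hf : Measurable f) :
    ∫⁻ y, f y = ∫⁻ σ : Metric.sphere (0 : V) 1, (∫⁻ r in Ioi (0 : ℝ),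
      ENNReal.ofReal (r ^ (Module.finrank ℝ V - 1)) * f (r • (σ : V))) ∂(surfaceMeasure V) := by
  have hm : Measurable (fun q : Metric.sphere (0 : V) 1 × ℝ => f (q.2 • (q.1 : V))) := by fun_prop
  rw [← measurePreserving_polar.map_eq, lintegral_map hf measurePreserving_polar.measurable,
    lintegral_prod _ hm.aemeasurable]
  refine lintegral_congr fun σ => ?_
  rw [radialMeasure, lintegral_withDensity_eq_lintegral_mul _ (by fun_prop) (by fun_prop)]
  rfl

theorem integral_radialMeasure (k : ℕ) (g : ℝ → ℝ) :
    ∫ r, g r ∂(radialMeasure k) = ∫ r in Ioi (0 : ℝ), r ^ k * g r := by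
  rw [radialMeasure]
  have := integral_withDensity_eq_integral_smul (μ := volume.restrict (Ioi (0 : ℝ)))
    (f := fun r => Real.toNNReal (r ^ k)) (by fun_prop) g
  simp only [ENNReal.ofReal]
  rw [this]
  refine setIntegral_congr_fun measurableSet_Ioi fun r hr => ?_
  simp only [NNReal.smul_def, Real.coe_toNNReal _ (pow_nonneg (le_of_lt (mem_Ioi.1 hr)) k),
    smul_eq_mul]

/-! #### Isometries -/

/-- The action of a linear isometry on the unit sphere. -/
def sphereMap (R : V ≃ₗᵢ[ℝ] V) (σ : Metric.sphere (0 : V) 1) : Metric.sphere (0 : V) 1 :=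
  ⟨R σ, by simp⟩

-- The surface measure of a set is a multiple of the volume of the cone over it. A linear isometry
-- preserves volume and maps cones to cones.
open scoped Pointwise in
theorem measurePreserving_sphereMap (R : V ≃ₗᵢ[ℝ] V) :
    MeasurePreserving (sphereMap R) (surfaceMeasure V) (surfaceMeasure V) := by
  have hm : Measurable (sphereMap R) :=
    Measurable.subtype_mk (R.continuous.measurable.comp measurable_subtype_coe)
  refine ⟨hm, Measure.ext fun s hs => ?_⟩
  rw [Measure.map_apply hm hs, surfaceMeasure, Measure.toSphere_apply' _ hs,
    Measure.toSphere_apply' _ (hm hs)]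
  congr 1
  rw [← (R.measurePreserving).measure_preimage_emb R.toMeasurableEquiv.measurableEmbedding
    (Ioo (0 : ℝ) 1 • (Subtype.val '' s))]
  congr 1
  ext y
  simp only [Set.mem_smul, mem_image, mem_preimage]
  constructor
  · rintro ⟨r, hr, _, ⟨σ, hσ, rfl⟩, rfl⟩
    exact ⟨r, hr, _, ⟨_, hσ, rfl⟩, by simp [sphereMap]⟩
  · rintro ⟨r, hr, _, ⟨σ, hσ, rfl⟩, h⟩
    refine ⟨r, hr, _, ⟨sphereMap R.symm σ, ?_, rfl⟩, ?_⟩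
    · convert hσ using 1
      exact Subtype.ext (by simp [sphereMap])
    · apply R.injective
      rw [← h]
      simp [sphereMap]

theorem integral_sphereMap (R : V ≃ₗᵢ[ℝ] V) (g : Metric.sphere (0 : V) 1 → ℝ) :
    ∫ σ, g (sphereMap R σ) ∂(surfaceMeasure V) = ∫ σ, g σ ∂(surfaceMeasure V) := by
  have hemb : MeasurableEmbedding (sphereMap R) := by
    refine MeasurableEmbedding.of_measurable_inverse (g := sphereMap R.symm)
      (measurePreserving_sphereMap R).measurable ?_ (measurePreserving_sphereMap R.symm).measurable
      fun σ => Subtype.ext (by simp [sphereMap])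
    have : range (sphereMap R) = univ := by
      refine range_eq_univ.2 fun σ => ⟨sphereMap R.symm σ, Subtype.ext (by simp [sphereMap])⟩
    rw [this]; exact MeasurableSet.univ
  exact (measurePreserving_sphereMap R).integral_comp hemb g

/-- The reflection in the hyperplane orthogonal to e - e' exchanges the two vectors and preserves
the surface measure. This is the source of the independence of θ. -/
theorem integral_sphere_inner_eq (g : ℝ → ℝ) {e e' : V} (he : ‖e‖ = ‖e'‖) :
    ∫ σ : Metric.sphere (0 : V) 1, g (inner ℝ (σ : V) e) ∂(surfaceMeasure V) =
      ∫ σ : Metric.sphere (0 : V) 1, g (inner ℝ (σ : V) e') ∂(surfaceMeasure V) := by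
  set R := (Submodule.span ℝ {e - e'})ᗮ.reflection with hR
  have hRe : R e = e' := Submodule.reflection_sub he
  rw [← integral_sphereMap R fun σ => g (inner ℝ (σ : V) e')]
  refine integral_congr_ae (Eventually.of_forall fun σ => ?_)
  simp only [sphereMap]
  rw [← hRe, LinearIsometryEquiv.inner_map_map]

theorem integral_sphere_inner_eq_zero (e : V) :
    ∫ σ : Metric.sphere (0 : V) 1, inner ℝ (σ : V) e ∂(surfaceMeasure V) = 0 := by
  have h := integral_sphereMap (LinearIsometryEquiv.neg ℝ)
    fun σ : Metric.sphere (0 : V) 1 => inner ℝ (σ : V) e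
  simp only [sphereMap, LinearIsometryEquiv.coe_neg, inner_neg_left, integral_neg] at h
  linarith

end Sphere

/-! ### Integration by parts on the sphere -/

section SphereIdentity

variable {V : Type*} [NormedAddCommGroup V] [InnerProductSpace ℝ V] [FiniteDimensional ℝ V]
  [MeasurableSpace V] [BorelSpace V]

theorem inner_div_norm_mem_Icc {V : Type*} [NormedAddCommGroup V] [InnerProductSpace ℝ V] {e : V}
    (he : ‖e‖ = 1) (y : V) : inner ℝ y e / ‖y‖ ∈ Icc (-1 : ℝ) 1 := by
  have h := abs_real_inner_div_norm_mul_norm_le_one y e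
  rw [he, mul_one] at h
  exact abs_le.1 h

/-- The directional derivative of `y ↦ φ(‖y‖) f(⟪y, e⟫ / ‖y‖)` in polar coordinates. -/
theorem hasDerivAt_radial_mul_angular {V : Type*} [NormedAddCommGroup V] [InnerProductSpace ℝ V]
    {e : V} (he : ‖e‖ = 1) {φ f : ℝ → ℝ} {r : ℝ} (hr : 0 < r) (σ : Metric.sphere (0 : V) 1)
    (hφ : DifferentiableAt ℝ φ r) (hf : DifferentiableAt ℝ f (inner ℝ (σ : V) e)) :
    HasDerivAt (fun t : ℝ => φ ‖r • (σ : V) + t • e‖ *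
        f (inner ℝ (r • (σ : V) + t • e) e / ‖r • (σ : V) + t • e‖))
      (deriv φ r * inner ℝ (σ : V) e * f (inner ℝ (σ : V) e) +
        φ r * (deriv f (inner ℝ (σ : V) e) * ((1 - inner ℝ (σ : V) e ^ 2) / r))) 0 := by
  set x : ℝ := inner ℝ (σ : V) e with hx
  have hσ : ‖(σ : V)‖ = 1 := norm_eq_of_mem_sphere σ
  have hrσ : ‖r • (σ : V)‖ = r := by rw [norm_smul, hσ, mul_one, Real.norm_of_nonneg hr.le]
  have hy : HasDerivAt (fun t : ℝ => r • (σ : V) + t • e) e 0 := by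
    simpa using ((hasDerivAt_id (0 : ℝ)).smul_const e).const_add (r • (σ : V))
  have hN : HasDerivAt (fun t : ℝ => ‖r • (σ : V) + t • e‖) x 0 := by
    have h1 := hy.norm_sq
    have h2 := h1.sqrt (by simp [hrσ, hr.ne'])
    simp only [Real.sqrt_sq (norm_nonneg _), zero_smul, add_zero, hrσ, inner_smul_left] at h2
    refine h2.congr_deriv ?_
    simp only [conj_trivial]
    rw [← hx, Real.sqrt_sq hr.le]
    field_simp
  have hI : HasDerivAt (fun t : ℝ => inner ℝ (r • (σ : V) + t • e) e) 1 0 := by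
    have := hy.inner ℝ (hasDerivAt_const (0 : ℝ) e)
    simpa [he] using this
  have hQ : HasDerivAt (fun t : ℝ => inner ℝ (r • (σ : V) + t • e) e / ‖r • (σ : V) + t • e‖)
      ((1 - x ^ 2) / r) 0 := by
    refine (hI.fun_div hN (by simp [hrσ, hr.ne'])).congr_deriv ?_
    simp only [zero_smul, add_zero, hrσ, inner_smul_left, conj_trivial, ← hx]
    field_simp
  have hφ' : HasDerivAt (fun t : ℝ => φ ‖r • (σ : V) + t • e‖) (deriv φ r * x) 0 := by
    refine HasDerivAt.comp (0 : ℝ) (h₂ := φ) ?_ hN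
    simpa [hrσ] using hφ.hasDerivAt
  have hf' : HasDerivAt (fun t : ℝ => f (inner ℝ (r • (σ : V) + t • e) e / ‖r • (σ : V) + t • e‖))
      (deriv f x * ((1 - x ^ 2) / r)) 0 := by
    refine HasDerivAt.comp (0 : ℝ) (h₂ := f) ?_ hQ
    have h0 : inner ℝ (r • (σ : V) + (0 : ℝ) • e) e / ‖r • (σ : V) + (0 : ℝ) • e‖ = x := by
      simp only [zero_smul, add_zero, hrσ, inner_smul_left, conj_trivial, ← hx]
      field_simp
    rw [h0]
    exact hf.hasDerivAt
  have h0 : inner ℝ (r • (σ : V) + (0 : ℝ) • e) e / ‖r • (σ : V) + (0 : ℝ) • e‖ = x := by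
    simp only [zero_smul, add_zero, hrσ, inner_smul_left, conj_trivial, ← hx]
    field_simp
  refine (hφ'.fun_mul hf').congr_deriv ?_
  rw [h0]
  simp [hrσ]

/-- The angular variable is singular only at the origin, and the radial factor vanishes on a ball
around it. -/
theorem contDiff_radial_mul_angular {V : Type*} [NormedAddCommGroup V] [InnerProductSpace ℝ V]
    {e : V} (he : ‖e‖ = 1) {φ f : ℝ → ℝ} (hφ : ContDiff ℝ 1 φ) (hφ0 : ∀ r < 1, φ r = 0)
    (hf : ∀ x ∈ Icc (-1 : ℝ) 1, ContDiffAt ℝ 1 f x) :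
    ContDiff ℝ 1 fun y : V => φ ‖y‖ * f (inner ℝ y e / ‖y‖) := by
  rw [contDiff_iff_contDiffAt]
  intro y
  by_cases hy : y = 0
  · have : (fun y : V => φ ‖y‖ * f (inner ℝ y e / ‖y‖)) =ᶠ[𝓝 y] fun _ => 0 := by
      filter_upwards [Metric.ball_mem_nhds y zero_lt_one] with z hz
      rw [hy, mem_ball_zero_iff] at hz
      rw [hφ0 _ hz, zero_mul]
    exact contDiffAt_const.congr_of_eventuallyEq this
  · have hn : ContDiffAt ℝ 1 (fun y : V => ‖y‖) y := contDiffAt_norm ℝ hy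
    refine (hφ.contDiffAt.comp y hn).mul ?_
    have hq : ContDiffAt ℝ 1 (fun y : V => inner ℝ y e / ‖y‖) y :=
      (contDiffAt_id.inner ℝ contDiffAt_const).div hn (norm_ne_zero_iff.2 hy)
    exact (hf _ (inner_div_norm_mem_Icc he y)).comp y hq

/-- Integration by parts on the sphere: the spherical divergence of `f(⟪σ, e⟫) ∇⟪σ, e⟫` integrates
to zero. -/
theorem integral_sphere_divergence_eq_zero [Nontrivial V] {e : V} (he : ‖e‖ = 1) {f : ℝ → ℝ}
    (hf : ∀ x ∈ Icc (-1 : ℝ) 1, ContDiffAt ℝ 1 f x) :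
    ∫ σ : Metric.sphere (0 : V) 1, ((1 - inner ℝ (σ : V) e ^ 2) * deriv f (inner ℝ (σ : V) e) -
      ((Module.finrank ℝ V : ℝ) - 1) * (inner ℝ (σ : V) e * f (inner ℝ (σ : V) e)))
      ∂(surfaceMeasure V) = 0 := by
  set k := Module.finrank ℝ V - 1 with hk
  have hkr : (Module.finrank ℝ V : ℝ) - 1 = k := by
    have : 0 < Module.finrank ℝ V := Module.finrank_pos
    rw [hk, Nat.cast_sub (by omega)]; simp
  -- The radial cutoff lives in the shell 1 < r < 2, away from the origin. The identity follows by
  -- writing in polar coordinates that the e-derivative of b(|y|) f(⟨y,e⟩/|y|) has integral zero.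
  let b : ContDiffBump (3 / 2 : ℝ) := ⟨1 / 4, 1 / 2, by norm_num, by norm_num⟩
  have hb0 : ∀ r, r ≤ 1 → b r = 0 := fun r hr => by
    apply b.zero_of_le_dist
    rw [Real.dist_eq, abs_sub_comm, abs_of_nonneg (by linarith)]
    change (1 / 2 : ℝ) ≤ _
    linarith
  have hbcd : ContDiff ℝ 1 b := b.contDiff
  set F : V → ℝ := fun y => b ‖y‖ * f (inner ℝ y e / ‖y‖) with hF
  have hFcd : ContDiff ℝ 1 F := contDiff_radial_mul_angular he hbcd (fun r hr => hb0 r hr.le) hf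
  have hFcs : HasCompactSupport F := by
    refine HasCompactSupport.of_support_subset_isCompact (isCompact_closedBall (0 : V) 2)
      fun y hy => ?_
    by_contra hy2
    rw [mem_closedBall_zero_iff, not_le] at hy2
    refine hy ?_
    have : b ‖y‖ = 0 := by
      apply b.zero_of_le_dist
      rw [Real.dist_eq, abs_of_nonneg (by linarith)]
      change (1 / 2 : ℝ) ≤ _
      linarith
    simp [hF, this]
  have hdcont : Continuous fun y => fderiv ℝ F y e :=
    (hFcd.continuous_fderiv one_ne_zero).clm_apply continuous_const
  have hdcs : HasCompactSupport fun y => fderiv ℝ F y e := hFcs.fderiv_apply ℝ e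
  have hdint : Integrable (fun y => fderiv ℝ F y e) volume :=
    hdcont.integrable_of_hasCompactSupport hdcs
  have hzero : ∫ y, fderiv ℝ F y e = 0 := by
    have := integral_mul_fderiv_eq_neg_fderiv_mul_of_integrable (μ := (volume : Measure V))
      (f := fun _ : V => (1 : ℝ)) (g := F) (v := e) (by simp) (by simpa using hdint)
      (by simpa using hFcd.continuous.integrable_of_hasCompactSupport hFcs)
      (fun x _ => differentiableAt_const _)
      (fun x _ => (hFcd.differentiable one_ne_zero).differentiableAt)
    simpa using this
  rw [← integral_polar hdcont.aestronglyMeasurable,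
    integral_prod _ ((integrable_polar_iff hdcont.aestronglyMeasurable).2 hdint)] at hzero
  simp only [integral_radialMeasure, ← hk] at hzero
  set c := ∫ r in Ioi (0 : ℝ), b r * (r ^ k / r) with hc
  have hψcd : ContDiff ℝ 1 fun r : ℝ => b r * r ^ k := hbcd.mul (contDiff_id.pow k)
  have hψcs : HasCompactSupport fun r : ℝ => b r * r ^ k := b.hasCompactSupport.mul_right
  have hψint : Integrable (deriv fun r : ℝ => b r * r ^ k) volume :=
    (hψcd.continuous_deriv le_rfl).integrable_of_hasCompactSupport hψcs.deriv
  have hψzero : ∫ r in Ioi (0 : ℝ), deriv (fun r : ℝ => b r * r ^ k) r = 0 := by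
    rw [setIntegral_eq_integral_of_forall_compl_eq_zero]
    · exact integral_eq_zero_of_hasDerivAt_of_integrable
        (fun r => (hψcd.differentiable one_ne_zero).differentiableAt.hasDerivAt) hψint
        (hψcd.continuous.integrable_of_hasCompactSupport hψcs)
    · intro r hr
      have : (fun r : ℝ => b r * r ^ k) =ᶠ[𝓝 r] fun _ => 0 := by
        have hr1 : r < 1 := by simp only [mem_Ioi, not_lt] at hr; linarith
        filter_upwards [gt_mem_nhds hr1] with s hs
        rw [hb0 s (le_of_lt hs), zero_mul]
      rw [this.deriv_eq, deriv_const]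
  have hcint0 : Integrable (fun r : ℝ => b r * (r ^ k / r)) volume := by
    have hcont : Continuous fun r : ℝ => b r * (r ^ k / r) := by
      rw [continuous_iff_continuousAt]
      intro r
      by_cases hr : r < 1
      · have : (fun r : ℝ => b r * (r ^ k / r)) =ᶠ[𝓝 r] fun _ => 0 := by
          filter_upwards [gt_mem_nhds hr] with s hs
          rw [hb0 s (le_of_lt hs), zero_mul]
        exact continuousAt_const.congr this.symm
      · have hr0 : r ≠ 0 := by linarith
        exact b.continuous.continuousAt.mul
          ((continuousAt_id.pow k).div continuousAt_id hr0)
    exact hcont.integrable_of_hasCompactSupport b.hasCompactSupport.mul_right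
  have hcpos : 0 < c := by
    rw [hc, setIntegral_pos_iff_support_of_nonneg_ae]
    · refine lt_of_lt_of_le ?_ (measure_mono (s := Ioo (1 : ℝ) 2) ?_)
      · simp [Real.volume_Ioo]
      · intro r hr
        have hr0 : 0 < r := by linarith [hr.1]
        refine ⟨?_, hr0⟩
        have hbp : 0 < b r := by
          apply b.pos_of_mem_ball
          rw [Metric.mem_ball, Real.dist_eq, abs_lt]
          change -(1 / 2 : ℝ) < _ ∧ _ < (1 / 2 : ℝ)
          constructor <;> linarith [hr.1, hr.2]
        exact (mul_pos hbp (by positivity)).ne'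
    · filter_upwards [ae_restrict_mem measurableSet_Ioi] with r hr
      have hr0 : 0 < r := hr
      exact mul_nonneg b.nonneg (by positivity)
    · exact hcint0.integrableOn
  have hinner : ∀ σ : Metric.sphere (0 : V) 1,
      ∫ r in Ioi (0 : ℝ), r ^ k * fderiv ℝ F (r • (σ : V)) e =
      c * ((1 - inner ℝ (σ : V) e ^ 2) * deriv f (inner ℝ (σ : V) e) -
      ((Module.finrank ℝ V : ℝ) - 1) * (inner ℝ (σ : V) e * f (inner ℝ (σ : V) e))) := by
    intro σ
    set x : ℝ := inner ℝ (σ : V) e with hx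
    have hxm : x ∈ Icc (-1 : ℝ) 1 := abs_le.1 (abs_inner_sphere_le he σ)
    set J := (1 - x ^ 2) * deriv f x - ((Module.finrank ℝ V : ℝ) - 1) * (x * f x) with hJ
    -- The radial derivative of b is completed to that of b·r^k, whose integral vanishes. The
    -- correction is exactly the term k x f, so what is left is a positive radial constant times the
    -- integrand J of the identity.
    have hpt : ∀ r ∈ Ioi (0 : ℝ), r ^ k * fderiv ℝ F (r • (σ : V)) e =
        x * f x * deriv (fun r : ℝ => b r * r ^ k) r + J * (b r * (r ^ k / r)) := by
      intro r hr
      have hr0 : 0 < r := hr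
      have h1 := hasDerivAt_radial_mul_angular he hr0 σ
        (hbcd.differentiable one_ne_zero).differentiableAt ((hf x hxm).differentiableAt one_ne_zero)
      have h2 : HasDerivAt (fun t : ℝ => F (r • (σ : V) + t • e)) (fderiv ℝ F (r • (σ : V)) e) 0 :=
        ((hFcd.differentiable one_ne_zero).differentiableAt.hasFDerivAt).hasLineDerivAt e
      have h3 := h2.unique h1
      have h4 : deriv (fun r : ℝ => b r * r ^ k) r = deriv b r * r ^ k + b r * (k * (r ^ k / r)) := by
        have h5 : HasDerivAt (fun r : ℝ => r ^ k) (k * (r ^ k / r)) r := by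
          refine (hasDerivAt_pow k r).congr_deriv ?_
          rcases Nat.eq_zero_or_pos k with h | h
          · simp [h]
          · obtain ⟨j, hj⟩ := Nat.exists_eq_add_of_lt h
            rw [hj, zero_add, pow_succ, Nat.add_sub_cancel]
            field_simp
        exact ((hbcd.differentiable one_ne_zero).differentiableAt.hasDerivAt.fun_mul h5).deriv
      rw [h3, h4, hJ, hkr]
      field_simp
      ring
    rw [setIntegral_congr_fun measurableSet_Ioi hpt, integral_add
      (hψint.integrableOn.const_mul _) (hcint0.integrableOn.const_mul _), integral_const_mul,
      integral_const_mul, hψzero, ← hc]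
    ring
  simp only [hinner, integral_const_mul] at hzero
  exact (mul_eq_zero.1 hzero).resolve_left hcpos.ne'

end SphereIdentity

/-! ### Integrability of the ring kernel near its singularity -/

section Kernel

variable {V : Type*} [NormedAddCommGroup V] [InnerProductSpace ℝ V]

/-- `1 - ⟪σ, e⟫` for a point `σ` of the unit sphere. -/
def sphereDefect (e : V) (σ : Metric.sphere (0 : V) 1) : ℝ := 1 - inner ℝ (σ : V) e

/-- The kernel `(τ² + 2 (1 - ⟪σ, e⟫))^{-p}`. -/
def ringKernel (e : V) (p : ℝ) (q : ℝ × Metric.sphere (0 : V) 1) : ℝ :=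
  (q.1 ^ 2 + 2 * sphereDefect e q.2) ^ (-p)

theorem sphereDefect_nonneg {e : V} (he : ‖e‖ = 1) (σ : Metric.sphere (0 : V) 1) :
    0 ≤ sphereDefect e σ := by
  have := (abs_le.1 (abs_inner_sphere_le he σ)).2
  unfold sphereDefect; linarith

theorem sphereDefect_le {e : V} (he : ‖e‖ = 1) (σ : Metric.sphere (0 : V) 1) :
    sphereDefect e σ ≤ 2 := by
  have := (abs_le.1 (abs_inner_sphere_le he σ)).1
  unfold sphereDefect; linarith

theorem ringKernel_nonneg {e : V} (he : ‖e‖ = 1) (p : ℝ) (q : ℝ × Metric.sphere (0 : V) 1) :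
    0 ≤ ringKernel e p q :=
  Real.rpow_nonneg (add_nonneg (sq_nonneg _) (mul_nonneg zero_le_two (sphereDefect_nonneg he _))) _

theorem sq_rpow_neg (p : ℝ) (τ : ℝ) : (τ ^ 2) ^ (-p) = |τ| ^ (-(2 * p)) := by
  rw [← sq_abs, ← Real.rpow_natCast, ← Real.rpow_mul (abs_nonneg _)]
  congr 1; push_cast; ring

theorem ringKernel_le {e : V} (he : ‖e‖ = 1) {p : ℝ} (hp : 0 ≤ p) {τ : ℝ} (hτ : τ ≠ 0)
    (σ : Metric.sphere (0 : V) 1) : ringKernel e p (τ, σ) ≤ |τ| ^ (-(2 * p)) := by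
  have h := sphereDefect_nonneg he σ
  rw [← sq_rpow_neg]
  exact Real.rpow_le_rpow_of_nonpos (by positivity) (by simp only; linarith) (by linarith)

variable [FiniteDimensional ℝ V] [MeasurableSpace V] [BorelSpace V]

theorem measurable_sphereDefect (e : V) : Measurable (sphereDefect e) := by
  unfold sphereDefect; fun_prop

theorem measurable_ringKernel (e : V) (p : ℝ) : Measurable (ringKernel e p) := by
  have := measurable_sphereDefect e
  unfold ringKernel; fun_prop

theorem integrable_ringKernel_section {e : V} (he : ‖e‖ = 1) {p : ℝ} (hp : 0 ≤ p) {τ : ℝ}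
    (hτ : τ ≠ 0) : Integrable (fun σ => ringKernel e p (τ, σ)) (surfaceMeasure V) := by
  refine Integrable.of_bound
    ((measurable_ringKernel e p).comp measurable_prodMk_left).aestronglyMeasurable
    (|τ| ^ (-(2 * p))) (Eventually.of_forall fun σ => ?_)
  rw [Real.norm_of_nonneg (ringKernel_nonneg he p _)]
  exact ringKernel_le he hp hτ σ

theorem integral_regularized_kernel {p : ℝ} (e : V) {t : ℝ} (ht : 0 < t) :
    ∫ y : V, (t ^ 2 + ‖y - e‖ ^ 2) ^ (-p) =
      t ^ ((Module.finrank ℝ V : ℝ) - 2 * p) * ∫ y : V, (1 + ‖y‖ ^ 2) ^ (-p) := by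
  rw [integral_sub_right_eq_self (fun y : V => (t ^ 2 + ‖y‖ ^ 2) ^ (-p)) e]
  have h := Measure.integral_comp_smul (volume : Measure V)
    (fun y : V => (t ^ 2 + ‖y‖ ^ 2) ^ (-p)) t
  have h1 : ∀ y : V, (t ^ 2 + ‖t • y‖ ^ 2) ^ (-p) = t ^ (-(2 * p)) * (1 + ‖y‖ ^ 2) ^ (-p) := by
    intro y
    rw [norm_smul, Real.norm_of_nonneg ht.le, mul_pow, ← mul_one_add,
      Real.mul_rpow (by positivity) (by positivity), sq_rpow_neg, abs_of_pos ht]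
  simp only [h1, integral_const_mul, smul_eq_mul] at h
  rw [abs_of_pos (by positivity)] at h
  have h2 : t ^ ((Module.finrank ℝ V : ℝ) - 2 * p) =
      t ^ Module.finrank ℝ V * t ^ (-(2 * p)) := by
    rw [sub_eq_add_neg, Real.rpow_add ht, Real.rpow_natCast]
  rw [h2, mul_assoc, h]
  field_simp

/-- The integral of the ring kernel over the sphere is `O(|τ|^{n-1-2p})`. -/
theorem exists_integral_ringKernel_le [Nontrivial V] {e : V} (he : ‖e‖ = 1) {p : ℝ}
    (hp : (Module.finrank ℝ V : ℝ) < 2 * p) :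
    ∃ C, 0 ≤ C ∧ ∀ τ, τ ≠ 0 → ∫ σ, ringKernel e p (τ, σ) ∂(surfaceMeasure V) ≤
      C * |τ| ^ ((Module.finrank ℝ V : ℝ) - 1 - 2 * p) := by
  have hn : 0 < Module.finrank ℝ V := Module.finrank_pos
  have hp0 : 0 ≤ p := by have : (0 : ℝ) < Module.finrank ℝ V := by exact_mod_cast hn
                         linarith
  set I := ∫ y : V, (1 + ‖y‖ ^ 2) ^ (-p) with hI
  set m := (surfaceMeasure V).real univ with hm
  have hI0 : 0 ≤ I := integral_nonneg fun y => Real.rpow_nonneg (by positivity) _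
  have hint1 : Integrable (fun y : V => (1 + ‖y‖ ^ 2) ^ (-p)) := by
    have := integrable_rpow_neg_one_add_norm_sq (μ := (volume : Measure V)) hp
    simpa [neg_div] using this
  refine ⟨2 ^ p * I + m, by positivity, fun τ hτ => ?_⟩
  have ht : 0 < |τ| := abs_pos.2 hτ
  -- For |τ| ≥ 1 the pointwise bound |τ|^{-2p} is already enough; the constant m is the total mass
  -- of the sphere. The singular range is compared with an integral over the whole space.
  rcases le_or_gt 1 |τ| with h1 | h1
  · calc ∫ σ, ringKernel e p (τ, σ) ∂(surfaceMeasure V)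
        ≤ ∫ σ, |τ| ^ (-(2 * p)) ∂(surfaceMeasure V) :=
          integral_mono (integrable_ringKernel_section he hp0 hτ) (integrable_const _)
            (fun σ => ringKernel_le he hp0 hτ σ)
      _ = m * |τ| ^ (-(2 * p)) := by rw [integral_const, smul_eq_mul]
      _ ≤ m * |τ| ^ ((Module.finrank ℝ V : ℝ) - 1 - 2 * p) := by
          refine mul_le_mul_of_nonneg_left (Real.rpow_le_rpow_of_exponent_le h1 ?_)
            measureReal_nonneg
          have : (1 : ℝ) ≤ Module.finrank ℝ V := by exact_mod_cast hn
          linarith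
      _ ≤ _ := mul_le_mul_of_nonneg_right (by have : 0 ≤ 2 ^ p * I := by positivity
                                              linarith) (by positivity)
  · set t := |τ| with htdef
    have hpos : ∀ y : V, 0 < t ^ 2 + ‖y - e‖ ^ 2 := fun y => by positivity
    have hint : Integrable (fun y : V => (t ^ 2 + ‖y - e‖ ^ 2) ^ (-p)) := by
      have h2 : Integrable (fun y : V => (t ^ 2 + ‖y‖ ^ 2) ^ (-p)) := by
        refine (hint1.const_mul ((t ^ 2) ^ (-p))).mono' (by fun_prop : Measurable fun y : V =>
          (t ^ 2 + ‖y‖ ^ 2) ^ (-p)).aestronglyMeasurable (Eventually.of_forall ?_)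
        intro y
        rw [Real.norm_of_nonneg (Real.rpow_nonneg (by positivity) _),
          ← Real.mul_rpow (by positivity) (by positivity)]
        refine Real.rpow_le_rpow_of_nonpos (by positivity) ?_ (by linarith)
        have : t ^ 2 ≤ 1 := pow_le_one₀ ht.le h1.le
        nlinarith [sq_nonneg ‖y‖]
      exact h2.comp_sub_right e
    have hA := ofReal_integral_eq_lintegral_ofReal hint
      (Eventually.of_forall fun y => Real.rpow_nonneg (hpos y).le _)
    rw [integral_regularized_kernel e ht, ← hI, lintegral_polar (by fun_prop)] at hA
    -- On the shell 1 < r ≤ 1 + t one has |rσ - e|² = (r-1)² + 2r(1-⟨σ,e⟩) ≤ t² + 4(1-⟨σ,e⟩), hence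
    -- t² + |rσ - e|² is at most twice the base of the ring kernel. The shell has thickness t, which
    -- accounts for the exponent n - 1 - 2p instead of n - 2p.
    have hB : ∀ σ : Metric.sphere (0 : V) 1,
        ENNReal.ofReal (2 ^ (-p) * ringKernel e p (τ, σ)) * ENNReal.ofReal t ≤
        ∫⁻ r in Ioi (0 : ℝ), ENNReal.ofReal (r ^ (Module.finrank ℝ V - 1)) *
          ENNReal.ofReal ((t ^ 2 + ‖r • (σ : V) - e‖ ^ 2) ^ (-p)) := by
      intro σ
      have hvol : ENNReal.ofReal t = volume (Ioc (1 : ℝ) (1 + t)) := by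
        rw [Real.volume_Ioc]; congr 1; ring
      rw [hvol, ← setLIntegral_const]
      refine (setLIntegral_mono' measurableSet_Ioc fun r hr => ?_).trans
        (lintegral_mono_set (fun r hr => lt_trans zero_lt_one hr.1))
      have hr1 : 1 ≤ r := hr.1.le
      have h3 : ENNReal.ofReal (2 ^ (-p) * ringKernel e p (τ, σ)) ≤
          ENNReal.ofReal ((t ^ 2 + ‖r • (σ : V) - e‖ ^ 2) ^ (-p)) := by
        refine ENNReal.ofReal_le_ofReal ?_
        have hd := sphereDefect_nonneg he σ
        rw [ringKernel, ← Real.mul_rpow zero_le_two (by simp only; positivity)]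
        refine Real.rpow_le_rpow_of_nonpos (hpos _) ?_ (by linarith)
        have h4 : ‖r • (σ : V) - e‖ ^ 2 = (r - 1) ^ 2 + 2 * r * sphereDefect e σ := by
          rw [norm_sub_sq_real, norm_smul, he, norm_eq_of_mem_sphere, real_inner_smul_left,
            sphereDefect, Real.norm_eq_abs, mul_one, sq_abs]
          ring
        rw [h4, ← sq_abs τ, ← htdef]
        have h5 : (r - 1) ^ 2 ≤ t ^ 2 := pow_le_pow_left₀ (by linarith) (by linarith [hr.2]) 2
        have h6 : r ≤ 2 := by linarith [hr.2]
        nlinarith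
      refine h3.trans ?_
      rw [← ENNReal.ofReal_mul (by positivity)]
      refine ENNReal.ofReal_le_ofReal (le_mul_of_one_le_left
        (Real.rpow_nonneg (hpos _).le _) (one_le_pow₀ hr1))
    have hC := lintegral_mono (μ := surfaceMeasure V) hB
    rw [← hA, lintegral_mul_const _ (by have := measurable_ringKernel e p; fun_prop),
      ← ofReal_integral_eq_lintegral_ofReal
        ((integrable_ringKernel_section he hp0 hτ).const_mul _)
        (Eventually.of_forall fun σ => mul_nonneg (by positivity) (ringKernel_nonneg he p _)),
      ← ENNReal.ofReal_mul' ht.le, ENNReal.ofReal_le_ofReal_iff (by positivity),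
      integral_const_mul, Real.rpow_neg zero_le_two] at hC
    have h7 : t ^ ((Module.finrank ℝ V : ℝ) - 1 - 2 * p) * t =
        t ^ ((Module.finrank ℝ V : ℝ) - 2 * p) := by
      rw [← Real.rpow_add_one ht.ne']; congr 1; ring
    rw [← h7] at hC
    have h2p : (0 : ℝ) < 2 ^ p := by positivity
    have h8 : ∫ σ, ringKernel e p (τ, σ) ∂(surfaceMeasure V) ≤
        2 ^ p * I * t ^ ((Module.finrank ℝ V : ℝ) - 1 - 2 * p) := by
      have h9 : (2 ^ p)⁻¹ * ∫ σ, ringKernel e p (τ, σ) ∂(surfaceMeasure V) ≤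
          t ^ ((Module.finrank ℝ V : ℝ) - 1 - 2 * p) * I := by
        refine le_of_mul_le_mul_right ?_ ht
        calc _ ≤ _ := hC
          _ = _ := by ring
      rw [inv_mul_le_iff₀ h2p] at h9
      linarith
    refine h8.trans (mul_le_mul_of_nonneg_right ?_ (by positivity))
    have : 0 ≤ m := measureReal_nonneg
    linarith

/-- A weight that is integrable against `|τ|^{n-1-2p}` is integrable against the ring kernel. -/
theorem integrable_mul_ringKernel {e : V} (he : ‖e‖ = 1) {p : ℝ} (hp0 : 0 ≤ p) {C a : ℝ}
    (hC : ∀ τ, τ ≠ 0 → ∫ σ, ringKernel e p (τ, σ) ∂(surfaceMeasure V) ≤ C * |τ| ^ a)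
    {φ : ℝ → ℝ} (hφm : Measurable φ) (hφ0 : ∀ τ, 0 ≤ φ τ)
    (hφ : Integrable fun τ => φ τ * |τ| ^ a) :
    Integrable (fun q : ℝ × Metric.sphere (0 : V) 1 => φ q.1 * ringKernel e p q)
      (volume.prod (surfaceMeasure V)) ∧
    ∫ q : ℝ × Metric.sphere (0 : V) 1, φ q.1 * ringKernel e p q
      ∂(volume.prod (surfaceMeasure V)) ≤ C * ∫ τ, φ τ * |τ| ^ a := by
  have hm : AEStronglyMeasurable (fun q : ℝ × Metric.sphere (0 : V) 1 =>
      φ q.1 * ringKernel e p q) (volume.prod (surfaceMeasure V)) := by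
    have := measurable_ringKernel e p
    exact (by fun_prop : Measurable fun q : ℝ × Metric.sphere (0 : V) 1 =>
      φ q.1 * ringKernel e p q).aestronglyMeasurable
  have hne : ∀ᵐ τ : ℝ, τ ≠ 0 := by simp [ae_iff, measure_singleton]
  have hbd : ∀ τ, τ ≠ 0 → ∫ σ, φ τ * ringKernel e p (τ, σ) ∂(surfaceMeasure V) ≤
      C * (φ τ * |τ| ^ a) := fun τ hτ => by
    rw [integral_const_mul]
    calc _ ≤ φ τ * (C * |τ| ^ a) := mul_le_mul_of_nonneg_left (hC τ hτ) (hφ0 τ)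
      _ = _ := by ring
  have hint : Integrable (fun q : ℝ × Metric.sphere (0 : V) 1 => φ q.1 * ringKernel e p q)
      (volume.prod (surfaceMeasure V)) := by
    rw [integrable_prod_iff hm]
    constructor
    · filter_upwards [hne] with τ hτ
      exact (integrable_ringKernel_section he hp0 hτ).const_mul _
    · refine (hφ.const_mul C).mono' hm.norm.integral_prod_right' ?_
      filter_upwards [hne] with τ hτ
      rw [Real.norm_of_nonneg (integral_nonneg fun _ => norm_nonneg _)]
      refine le_trans (le_of_eq ?_) (hbd τ hτ)
      refine integral_congr_ae (Eventually.of_forall fun σ => ?_)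
      exact Real.norm_of_nonneg (mul_nonneg (hφ0 τ) (ringKernel_nonneg he p _))
  refine ⟨hint, ?_⟩
  rw [integral_prod _ hint, ← integral_const_mul]
  refine integral_mono_ae hint.integral_prod_left (hφ.const_mul C) ?_
  filter_upwards [hne] with τ hτ using hbd τ hτ

/-- Functions of `|τ|` bounded by `|τ|^a` near the origin and by `|τ|^b` at infinity. -/
theorem integrable_min_abs_rpow {a b : ℝ} (ha : -1 < a) (hb : b < -1) :
    Integrable fun τ : ℝ => min (|τ| ^ a) (|τ| ^ b) := by
  have h := integrable_fun_norm_addHaar (volume : Measure ℝ) (f := fun r : ℝ => min (r ^ a) (r ^ b))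
  simp only [Real.norm_eq_abs, Module.finrank_self, Nat.sub_self, pow_zero, one_smul] at h
  rw [h, ← Ioc_union_Ioi_eq_Ioi zero_le_one]
  have hm : Measurable fun r : ℝ => min (r ^ a) (r ^ b) := by fun_prop
  refine IntegrableOn.union ?_ ?_
  · have h1 : IntegrableOn (fun r : ℝ => r ^ a) (Ioc 0 1) := by
      rw [← intervalIntegrable_iff_integrableOn_Ioc_of_le zero_le_one]
      exact intervalIntegral.intervalIntegrable_rpow' ha
    refine Integrable.mono' h1 hm.aestronglyMeasurable ?_
    filter_upwards [ae_restrict_mem measurableSet_Ioc] with r hr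
    rw [Real.norm_of_nonneg (le_min (Real.rpow_nonneg hr.1.le _) (Real.rpow_nonneg hr.1.le _))]
    exact min_le_left _ _
  · refine Integrable.mono' (integrableOn_Ioi_rpow_of_lt hb zero_lt_one) hm.aestronglyMeasurable ?_
    filter_upwards [ae_restrict_mem measurableSet_Ioi] with r hr
    have hr0 : 0 ≤ r := zero_le_one.trans (le_of_lt hr)
    rw [Real.norm_of_nonneg (le_min (Real.rpow_nonneg hr0 _) (Real.rpow_nonneg hr0 _))]
    exact min_le_right _ _

/-- Integration by parts against the primitive τ. It trades the exponent 1 - p for a weight τ² with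
exponent -p, with constants uniform as m → 0. -/
theorem integral_sq_add_rpow {p m : ℝ} (hm : 0 < m) :
    ∫ τ in (-1 : ℝ)..1, (τ ^ 2 + m) ^ (1 - p) = 2 * (1 + m) ^ (1 - p) +
      (2 * p - 2) * ∫ τ in (-1 : ℝ)..1, τ ^ 2 * (τ ^ 2 + m) ^ (-p) := by
  have hpos : ∀ τ : ℝ, 0 < τ ^ 2 + m := fun τ => by positivity
  have hc : ∀ r : ℝ, Continuous fun τ : ℝ => (τ ^ 2 + m) ^ r := fun r =>
    Continuous.rpow_const (by fun_prop) fun τ => Or.inl (hpos τ).ne'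
  have hd : ∀ τ : ℝ, HasDerivAt (fun τ : ℝ => τ * (τ ^ 2 + m) ^ (1 - p))
      ((τ ^ 2 + m) ^ (1 - p) - (2 * p - 2) * (τ ^ 2 * (τ ^ 2 + m) ^ (-p))) τ := by
    intro τ
    have h1 : HasDerivAt (fun τ : ℝ => τ ^ 2 + m) (2 * τ) τ := by
      simpa using (hasDerivAt_pow 2 τ).add_const m
    refine ((hasDerivAt_id τ).fun_mul (h1.rpow_const (p := 1 - p) (Or.inl (hpos τ).ne'))).congr_deriv ?_
    have : (1 : ℝ) - p - 1 = -p := by ring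
    simp only [id, this]
    ring
  have hi1 : IntervalIntegrable (fun τ : ℝ => (τ ^ 2 + m) ^ (1 - p)) volume (-1) 1 :=
    (hc _).intervalIntegrable _ _
  have hi2 : IntervalIntegrable (fun τ : ℝ => (2 * p - 2) * (τ ^ 2 * (τ ^ 2 + m) ^ (-p)))
      volume (-1) 1 :=
    (continuous_const.mul ((continuous_pow 2).mul (hc _))).intervalIntegrable _ _
  have := intervalIntegral.integral_eq_sub_of_hasDerivAt (fun τ _ => hd τ) (hi1.sub hi2)
  rw [intervalIntegral.integral_sub hi1 hi2, intervalIntegral.integral_const_mul] at this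
  norm_num at this
  linarith

/-- Integrating first in τ, the factor 1-⟨σ,e⟩ is absorbed into the kernel, and
`integral_sq_add_rpow` replaces (τ²+m)^{1-p} by τ²(τ²+m)^{-p}. That weight is integrable because
τ²|τ|^{n-1-2p} is integrable at the origin for 2p < n + 2; no estimate of spherical caps is needed.
-/
theorem integrable_sphereDefect_mul_ringKernel [Nontrivial V] {e : V} (he : ‖e‖ = 1) {p : ℝ}
    (hp1 : 1 < p) (hp : (Module.finrank ℝ V : ℝ) < 2 * p)
    (hp' : 2 * p < (Module.finrank ℝ V : ℝ) + 2) :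
    Integrable (fun q : ℝ × Metric.sphere (0 : V) 1 => sphereDefect e q.2 * ringKernel e p q)
      (volume.prod (surfaceMeasure V)) := by
  obtain ⟨C, hC0, hC⟩ := exists_integral_ringKernel_le he hp
  have hmc := measurable_sphereDefect e
  have hmk := measurable_ringKernel e p
  have hm : Measurable (fun q : ℝ × Metric.sphere (0 : V) 1 =>
    sphereDefect e q.2 * ringKernel e p q) := by fun_prop
  set φ : ℝ → ℝ := (Ioc (-1 : ℝ) 1).indicator fun τ => τ ^ 2 with hφ
  have hφm : Measurable φ := (measurable_id.pow_const 2).indicator measurableSet_Ioc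
  have hφ0 : ∀ τ, 0 ≤ φ τ := fun τ => indicator_nonneg (fun τ _ => sq_nonneg τ) τ
  have hφi := (integrable_mul_ringKernel he (by linarith) hC hφm hφ0 (by
    refine (integrable_min_abs_rpow (a := (Module.finrank ℝ V : ℝ) + 1 - 2 * p) (b := -2)
      (by linarith) (by norm_num)).mono' (by fun_prop) ?_
    have hne : ∀ᵐ τ : ℝ, τ ≠ 0 := by simp [ae_iff, measure_singleton]
    filter_upwards [hne] with τ hτ
    have hτ0 : 0 < |τ| := abs_pos.2 hτ
    rw [Real.norm_of_nonneg (mul_nonneg (hφ0 τ) (by positivity))]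
    by_cases hmem : τ ∈ Ioc (-1 : ℝ) 1
    · rw [hφ, indicator_of_mem hmem]
      have h1 : τ ^ 2 * |τ| ^ ((Module.finrank ℝ V : ℝ) - 1 - 2 * p) =
          |τ| ^ ((Module.finrank ℝ V : ℝ) + 1 - 2 * p) := by
        rw [← sq_abs, ← Real.rpow_natCast, ← Real.rpow_add hτ0]; congr 1; push_cast; ring
      rw [h1]
      refine le_min le_rfl (Real.rpow_le_rpow_of_exponent_ge hτ0
        (abs_le.2 ⟨hmem.1.le, hmem.2⟩) (by linarith))
    · rw [hφ, indicator_of_notMem hmem, zero_mul]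
      positivity)).1
  -- Majorant for |τ| ≥ 1; the factor 2 bounds 1-⟨σ,e⟩.
  set ψ : ℝ → ℝ := fun τ => 2 * min (|τ| ^ (0 : ℝ)) (|τ| ^ (-(2 * p))) with hψ
  have hψi : Integrable ψ :=
    (integrable_min_abs_rpow (by norm_num) (by linarith)).const_mul 2
  have hsec : ∀ σ : Metric.sphere (0 : V) 1, sphereDefect e σ ≠ 0 →
      Integrable (fun τ : ℝ => (Ioc (-1 : ℝ) 1).indicator
        (fun τ => (τ ^ 2 + 2 * sphereDefect e σ) ^ (1 - p)) τ + ψ τ) ∧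
      ∀ τ, sphereDefect e σ * ringKernel e p (τ, σ) ≤ (Ioc (-1 : ℝ) 1).indicator
        (fun τ => (τ ^ 2 + 2 * sphereDefect e σ) ^ (1 - p)) τ + ψ τ := by
    intro σ hσ
    have hc0 : 0 < sphereDefect e σ := lt_of_le_of_ne (sphereDefect_nonneg he σ) (Ne.symm hσ)
    have hpos : ∀ τ : ℝ, 0 < τ ^ 2 + 2 * sphereDefect e σ := fun τ => by positivity
    refine ⟨Integrable.add ?_ hψi, fun τ => ?_⟩
    · rw [integrable_indicator_iff measurableSet_Ioc]
      have hcont : Continuous fun τ : ℝ => (τ ^ 2 + 2 * sphereDefect e σ) ^ (1 - p) :=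
        Continuous.rpow_const (by fun_prop) fun τ => Or.inl (hpos τ).ne'
      exact (hcont.integrableOn_Icc (a := -1) (b := 1)).mono_set Ioc_subset_Icc_self
    · have hψ0 : 0 ≤ ψ τ := by simp only [hψ]; positivity
      by_cases hmem : τ ∈ Ioc (-1 : ℝ) 1
      · rw [indicator_of_mem hmem]
        have h1 : sphereDefect e σ * ringKernel e p (τ, σ) ≤
            (τ ^ 2 + 2 * sphereDefect e σ) ^ (1 - p) := by
          have h2 : (τ ^ 2 + 2 * sphereDefect e σ) ^ (1 - p) =
              (τ ^ 2 + 2 * sphereDefect e σ) * ringKernel e p (τ, σ) := by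
            rw [ringKernel, sub_eq_add_neg, Real.rpow_add (hpos τ), Real.rpow_one]
          rw [h2]
          exact mul_le_mul_of_nonneg_right (by nlinarith [sq_nonneg τ])
            (ringKernel_nonneg he p _)
        linarith
      · rw [indicator_of_notMem hmem, zero_add]
        have hτ1 : 1 ≤ |τ| := by
          by_contra hlt
          rw [not_le, abs_lt] at hlt
          exact hmem ⟨hlt.1, hlt.2.le⟩
        have hτ : τ ≠ 0 := fun h => by rw [h, abs_zero] at hτ1; linarith
        simp only [hψ]
        rw [min_eq_right (Real.rpow_le_rpow_of_exponent_le hτ1 (by linarith))]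
        exact mul_le_mul (sphereDefect_le he σ) (ringKernel_le he (by linarith) hτ σ)
          (ringKernel_nonneg he p _) zero_le_two
  have hnn : ∀ q : ℝ × Metric.sphere (0 : V) 1, 0 ≤ sphereDefect e q.2 * ringKernel e p q :=
    fun q => mul_nonneg (sphereDefect_nonneg he _) (ringKernel_nonneg he p _)
  rw [integrable_prod_iff' hm.aestronglyMeasurable]
  constructor
  · refine Eventually.of_forall fun σ => ?_
    by_cases hσ : sphereDefect e σ = 0
    · simp [hσ]
    · refine (hsec σ hσ).1.mono' (hm.comp measurable_prodMk_right).aestronglyMeasurable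
        (Eventually.of_forall fun τ => ?_)
      rw [Real.norm_of_nonneg (hnn _)]
      exact (hsec σ hσ).2 τ
  · have hg : Integrable (fun σ : Metric.sphere (0 : V) 1 => (2 + ∫ τ, ψ τ) +
        (2 * p - 2) * ∫ τ, φ τ * ringKernel e p (τ, σ)) (surfaceMeasure V) :=
      (integrable_const _).add (hφi.integral_prod_right.const_mul _)
    refine hg.mono' hm.norm.aestronglyMeasurable.prod_swap.integral_prod_right'
      (Eventually.of_forall fun σ => ?_)
    rw [Real.norm_of_nonneg (integral_nonneg fun _ => norm_nonneg _)]
    have hnorm : ∫ τ : ℝ, ‖sphereDefect e (τ, σ).2 * ringKernel e p (τ, σ)‖ =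
        ∫ τ : ℝ, sphereDefect e σ * ringKernel e p (τ, σ) :=
      integral_congr_ae (Eventually.of_forall fun τ => Real.norm_of_nonneg (hnn (τ, σ)))
    rw [hnorm]
    have hφW : 0 ≤ ∫ τ, φ τ * ringKernel e p (τ, σ) :=
      integral_nonneg fun τ => mul_nonneg (hφ0 τ) (ringKernel_nonneg he p _)
    have hψ0 : 0 ≤ ∫ τ, ψ τ := integral_nonneg fun τ => by simp only [hψ]; positivity
    by_cases hσ : sphereDefect e σ = 0
    · simp only [hσ, zero_mul, integral_zero]
      have := mul_nonneg (by linarith : 0 ≤ 2 * p - 2) hφW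
      linarith
    have hc0 : 0 < sphereDefect e σ := lt_of_le_of_ne (sphereDefect_nonneg he σ) (Ne.symm hσ)
    obtain ⟨hi, hle⟩ := hsec σ hσ
    refine (integral_mono_of_nonneg (Eventually.of_forall fun τ => hnn (τ, σ)) hi
      (Eventually.of_forall hle)).trans ?_
    rw [integral_add ((hi.sub hψi).congr (Eventually.of_forall fun τ => by simp)) hψi, integral_indicator measurableSet_Ioc,
      ← intervalIntegral.integral_of_le (by norm_num), integral_sq_add_rpow (by positivity)]
    have h1 : ∫ τ in (-1 : ℝ)..1, τ ^ 2 * (τ ^ 2 + 2 * sphereDefect e σ) ^ (-p) =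
        ∫ τ, φ τ * ringKernel e p (τ, σ) := by
      rw [intervalIntegral.integral_of_le (by norm_num), ← integral_indicator measurableSet_Ioc]
      refine integral_congr_ae (Eventually.of_forall fun τ => ?_)
      simp only [hφ, ringKernel, indicator]
      split_ifs <;> simp
    have h2 : (1 + 2 * sphereDefect e σ) ^ (1 - p) ≤ 1 :=
      Real.rpow_le_one_of_one_le_of_nonpos (by linarith) (by linarith)
    rw [h1]
    linarith

end Kernel

/-! ### Elementary bounds in Hölder spaces -/

/-- A bounded quantity with a Hölder bound of exponent b has one of any smaller exponent γ: for d ≤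
1 the power decreases in the exponent, for d ≥ 1 the bound A suffices. It brings everything down to
the exponent β - α. -/
theorem le_mul_rpow_of_le_of_le {x A d b γ : ℝ} (hd : 0 ≤ d) (hA : 0 ≤ A) (hγ : 0 < γ)
    (hγb : γ ≤ b) (h1 : x ≤ A) (h2 : x ≤ A * d ^ b) : x ≤ A * d ^ γ := by
  rcases le_total d 1 with hd1 | hd1
  · exact h2.trans (mul_le_mul_of_nonneg_left
      (Real.rpow_le_rpow_of_exponent_ge' hd hd1 hγ.le hγb) hA)
  · exact h1.trans (le_mul_of_one_le_right hA (Real.one_le_rpow hd1 hγ.le))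

theorem le_mul_min_rpow {x A a b r : ℝ} (h1 : x ≤ A * a ^ r)
    (h2 : x ≤ A * b ^ r) : x ≤ A * min a b ^ r := by
  rcases le_total a b with h | h
  · rwa [min_eq_left h]
  · rwa [min_eq_right h]

namespace HolderSpace

section One

variable {β : ℝ} (u : HolderSpace 1 β)

theorem norm_eq_one : ‖u‖ = supNorm 0 u + supNorm 1 u + seminorm u := by
  have : ‖u‖ = (∑ j ∈ Finset.range (1 + 1), supNorm j u) + seminorm u := rfl
  rw [this, Finset.sum_range_succ, Finset.sum_range_one]

theorem abs_apply_le (s : ℝ) : |u s| ≤ ‖u‖ := by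
  have h := le_ciSup (bddAbove_sup (Nat.zero_le 1) u) s
  have h1 := supNorm_nonneg 1 u
  have h2 := seminorm_nonneg u
  rw [norm_eq_one]
  simp only [iteratedDeriv_zero] at h
  have h3 : |u s| ≤ supNorm 0 u := by simpa [supNorm] using h
  linarith

theorem abs_deriv_le (s : ℝ) : |deriv u s| ≤ ‖u‖ := by
  have h := le_ciSup (bddAbove_sup (le_refl 1) u) s
  have h1 := supNorm_nonneg 0 u
  have h2 := seminorm_nonneg u
  rw [norm_eq_one]
  have h3 : |deriv u s| ≤ supNorm 1 u := by simpa [supNorm, iteratedDeriv_one] using h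
  linarith

theorem abs_deriv_sub_le (s t : ℝ) : |deriv u s - deriv u t| ≤ ‖u‖ * |s - t| ^ β := by
  rcases eq_or_ne s t with rfl | hst
  · simp only [sub_self, abs_zero]
    exact mul_nonneg (norm_nonneg _) (Real.rpow_nonneg le_rfl _)
  have h := le_ciSup (bddAbove_seminorm u) (s, t)
  have h1 := supNorm_nonneg 0 u
  have h2 := supNorm_nonneg 1 u
  have hp : 0 < |s - t| ^ β := Real.rpow_pos_of_pos (abs_pos.2 (sub_ne_zero.2 hst)) _
  have h3 : |deriv u s - deriv u t| / |s - t| ^ β ≤ seminorm u := by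
    simpa [seminorm, iteratedDeriv_one] using h
  rw [div_le_iff₀ hp] at h3
  refine h3.trans (mul_le_mul_of_nonneg_right ?_ hp.le)
  rw [norm_eq_one]; linarith

theorem contDiff_one : ContDiff ℝ 1 (u : ℝ → ℝ) := by exact_mod_cast u.isHolder.1

theorem hasDerivAt (s : ℝ) : HasDerivAt (u : ℝ → ℝ) (deriv u s) s :=
  (u.contDiff_one.differentiable one_ne_zero).differentiableAt.hasDerivAt

theorem continuous : Continuous (u : ℝ → ℝ) := u.contDiff_one.continuous

theorem continuous_deriv : Continuous (deriv (u : ℝ → ℝ)) :=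
  u.contDiff_one.continuous_deriv le_rfl

theorem abs_sub_le (s t : ℝ) : |u s - u t| ≤ ‖u‖ * |s - t| := by
  have := convex_univ.norm_image_sub_le_of_norm_hasDerivWithin_le (f := (u : ℝ → ℝ))
    (fun x _ => (u.hasDerivAt x).hasDerivWithinAt) (fun x _ => u.abs_deriv_le x)
    (mem_univ t) (mem_univ s)
  simpa [Real.norm_eq_abs] using this

/-- First order Taylor estimate. -/
theorem abs_taylor_le (hβ : 0 ≤ β) (s τ : ℝ) :
    |u s - u (s - τ) - τ * deriv u (s - τ)| ≤ ‖u‖ * |τ| ^ β * |τ| := by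
  have := (convex_uIcc (s - τ) s).norm_image_sub_le_of_norm_hasDerivWithin_le
    (f := fun x => u x - x * deriv u (s - τ)) (f' := fun x => deriv u x - deriv u (s - τ))
    (C := ‖u‖ * |τ| ^ β)
    (fun x _ => (((u.hasDerivAt x).sub (by
      simpa using (hasDerivAt_id x).mul_const (deriv u (s - τ)))).hasDerivWithinAt))
    (fun x hx => by
      refine (u.abs_deriv_sub_le x (s - τ)).trans
        (mul_le_mul_of_nonneg_left (Real.rpow_le_rpow (abs_nonneg _) ?_ hβ) (norm_nonneg _))
      have := abs_sub_left_of_mem_uIcc hx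
      simpa using this) left_mem_uIcc right_mem_uIcc
  simp only [Real.norm_eq_abs, sub_sub_cancel] at this
  convert this using 2
  ring

/-- The mean value inequality for x ↦ u(s+x) - u(t+x), whose derivative is bounded by the Hölder
seminorm of u'. With t = s + τ it also controls second differences. -/
theorem abs_increment_sub_le (s t τ : ℝ) :
    |(u s - u (s - τ)) - (u t - u (t - τ))| ≤ ‖u‖ * |s - t| ^ β * |τ| := by
  have hshift : ∀ a x : ℝ, HasDerivAt (fun x => u (a + x)) (deriv u (a + x)) x := fun a x =>
    (u.hasDerivAt (a + x)).comp_const_add a x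
  have := convex_univ.norm_image_sub_le_of_norm_hasDerivWithin_le
    (f := fun x => u (s + x) - u (t + x)) (f' := fun x => deriv u (s + x) - deriv u (t + x))
    (C := ‖u‖ * |s - t| ^ β)
    (fun x _ => ((hshift s x).sub (hshift t x)).hasDerivWithinAt)
    (fun x _ => by simpa using u.abs_deriv_sub_le (s + x) (t + x)) (mem_univ (-τ)) (mem_univ 0)
  simp only [Real.norm_eq_abs, add_zero, zero_sub, neg_neg, ← sub_eq_add_neg] at this
  convert this using 2
  ring

end One

section Zero

variable {γ : ℝ}

/-- An element of `C^{0,γ}(ℝ)` from its bounds. -/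
def ofBounds (hγ : 0 < γ) (f : ℝ → ℝ) (hb : ∃ C, ∀ s, |f s| ≤ C)
    (hh : ∃ C, ∀ s t, |f s - f t| ≤ C * |s - t| ^ γ) : HolderSpace 0 γ :=
  ⟨f, by
    refine ⟨?_, fun j hj => ?_, ?_⟩
    · have hcont : Continuous f := by
        obtain ⟨C, hC⟩ := hh
        rw [continuous_iff_continuousAt]
        intro s
        rw [ContinuousAt, tendsto_iff_dist_tendsto_zero]
        refine squeeze_zero (fun _ => dist_nonneg) (fun t => hC t s) ?_
        have h1 : Tendsto (fun t : ℝ => C * |t - s| ^ γ) (𝓝 s) (𝓝 (C * |s - s| ^ γ)) := by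
          refine Tendsto.const_mul C (Tendsto.rpow_const ?_ (Or.inr hγ.le))
          exact (continuous_abs.comp (continuous_id.sub continuous_const)).tendsto s
        simpa [Real.zero_rpow hγ.ne'] using h1
      simpa using (contDiff_zero (𝕜 := ℝ)).2 hcont
    · obtain rfl := Nat.le_zero.1 hj
      simpa [iteratedDeriv_zero] using hb
    · simpa [iteratedDeriv_zero] using hh⟩

@[simp] theorem ofBounds_apply (hγ : 0 < γ) (f : ℝ → ℝ) (hb hh) (s : ℝ) :
    ofBounds hγ f hb hh s = f s := rfl

theorem norm_le_of_bounds {u : HolderSpace 0 γ} {A B : ℝ} (hB : 0 ≤ B)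
    (h1 : ∀ s, |u s| ≤ A) (h2 : ∀ s t, |u s - u t| ≤ B * |s - t| ^ γ) : ‖u‖ ≤ A + B := by
  rw [norm_def, Finset.sum_range_one]
  refine add_le_add (ciSup_le fun s => by simpa using h1 s) (ciSup_le fun q => ?_)
  simp only [iteratedDeriv_zero]
  exact div_le_of_le_mul₀ (Real.rpow_nonneg (abs_nonneg _) _) hB (h2 q.1 q.2)

theorem abs_apply_le_zero (u : HolderSpace 0 γ) (s : ℝ) : |u s| ≤ ‖u‖ := by
  have h := le_ciSup (bddAbove_sup (le_refl 0) u) s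
  have h2 := seminorm_nonneg u
  have h3 : |u s| ≤ supNorm 0 u := by simpa [supNorm] using h
  have h4 : ‖u‖ = (∑ j ∈ Finset.range (0 + 1), supNorm j u) + seminorm u := rfl
  rw [h4, Finset.sum_range_one]; linarith

/-- Evaluation at a point of a function in `C^{0,γ}(ℝ)`. -/
def evalCLM (s : ℝ) : HolderSpace 0 γ →L[ℝ] ℝ :=
  LinearMap.mkContinuous
    { toFun := fun u => u s
      map_add' := fun _ _ => rfl
      map_smul' := fun _ _ => rfl } 1 fun u => by
    rw [one_mul]; exact u.abs_apply_le_zero s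

end Zero

end HolderSpace

/-! ### Linear maps from `C^{1,β}(ℝ)` to uniformly Hölder families -/

namespace HolderFamily

variable {γ β : ℝ} {Θ : Type*} [MeasurableSpace Θ]

theorem deriv_coe_add (u v : HolderSpace 1 β) (s : ℝ) :
    deriv (u + v : HolderSpace 1 β) s = deriv u s + deriv v s :=
  ((u.hasDerivAt s).add (v.hasDerivAt s)).deriv

theorem deriv_coe_smul (c : ℝ) (u : HolderSpace 1 β) (s : ℝ) :
    deriv (c • u : HolderSpace 1 β) s = c * deriv u s :=
  ((u.hasDerivAt s).const_smul c).deriv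

/-- The family `(s, θ) ↦ u(s - g(θ))`. -/
def shiftCLM (hγ : 0 < γ) (hγ1 : γ ≤ 1) (g : Θ → ℝ) (hg : Measurable g) :
    HolderSpace 1 β →L[ℝ] HolderFamily γ Θ :=
  have key : ∀ (u : HolderSpace 1 β) (s t : ℝ) (θ : Θ),
      |u (s - g θ) - u (t - g θ)| ≤ 2 * ‖u‖ * |s - t| ^ γ := fun u s t θ => by
    refine le_mul_rpow_of_le_of_le (b := 1) (abs_nonneg _) (by positivity) hγ hγ1 ?_ ?_
    · refine (abs_sub _ _).trans ?_
      linarith [u.abs_apply_le (s - g θ), u.abs_apply_le (t - g θ)]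
    · have := u.abs_sub_le (s - g θ) (t - g θ)
      rw [sub_sub_sub_cancel_right] at this
      rw [Real.rpow_one]
      have h2 := mul_nonneg (norm_nonneg u) (abs_nonneg (s - t))
      linarith
  LinearMap.mkContinuous
    { toFun := fun u => ofBounds (fun s θ => u (s - g θ))
        (fun s => u.continuous.measurable.comp (measurable_const.sub hg))
        ⟨‖u‖, fun s θ => u.abs_apply_le _⟩ ⟨2 * ‖u‖, key u⟩
      map_add' := fun _ _ => rfl
      map_smul' := fun _ _ => rfl } 3 fun u => by
    refine (norm_le (norm_nonneg u) (by positivity : 0 ≤ 2 * ‖u‖)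
      (fun s θ => u.abs_apply_le _) (key u)).trans (by linarith)

/-- The difference quotients `(s, θ) ↦ (u(s) - u(s - g(θ))) / g(θ)`. -/
def quotientCLM (hγ : 0 < γ) (hγβ : γ ≤ β) (g : Θ → ℝ) (hg : Measurable g) :
    HolderSpace 1 β →L[ℝ] HolderFamily γ Θ :=
  have key1 : ∀ (u : HolderSpace 1 β) (s : ℝ) (θ : Θ),
      |(u s - u (s - g θ)) / g θ| ≤ ‖u‖ := fun u s θ => by
    rw [abs_div]
    refine div_le_of_le_mul₀ (abs_nonneg _) (norm_nonneg _) ?_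
    simpa using u.abs_sub_le s (s - g θ)
  have key2 : ∀ (u : HolderSpace 1 β) (s t : ℝ) (θ : Θ),
      |(u s - u (s - g θ)) / g θ - (u t - u (t - g θ)) / g θ| ≤ 2 * ‖u‖ * |s - t| ^ γ :=
    fun u s t θ => by
    refine le_mul_rpow_of_le_of_le (b := β) (abs_nonneg _) (by positivity) hγ hγβ ?_ ?_
    · refine (abs_sub _ _).trans ?_
      linarith [key1 u s θ, key1 u t θ]
    · have h0 : 0 ≤ ‖u‖ * |s - t| ^ β :=
        mul_nonneg (norm_nonneg u) (Real.rpow_nonneg (abs_nonneg (s - t)) β)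
      rw [← sub_div, abs_div]
      refine div_le_of_le_mul₀ (abs_nonneg _) (by linarith) ?_
      refine (u.abs_increment_sub_le s t (g θ)).trans
        (mul_le_mul_of_nonneg_right (by linarith) (abs_nonneg _))
  LinearMap.mkContinuous
    { toFun := fun u => ofBounds (fun s θ => (u s - u (s - g θ)) / g θ)
        (fun s => (measurable_const.sub
          (u.continuous.measurable.comp (measurable_const.sub hg))).div hg)
        ⟨‖u‖, key1 u⟩ ⟨2 * ‖u‖, key2 u⟩
      map_add' := fun u v => HolderFamily.ext fun s θ => by
        simp only [ofBounds_apply, add_apply, HolderSpace.coe_add, Pi.add_apply]; ring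
      map_smul' := fun c u => HolderFamily.ext fun s θ => by
        simp only [ofBounds_apply, smul_apply, HolderSpace.coe_smul, Pi.smul_apply, smul_eq_mul,
          RingHom.id_apply]; ring } 3 fun u => by
    refine (norm_le (norm_nonneg u) (by positivity : 0 ≤ 2 * ‖u‖) (key1 u) (key2 u)).trans
      (by linarith)

/-- A bounded measurable function of the parameter, as a constant family. -/
def constFamily (g : Θ → ℝ) (hg : Measurable g) (hb : ∃ C, ∀ θ, |g θ| ≤ C) :
    HolderFamily γ Θ :=
  ofBounds (fun _ θ => g θ) (fun _ => hg) (hb.imp fun _ h _ => h)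
    ⟨0, fun s t θ => by simp⟩

end HolderFamily

/-! ### One-dimensional weights -/

theorem integrable_min_one_rpow {α β : ℝ} (hα : 0 < α) (hαβ : α < β) :
    Integrable fun τ : ℝ => |τ| ^ (-1 - α) * min |τ| 1 ^ β := by
  refine (integrable_min_abs_rpow (a := β - 1 - α) (b := -1 - α) (by linarith)
    (by linarith)).congr ?_
  have hne : ∀ᵐ τ : ℝ, τ ≠ 0 := by simp [ae_iff, measure_singleton]
  filter_upwards [hne] with τ hτ
  have hτ0 : 0 < |τ| := abs_pos.2 hτ
  have e : |τ| ^ (β - 1 - α) = |τ| ^ (-1 - α) * |τ| ^ β := by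
    rw [← Real.rpow_add hτ0]; congr 1; ring
  rcases le_total |τ| 1 with h | h
  · rw [min_eq_left h, min_eq_left (Real.rpow_le_rpow_of_exponent_ge hτ0 h (by linarith)), e]
  · rw [min_eq_right h, min_eq_right (Real.rpow_le_rpow_of_exponent_le h (by linarith)),
      Real.one_rpow, mul_one]

theorem weight_scaling {α β h : ℝ} (hh : 0 < h) (τ : ℝ) :
    |τ| ^ (-1 - α) * min |τ| h ^ β =
      h ^ (β - 1 - α) * (|h⁻¹ * τ| ^ (-1 - α) * min |h⁻¹ * τ| 1 ^ β) := by
  have h1 : |h⁻¹ * τ| = h⁻¹ * |τ| := by rw [abs_mul, abs_of_pos (inv_pos.2 hh)]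
  have h2 : min |τ| h = h * min (h⁻¹ * |τ|) 1 := by
    rw [mul_min_of_nonneg _ _ hh.le, mul_inv_cancel_left₀ hh.ne', mul_one]
  rw [h1, h2, Real.mul_rpow hh.le (le_min (by positivity) zero_le_one),
    Real.mul_rpow (inv_nonneg.2 hh.le) (abs_nonneg _), Real.inv_rpow hh.le,
    show β - 1 - α = (-1 - α) + β by ring, Real.rpow_add hh]
  have : h ^ (-1 - α) ≠ 0 := (Real.rpow_pos_of_pos hh _).ne'
  field_simp

theorem integrable_min_rpow {α β h : ℝ} (hα : 0 < α) (hαβ : α < β) (hh : 0 < h) :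
    Integrable fun τ : ℝ => |τ| ^ (-1 - α) * min |τ| h ^ β := by
  have := ((integrable_min_one_rpow hα hαβ).comp_mul_left' (inv_ne_zero hh.ne')).const_mul
    (h ^ (β - 1 - α))
  exact this.congr (Eventually.of_forall fun τ => (weight_scaling hh τ).symm)

/-- By homogeneity of the integrand under τ ↦ hτ. This scaling is where the exponent β - α of the
target space comes from. -/
theorem integral_min_rpow {α β h : ℝ} (hh : 0 < h) :
    ∫ τ : ℝ, |τ| ^ (-1 - α) * min |τ| h ^ β =
      h ^ (β - α) * ∫ τ : ℝ, |τ| ^ (-1 - α) * min |τ| 1 ^ β := by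
  simp only [weight_scaling hh]
  rw [integral_const_mul, Measure.integral_comp_mul_left
    (fun τ : ℝ => |τ| ^ (-1 - α) * min |τ| 1 ^ β), inv_inv, abs_of_pos hh, smul_eq_mul,
    ← mul_assoc]
  congr 1
  rw [← Real.rpow_add_one hh.ne']
  congr 1; ring

/-! ### The operators -/

section Operators

variable {V : Type*} [NormedAddCommGroup V] [InnerProductSpace ℝ V] [FiniteDimensional ℝ V]
  [MeasurableSpace V] [BorelSpace V]

/-- The exponent `(n + 1 + α) / 2`, with `n` the dimension of `V`. -/
def kernelExponent (V : Type*) [NormedAddCommGroup V] [InnerProductSpace ℝ V] (α : ℝ) : ℝ :=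
  ((Module.finrank ℝ V : ℝ) + 1 + α) / 2

theorem one_lt_kernelExponent [Nontrivial V] {α : ℝ} (hα : 0 < α) : 1 < kernelExponent V α := by
  have : (1 : ℝ) ≤ Module.finrank ℝ V := by exact_mod_cast Module.finrank_pos (R := ℝ) (M := V)
  unfold kernelExponent; linarith

/-- Integrating over the sphere turns the kernel into |τ|^{-2-α}, and the scaling in τ does the
rest. The value h = 1 serves the supremum bound, h = |s-t| the Hölder bound. -/
theorem exists_integral_mul_ringKernel_le [Nontrivial V] {e : V} (he : ‖e‖ = 1) {α β : ℝ}
    (hα : 0 < α) (hαβ : α < β) :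
    ∃ K, 0 ≤ K ∧ ∀ h, 0 < h →
      Integrable (fun q : ℝ × Metric.sphere (0 : V) 1 =>
        |q.1| * min |q.1| h ^ β * ringKernel e (kernelExponent V α) q)
        (volume.prod (surfaceMeasure V)) ∧
      ∫ q : ℝ × Metric.sphere (0 : V) 1,
        |q.1| * min |q.1| h ^ β * ringKernel e (kernelExponent V α) q
        ∂(volume.prod (surfaceMeasure V)) ≤ K * h ^ (β - α) := by
  have hp1 := one_lt_kernelExponent (V := V) hα
  obtain ⟨C, hC0, hC⟩ := exists_integral_ringKernel_le he (p := kernelExponent V α)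
    (by unfold kernelExponent; linarith)
  have hexp : (Module.finrank ℝ V : ℝ) - 1 - 2 * kernelExponent V α = -2 - α := by
    unfold kernelExponent; ring
  rw [hexp] at hC
  refine ⟨C * ∫ τ : ℝ, |τ| ^ (-1 - α) * min |τ| 1 ^ β, mul_nonneg hC0
    (integral_nonneg fun τ => by positivity), fun h hh => ?_⟩
  have e1 : ∀ᵐ τ : ℝ, |τ| * min |τ| h ^ β * |τ| ^ (-2 - α) =
      |τ| ^ (-1 - α) * min |τ| h ^ β := by
    have hne : ∀ᵐ τ : ℝ, τ ≠ 0 := by simp [ae_iff, measure_singleton]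
    filter_upwards [hne] with τ hτ
    rw [show -1 - α = (-2 - α) + 1 by ring, Real.rpow_add_one (abs_pos.2 hτ).ne']
    ring
  have := integrable_mul_ringKernel he (by linarith) hC
    (φ := fun τ => |τ| * min |τ| h ^ β) (by fun_prop) (fun τ => by positivity)
    ((integrable_congr e1).2 (integrable_min_rpow hα hαβ hh))
  refine ⟨this.1, this.2.trans (le_of_eq ?_)⟩
  rw [integral_congr_ae e1, integral_min_rpow hh]
  ring

variable {α β : ℝ}

/-- The remainder `u'(s-τ) - (u(s) - u(s-τ)) / τ`. -/
def taylorRemainder (u : HolderSpace 1 β) (s τ : ℝ) : ℝ :=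
  deriv u (s - τ) - (u s - u (s - τ)) / τ

theorem taylorRemainder_add (u v : HolderSpace 1 β) (s τ : ℝ) :
    taylorRemainder (u + v) s τ = taylorRemainder u s τ + taylorRemainder v s τ := by
  rw [taylorRemainder, HolderFamily.deriv_coe_add]
  simp only [taylorRemainder, HolderSpace.coe_add, Pi.add_apply]
  ring

theorem taylorRemainder_smul (c : ℝ) (u : HolderSpace 1 β) (s τ : ℝ) :
    taylorRemainder (c • u) s τ = c * taylorRemainder u s τ := by
  rw [taylorRemainder, HolderFamily.deriv_coe_smul]
  simp only [taylorRemainder, HolderSpace.coe_smul, Pi.smul_apply, smul_eq_mul]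
  ring

theorem measurable_taylorRemainder (u : HolderSpace 1 β) (s : ℝ) :
    Measurable (taylorRemainder u s) := by
  have h1 := u.continuous.measurable
  have h2 := u.continuous_deriv.measurable
  unfold taylorRemainder; fun_prop

/-- Taylor's estimate with base point s - τ gives |τ|^β; for large τ both terms are bounded by the
norm of u. -/
theorem abs_taylorRemainder_le (hβ : 0 ≤ β) (u : HolderSpace 1 β) (s : ℝ) {τ : ℝ} (hτ : τ ≠ 0) :
    |taylorRemainder u s τ| ≤ 2 * ‖u‖ * min |τ| 1 ^ β := by
  have hn := norm_nonneg u
  have hτ0 : 0 < |τ| := abs_pos.2 hτ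
  refine le_mul_min_rpow ?_ ?_
  · have h := u.abs_taylor_le hβ s τ
    have e : taylorRemainder u s τ = -((u s - u (s - τ) - τ * deriv u (s - τ)) / τ) := by
      unfold taylorRemainder; field_simp; ring
    have h0 : 0 ≤ ‖u‖ * |τ| ^ β := by positivity
    rw [e, abs_neg, abs_div, div_le_iff₀ hτ0]
    exact h.trans (mul_le_mul_of_nonneg_right (by linarith) hτ0.le)
  · rw [Real.one_rpow, mul_one]
    refine (abs_sub _ _).trans ?_
    have h1 := u.abs_deriv_le (s - τ)
    have h2 : |(u s - u (s - τ)) / τ| ≤ ‖u‖ := by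
      rw [abs_div, div_le_iff₀ hτ0]
      simpa using u.abs_sub_le s (s - τ)
    linarith

/-- Two competing estimates: each remainder is O(|τ|^β) separately, and the difference is O(|s-t|^β)
by Hölder continuity of u'. Keeping the minimum, rather than either one, is what makes the Hölder
bound of the integral converge. -/
theorem abs_taylorRemainder_sub_le (hβ : 0 ≤ β) (u : HolderSpace 1 β) (s t : ℝ) {τ : ℝ}
    (hτ : τ ≠ 0) :
    |taylorRemainder u s τ - taylorRemainder u t τ| ≤ 4 * ‖u‖ * min |τ| |s - t| ^ β := by
  have hn := norm_nonneg u
  have hτ0 : 0 < |τ| := abs_pos.2 hτ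
  refine le_mul_min_rpow ?_ ?_
  · have h1 := abs_taylorRemainder_le hβ u s hτ
    have h2 := abs_taylorRemainder_le hβ u t hτ
    have h3 : min |τ| 1 ^ β ≤ |τ| ^ β :=
      Real.rpow_le_rpow (by positivity) (min_le_left _ _) hβ
    have h4 := mul_le_mul_of_nonneg_left h3 (by linarith : 0 ≤ 2 * ‖u‖)
    refine (abs_sub _ _).trans ?_
    linarith
  · have h1 := u.abs_deriv_sub_le (s - τ) (t - τ)
    rw [sub_sub_sub_cancel_right] at h1
    have h2 : |(u s - u (s - τ)) / τ - (u t - u (t - τ)) / τ| ≤ ‖u‖ * |s - t| ^ β := by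
      rw [← sub_div, abs_div, div_le_iff₀ hτ0]
      exact u.abs_increment_sub_le s t τ
    have h3 : 0 ≤ ‖u‖ * |s - t| ^ β := by positivity
    have e : taylorRemainder u s τ - taylorRemainder u t τ =
        (deriv u (s - τ) - deriv u (t - τ)) -
        ((u s - u (s - τ)) / τ - (u t - u (t - τ)) / τ) := by unfold taylorRemainder; ring
    rw [e]
    refine (abs_sub _ _).trans ?_
    linarith

/-- The integrand of the bilinear part of the nonlocal mean curvature. -/
def bilinearIntegrand (e : V) (α : ℝ) {γ : ℝ} (u : HolderSpace 1 β)
    (M : HolderFamily γ (ℝ × Metric.sphere (0 : V) 1)) (s : ℝ)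
    (q : ℝ × Metric.sphere (0 : V) 1) : ℝ :=
  q.1 * taylorRemainder u s q.1 * M s q * ringKernel e (kernelExponent V α) q

variable {γ : ℝ}

theorem ae_fst_ne_zero : ∀ᵐ q : ℝ × Metric.sphere (0 : V) 1 ∂(volume.prod (surfaceMeasure V)),
    q.1 ≠ 0 := by
  have hne : ∀ᵐ τ : ℝ, τ ≠ 0 := by simp [ae_iff, measure_singleton]
  exact Measure.quasiMeasurePreserving_fst.ae hne

theorem measurable_bilinearIntegrand (e : V) (u : HolderSpace 1 β)
    (M : HolderFamily γ (ℝ × Metric.sphere (0 : V) 1)) (s : ℝ) :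
    Measurable (bilinearIntegrand e α u M s) := by
  have h1 := measurable_taylorRemainder u s
  have h2 := M.measurable s
  have h3 := measurable_ringKernel e (kernelExponent V α)
  unfold bilinearIntegrand; fun_prop

theorem abs_bilinearIntegrand_le {e : V} (he : ‖e‖ = 1) (hβ : 0 ≤ β) (u : HolderSpace 1 β)
    (M : HolderFamily γ (ℝ × Metric.sphere (0 : V) 1)) (s : ℝ)
    {q : ℝ × Metric.sphere (0 : V) 1} (hq : q.1 ≠ 0) :
    |bilinearIntegrand e α u M s q| ≤ 2 * ‖u‖ * ‖M‖ *
      (|q.1| * min |q.1| 1 ^ β * ringKernel e (kernelExponent V α) q) := by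
  have hW := ringKernel_nonneg he (kernelExponent V α) q
  rw [bilinearIntegrand, abs_mul, abs_mul, abs_mul, abs_of_nonneg hW]
  calc _ ≤ |q.1| * (2 * ‖u‖ * min |q.1| 1 ^ β) * ‖M‖ * ringKernel e (kernelExponent V α) q := by
        gcongr
        · exact abs_taylorRemainder_le hβ u s hq
        · exact M.abs_apply_le s q
    _ = _ := by ring

theorem integrable_bilinearIntegrand [Nontrivial V] {e : V} (he : ‖e‖ = 1) (hα : 0 < α)
    (hαβ : α < β) (u : HolderSpace 1 β) (M : HolderFamily γ (ℝ × Metric.sphere (0 : V) 1))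
    (s : ℝ) : Integrable (bilinearIntegrand e α u M s) (volume.prod (surfaceMeasure V)) := by
  obtain ⟨K, hK0, hK⟩ := exists_integral_mul_ringKernel_le he hα hαβ
  refine ((hK 1 one_pos).1.const_mul (2 * ‖u‖ * ‖M‖)).mono'
    (measurable_bilinearIntegrand e u M s).aestronglyMeasurable ?_
  filter_upwards [ae_fst_ne_zero] with q hq
  exact abs_bilinearIntegrand_le he (by linarith) u M s hq

theorem abs_bilinearIntegrand_sub_le {e : V} (he : ‖e‖ = 1) (hβ : 0 ≤ β) (u : HolderSpace 1 β)
    (M : HolderFamily γ (ℝ × Metric.sphere (0 : V) 1)) (s t : ℝ)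
    {q : ℝ × Metric.sphere (0 : V) 1} (hq : q.1 ≠ 0) :
    |bilinearIntegrand e α u M s q - bilinearIntegrand e α u M t q| ≤
      4 * ‖u‖ * ‖M‖ * (|q.1| * min |q.1| |s - t| ^ β * ringKernel e (kernelExponent V α) q) +
      2 * ‖u‖ * ‖M‖ * |s - t| ^ γ *
        (|q.1| * min |q.1| 1 ^ β * ringKernel e (kernelExponent V α) q) := by
  have hW := ringKernel_nonneg he (kernelExponent V α) q
  have e1 : bilinearIntegrand e α u M s q - bilinearIntegrand e α u M t q =
      q.1 * (taylorRemainder u s q.1 - taylorRemainder u t q.1) * M s q *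
        ringKernel e (kernelExponent V α) q +
      q.1 * taylorRemainder u t q.1 * (M s q - M t q) * ringKernel e (kernelExponent V α) q := by
    unfold bilinearIntegrand; ring
  rw [e1]
  refine (abs_add_le _ _).trans (add_le_add ?_ ?_)
  · rw [abs_mul, abs_mul, abs_mul, abs_of_nonneg hW]
    calc _ ≤ |q.1| * (4 * ‖u‖ * min |q.1| |s - t| ^ β) * ‖M‖ *
          ringKernel e (kernelExponent V α) q := by
          gcongr
          · exact abs_taylorRemainder_sub_le hβ u s t hq
          · exact M.abs_apply_le s q
      _ = _ := by ring
  · rw [abs_mul, abs_mul, abs_mul, abs_of_nonneg hW]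
    calc _ ≤ |q.1| * (2 * ‖u‖ * min |q.1| 1 ^ β) * (‖M‖ * |s - t| ^ γ) *
          ringKernel e (kernelExponent V α) q := by
          gcongr
          · exact abs_taylorRemainder_le hβ u t hq
          · exact M.abs_sub_le s t q
      _ = _ := by ring

/-- The increment in s falls either on the remainder, which costs the integral with h = |s-t|, or on
M, which is Hölder of exponent β - α by assumption. -/
theorem exists_bilinear_bounds [Nontrivial V] {e : V} (he : ‖e‖ = 1) (hα : 0 < α)
    (hαβ : α < β) : ∃ K, 0 ≤ K ∧ ∀ (u : HolderSpace 1 β)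
      (M : HolderFamily (β - α) (ℝ × Metric.sphere (0 : V) 1)),
      (∀ s, |∫ q, bilinearIntegrand e α u M s q ∂(volume.prod (surfaceMeasure V))| ≤
        K * ‖u‖ * ‖M‖) ∧
      ∀ s t, |∫ q, bilinearIntegrand e α u M s q ∂(volume.prod (surfaceMeasure V)) -
        ∫ q, bilinearIntegrand e α u M t q ∂(volume.prod (surfaceMeasure V))| ≤
        K * ‖u‖ * ‖M‖ * |s - t| ^ (β - α) := by
  obtain ⟨K, hK0, hK⟩ := exists_integral_mul_ringKernel_le he hα hαβ
  have hβ : 0 ≤ β := by linarith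
  -- 6 = 4 + 2: the increment of the remainder contributes 4K and that of M contributes 2K. The
  -- supremum bound needs only 2K.
  refine ⟨6 * K, by positivity, fun u M => ⟨fun s => ?_, fun s t => ?_⟩⟩
  · have h1 := norm_integral_le_of_norm_le ((hK 1 one_pos).1.const_mul (2 * ‖u‖ * ‖M‖))
      (f := bilinearIntegrand e α u M s) (by
        filter_upwards [ae_fst_ne_zero] with q hq
        exact abs_bilinearIntegrand_le he hβ u M s hq)
    rw [integral_const_mul, Real.norm_eq_abs] at h1
    have h2 := (hK 1 one_pos).2
    rw [Real.one_rpow, mul_one] at h2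
    have h3 := mul_le_mul_of_nonneg_left h2 (by positivity : 0 ≤ 2 * ‖u‖ * ‖M‖)
    have h4 : 0 ≤ K * ‖u‖ * ‖M‖ := by positivity
    linarith
  · rcases eq_or_ne s t with rfl | hst
    · simp only [sub_self, abs_zero]
      positivity
    have hd : 0 < |s - t| := abs_pos.2 (sub_ne_zero.2 hst)
    rw [← integral_sub (integrable_bilinearIntegrand he hα hαβ u M s)
      (integrable_bilinearIntegrand he hα hαβ u M t)]
    have i1 := (hK _ hd).1.const_mul (4 * ‖u‖ * ‖M‖)
    have i2 := (hK 1 one_pos).1.const_mul (2 * ‖u‖ * ‖M‖ * |s - t| ^ (β - α))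
    have h1 := norm_integral_le_of_norm_le (i1.add i2)
      (f := fun q => bilinearIntegrand e α u M s q - bilinearIntegrand e α u M t q) (by
        filter_upwards [ae_fst_ne_zero] with q hq
        exact abs_bilinearIntegrand_sub_le he hβ u M s t hq)
    simp only [Pi.add_apply] at h1
    rw [integral_add i1 i2, integral_const_mul, integral_const_mul, Real.norm_eq_abs] at h1
    have h2 := mul_le_mul_of_nonneg_left (hK _ hd).2 (by positivity : 0 ≤ 4 * ‖u‖ * ‖M‖)
    have h3 := (hK 1 one_pos).2
    rw [Real.one_rpow, mul_one] at h3
    have h4 := mul_le_mul_of_nonneg_left h3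
      (by positivity : 0 ≤ 2 * ‖u‖ * ‖M‖ * |s - t| ^ (β - α))
    refine h1.trans ((add_le_add h2 h4).trans (le_of_eq ?_))
    ring

/-- The bilinear part of the nonlocal mean curvature,
`(u, M) ↦ ∫∫ τ (u'(s-τ) - (u(s)-u(s-τ))/τ) M(s,τ,σ) (τ² + 2(1-⟪σ,e⟫))^{-p} dσ dτ`. -/
def bilinearCLM [Nontrivial V] {e : V} (he : ‖e‖ = 1) (hα : 0 < α) (hαβ : α < β) :
    HolderSpace 1 β →L[ℝ] HolderFamily (β - α) (ℝ × Metric.sphere (0 : V) 1) →L[ℝ]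
      HolderSpace 0 (β - α) :=
  LinearMap.mkContinuous₂
    (LinearMap.mk₂ ℝ (fun u M => HolderSpace.ofBounds (sub_pos.2 hαβ)
      (fun s => ∫ q, bilinearIntegrand e α u M s q ∂(volume.prod (surfaceMeasure V)))
      (by obtain ⟨K, _, hK⟩ := exists_bilinear_bounds he hα hαβ
          exact ⟨_, (hK u M).1⟩)
      (by obtain ⟨K, _, hK⟩ := exists_bilinear_bounds he hα hαβ
          exact ⟨_, (hK u M).2⟩))
      (fun u v M => HolderSpace.ext fun s => by
        simp only [HolderSpace.coe_add, Pi.add_apply, HolderSpace.ofBounds_apply]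
        rw [← integral_add (integrable_bilinearIntegrand he hα hαβ u M s)
          (integrable_bilinearIntegrand he hα hαβ v M s)]
        refine integral_congr_ae (Eventually.of_forall fun q => ?_)
        simp only [bilinearIntegrand, taylorRemainder_add]
        ring)
      (fun c u M => HolderSpace.ext fun s => by
        simp only [HolderSpace.coe_smul, Pi.smul_apply, HolderSpace.ofBounds_apply, smul_eq_mul]
        rw [← integral_const_mul]
        refine integral_congr_ae (Eventually.of_forall fun q => ?_)
        simp only [bilinearIntegrand, taylorRemainder_smul]
        ring)
      (fun u M M' => HolderSpace.ext fun s => by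
        simp only [HolderSpace.coe_add, Pi.add_apply, HolderSpace.ofBounds_apply]
        rw [← integral_add (integrable_bilinearIntegrand he hα hαβ u M s)
          (integrable_bilinearIntegrand he hα hαβ u M' s)]
        refine integral_congr_ae (Eventually.of_forall fun q => ?_)
        simp only [bilinearIntegrand, HolderFamily.add_apply]
        ring)
      (fun c u M => HolderSpace.ext fun s => by
        simp only [HolderSpace.coe_smul, Pi.smul_apply, HolderSpace.ofBounds_apply, smul_eq_mul]
        rw [← integral_const_mul]
        refine integral_congr_ae (Eventually.of_forall fun q => ?_)
        simp only [bilinearIntegrand, HolderFamily.smul_apply]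
        ring))
    (2 * (exists_bilinear_bounds (V := V) he hα hαβ).choose) (fun u M => by
      have hK0 := (exists_bilinear_bounds (V := V) he hα hαβ).choose_spec.1
      have hK := (exists_bilinear_bounds (V := V) he hα hαβ).choose_spec.2 u M
      refine (HolderSpace.norm_le_of_bounds (by positivity) hK.1 hK.2).trans (le_of_eq ?_)
      ring)

theorem bilinearCLM_apply [Nontrivial V] {e : V} (he : ‖e‖ = 1) (hα : 0 < α) (hαβ : α < β)
    (u : HolderSpace 1 β) (M : HolderFamily (β - α) (ℝ × Metric.sphere (0 : V) 1)) (s : ℝ) :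
    bilinearCLM he hα hαβ u M s =
      ∫ q, bilinearIntegrand e α u M s q ∂(volume.prod (surfaceMeasure V)) := rfl

theorem integrable_mul_sphereDefect_mul_ringKernel [Nontrivial V] {e : V} (he : ‖e‖ = 1)
    (hα : 0 < α) (hα1 : α < 1) (M : HolderFamily γ (ℝ × Metric.sphere (0 : V) 1)) (s : ℝ) :
    Integrable (fun q => M s q * (sphereDefect e q.2 * ringKernel e (kernelExponent V α) q))
      (volume.prod (surfaceMeasure V)) := by
  refine (integrable_sphereDefect_mul_ringKernel he (one_lt_kernelExponent hα)
    (by unfold kernelExponent; linarith) (by unfold kernelExponent; linarith)).bdd_mul (c := ‖M‖)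
    (M.measurable s).aestronglyMeasurable (Eventually.of_forall fun q => M.abs_apply_le s q)

/-- The linear part of the nonlocal mean curvature,
`M ↦ ∫∫ M(s,τ,σ) (1-⟪σ,e⟫) (τ² + 2(1-⟪σ,e⟫))^{-p} dσ dτ`. -/
def defectCLM [Nontrivial V] {e : V} (he : ‖e‖ = 1) (hα : 0 < α) (hα1 : α < 1) (hγ : 0 < γ) :
    HolderFamily γ (ℝ × Metric.sphere (0 : V) 1) →L[ℝ] HolderSpace 0 γ :=
  have hI := integrable_sphereDefect_mul_ringKernel he (one_lt_kernelExponent (V := V) hα)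
    (by unfold kernelExponent; linarith) (by unfold kernelExponent; linarith)
  have hnn : ∀ q : ℝ × Metric.sphere (0 : V) 1,
      0 ≤ sphereDefect e q.2 * ringKernel e (kernelExponent V α) q := fun q =>
    mul_nonneg (sphereDefect_nonneg he _) (ringKernel_nonneg he _ _)
  have key1 : ∀ (M : HolderFamily γ (ℝ × Metric.sphere (0 : V) 1)) (s : ℝ),
      |∫ q, M s q * (sphereDefect e q.2 * ringKernel e (kernelExponent V α) q)
        ∂(volume.prod (surfaceMeasure V))| ≤ ‖M‖ *
      ∫ q, sphereDefect e q.2 * ringKernel e (kernelExponent V α) q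
        ∂(volume.prod (surfaceMeasure V)) := fun M s => by
    rw [← integral_const_mul, ← Real.norm_eq_abs]
    refine norm_integral_le_of_norm_le (hI.const_mul ‖M‖) (Eventually.of_forall fun q => ?_)
    rw [norm_mul, Real.norm_of_nonneg (hnn q)]
    exact mul_le_mul_of_nonneg_right (M.abs_apply_le s q) (hnn q)
  have key2 : ∀ (M : HolderFamily γ (ℝ × Metric.sphere (0 : V) 1)) (s t : ℝ),
      |∫ q, M s q * (sphereDefect e q.2 * ringKernel e (kernelExponent V α) q)
        ∂(volume.prod (surfaceMeasure V)) -
      ∫ q, M t q * (sphereDefect e q.2 * ringKernel e (kernelExponent V α) q)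
        ∂(volume.prod (surfaceMeasure V))| ≤ ‖M‖ *
      (∫ q, sphereDefect e q.2 * ringKernel e (kernelExponent V α) q
        ∂(volume.prod (surfaceMeasure V))) * |s - t| ^ γ := fun M s t => by
    rw [← integral_sub (integrable_mul_sphereDefect_mul_ringKernel he hα hα1 M s)
      (integrable_mul_sphereDefect_mul_ringKernel he hα hα1 M t), mul_right_comm,
      ← integral_const_mul, ← Real.norm_eq_abs]
    refine norm_integral_le_of_norm_le (hI.const_mul _) (Eventually.of_forall fun q => ?_)
    rw [← sub_mul, norm_mul, Real.norm_of_nonneg (hnn q)]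
    exact mul_le_mul_of_nonneg_right (M.abs_sub_le s t q) (hnn q)
  LinearMap.mkContinuous
    { toFun := fun M => HolderSpace.ofBounds hγ (fun s =>
        ∫ q, M s q * (sphereDefect e q.2 * ringKernel e (kernelExponent V α) q)
          ∂(volume.prod (surfaceMeasure V))) ⟨_, key1 M⟩ ⟨_, key2 M⟩
      map_add' := fun M M' => HolderSpace.ext fun s => by
        simp only [HolderSpace.coe_add, Pi.add_apply, HolderSpace.ofBounds_apply]
        rw [← integral_add (integrable_mul_sphereDefect_mul_ringKernel he hα hα1 M s)
          (integrable_mul_sphereDefect_mul_ringKernel he hα hα1 M' s)]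
        refine integral_congr_ae (Eventually.of_forall fun q => ?_)
        simp only [HolderFamily.add_apply]
        ring
      map_smul' := fun c M => HolderSpace.ext fun s => by
        simp only [HolderSpace.coe_smul, Pi.smul_apply, HolderSpace.ofBounds_apply, smul_eq_mul,
          RingHom.id_apply]
        rw [← integral_const_mul]
        refine integral_congr_ae (Eventually.of_forall fun q => ?_)
        simp only [HolderFamily.smul_apply]
        ring }
    (2 * ∫ q, sphereDefect e q.2 * ringKernel e (kernelExponent V α) q
        ∂(volume.prod (surfaceMeasure V))) fun M => by
    refine (HolderSpace.norm_le_of_bounds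
      (mul_nonneg (norm_nonneg M) (integral_nonneg hnn)) (key1 M) (key2 M)).trans (le_of_eq ?_)
    ring

theorem defectCLM_apply [Nontrivial V] {e : V} (he : ‖e‖ = 1) (hα : 0 < α) (hα1 : α < 1)
    (hγ : 0 < γ) (M : HolderFamily γ (ℝ × Metric.sphere (0 : V) 1)) (s : ℝ) :
    defectCLM he hα hα1 hγ M s =
      ∫ q, M s q * (sphereDefect e q.2 * ringKernel e (kernelExponent V α) q)
        ∂(volume.prod (surfaceMeasure V)) := rfl

end Operators

/-! ### The cone of functions bounded below by a positive constant -/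

theorem exists_pos_le_of_mem_positiveCone {β : ℝ} {u : HolderSpace 1 β} (hu : u ∈ positiveCone β) :
    ∃ m, 0 < m ∧ ∀ s, m ≤ u s :=
  ⟨⨅ s, u s, hu, fun s => ciInf_le ⟨-‖u‖, by
    rintro _ ⟨t, rfl⟩; exact (abs_le.1 (u.abs_apply_le t)).1⟩ s⟩

theorem mem_positiveCone_of_le {β : ℝ} {u : HolderSpace 1 β} {m : ℝ} (hm : 0 < m)
    (h : ∀ s, m ≤ u s) : u ∈ positiveCone β := lt_of_lt_of_le hm (le_ciInf h)

theorem isOpen_positiveCone (β : ℝ) : IsOpen (positiveCone β) := by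
  rw [Metric.isOpen_iff]
  intro u hu
  obtain ⟨m, hm, hmu⟩ := exists_pos_le_of_mem_positiveCone hu
  refine ⟨m / 2, half_pos hm, fun v hv => mem_positiveCone_of_le (half_pos hm) fun s => ?_⟩
  rw [Metric.mem_ball, dist_eq_norm] at hv
  have h1 := (abs_le.1 ((v - u).abs_apply_le s)).1
  have h2 : (v - u : HolderSpace 1 β) s = v s - u s := rfl
  rw [h2] at h1
  linarith [hmu s]

/-! ### The curvature map and its smoothness -/

section CurvatureMap

variable {V : Type*} [NormedAddCommGroup V] [InnerProductSpace ℝ V] [FiniteDimensional ℝ V]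
  [MeasurableSpace V] [BorelSpace V] {α β γ : ℝ}

/-- The weight `τ² / (τ² + 2(1 - ⟪σ,e⟫))`. -/
def ringWeight (e : V) (q : ℝ × Metric.sphere (0 : V) 1) : ℝ :=
  q.1 ^ 2 / (q.1 ^ 2 + 2 * sphereDefect e q.2)

theorem ringWeight_mem_Icc {e : V} (he : ‖e‖ = 1) (q : ℝ × Metric.sphere (0 : V) 1) :
    ringWeight e q ∈ Icc (0 : ℝ) 1 := by
  have hc := sphereDefect_nonneg he q.2
  exact ⟨by unfold ringWeight; positivity, div_le_one_of_le₀ (by linarith) (by positivity)⟩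

/-- `ringWeight` as a uniformly Hölder family. -/
def weightFamily {e : V} (he : ‖e‖ = 1) (γ : ℝ) :
    HolderFamily γ (ℝ × Metric.sphere (0 : V) 1) :=
  HolderFamily.constFamily (ringWeight e)
    (by have := measurable_sphereDefect e; unfold ringWeight; fun_prop)
    ⟨1, fun q => by
      have := ringWeight_mem_Icc he q
      rw [abs_of_nonneg this.1]; exact this.2⟩

/-- The family `u(s)`. -/
def valueFamily (V : Type*) [NormedAddCommGroup V] [InnerProductSpace ℝ V]
    [MeasurableSpace V] [BorelSpace V] (hγ : 0 < γ) (hγ1 : γ ≤ 1) :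
    HolderSpace 1 β →L[ℝ] HolderFamily γ (ℝ × Metric.sphere (0 : V) 1) :=
  HolderFamily.shiftCLM hγ hγ1 (fun _ => 0) measurable_const

/-- The family `u(s - τ)`. -/
def translateFamily (V : Type*) [NormedAddCommGroup V] [InnerProductSpace ℝ V]
    [MeasurableSpace V] [BorelSpace V] (hγ : 0 < γ) (hγ1 : γ ≤ 1) :
    HolderSpace 1 β →L[ℝ] HolderFamily γ (ℝ × Metric.sphere (0 : V) 1) :=
  HolderFamily.shiftCLM hγ hγ1 Prod.fst measurable_fst

/-- The family `(u(s) - u(s - τ)) / τ`. -/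
def slopeFamily (V : Type*) [NormedAddCommGroup V] [InnerProductSpace ℝ V]
    [MeasurableSpace V] [BorelSpace V] (hγ : 0 < γ) (hγβ : γ ≤ β) :
    HolderSpace 1 β →L[ℝ] HolderFamily γ (ℝ × Metric.sphere (0 : V) 1) :=
  HolderFamily.quotientCLM hγ hγβ Prod.fst measurable_fst

/-- The normalized squared distance between `(s, u(s) e)` and `(s - τ, u(s - τ) σ)`. -/
def distanceFamily {e : V} (he : ‖e‖ = 1) (hγ : 0 < γ) (hγβ : γ ≤ β) (hβ1 : β ≤ 1)
    (u : HolderSpace 1 β) : HolderFamily γ (ℝ × Metric.sphere (0 : V) 1) :=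
  weightFamily he γ * (1 + slopeFamily V hγ hγβ u ^ 2) +
    (1 - weightFamily he γ) *
      (valueFamily V hγ (hγβ.trans hβ1) u * translateFamily V hγ (hγβ.trans hβ1) u)

/-- The normalized density of the surface integral representing the curvature. -/
def densityFamily {e : V} (he : ‖e‖ = 1) (hγ : 0 < γ) (hγβ : γ ≤ β) (hβ1 : β ≤ 1) (α : ℝ)
    (u : HolderSpace 1 β) : HolderFamily γ (ℝ × Metric.sphere (0 : V) 1) :=
  translateFamily V hγ (hγβ.trans hβ1) u ^ (Module.finrank ℝ V - 1) *
    HolderFamily.rpow (-kernelExponent V α) (distanceFamily he hγ hγβ hβ1 u)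

/-- The nonlocal mean curvature as a map between Hölder spaces. -/
def curvatureMap [Nontrivial V] {e : V} (he : ‖e‖ = 1) (hα : 0 < α) (hαβ : α < β) (hβ : β < 1)
    (u : HolderSpace 1 β) : HolderSpace 0 (β - α) :=
  (2 / α) • (bilinearCLM he hα hαβ u
      (densityFamily he (sub_pos.2 hαβ) (sub_le_self β hα.le) hβ.le α u) +
    defectCLM he hα (hαβ.trans hβ) (sub_pos.2 hαβ)
      (valueFamily V (sub_pos.2 hαβ) ((sub_le_self β hα.le).trans hβ.le) u *
        densityFamily he (sub_pos.2 hαβ) (sub_le_self β hα.le) hβ.le α u))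

/-- The family is a convex combination, with weight `ringWeight`, of 1 + slope² ≥ 1 and u(s)u(s-τ) ≥
m², where m > 0 is a lower bound of u. -/
theorem distanceFamily_isPositive {e : V} (he : ‖e‖ = 1) (hγ : 0 < γ) (hγβ : γ ≤ β) (hβ1 : β ≤ 1)
    {u : HolderSpace 1 β} (hu : u ∈ positiveCone β) :
    (distanceFamily he hγ hγβ hβ1 u).IsPositive := by
  obtain ⟨m, hm, hmu⟩ := exists_pos_le_of_mem_positiveCone hu
  refine ⟨min 1 (m ^ 2), by positivity, fun s q => ?_⟩
  obtain ⟨h0, h1⟩ := ringWeight_mem_Icc he q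
  have hab : m ^ 2 ≤ u (s - 0) * u (s - q.1) := by
    rw [sq]; exact mul_le_mul (hmu _) (hmu _) hm.le (hm.le.trans (hmu _))
  change min 1 (m ^ 2) ≤ ringWeight e q * (1 + ((u s - u (s - q.1)) / q.1) ^ 2) +
    (1 - ringWeight e q) * (u (s - 0) * u (s - q.1))
  have h2 : min 1 (m ^ 2) ≤ 1 + ((u s - u (s - q.1)) / q.1) ^ 2 :=
    (min_le_left _ _).trans (le_add_of_nonneg_right (sq_nonneg _))
  have h3 : min 1 (m ^ 2) ≤ u (s - 0) * u (s - q.1) := (min_le_right _ _).trans hab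
  have h4 := mul_le_mul_of_nonneg_left h2 h0
  have h5 := mul_le_mul_of_nonneg_left h3 (sub_nonneg.2 h1)
  linarith

theorem contDiff_distanceFamily {e : V} (he : ‖e‖ = 1) (hγ : 0 < γ) (hγβ : γ ≤ β) (hβ1 : β ≤ 1) :
    ContDiff ℝ ∞ (distanceFamily he hγ hγβ hβ1 : HolderSpace 1 β → _) := by
  unfold distanceFamily
  exact (contDiff_const.mul (contDiff_const.add ((slopeFamily V hγ hγβ).contDiff.pow 2))).add
    (contDiff_const.mul ((valueFamily V hγ _).contDiff.mul (translateFamily V hγ _).contDiff))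

theorem contDiffAt_densityFamily {e : V} (he : ‖e‖ = 1) (hγ : 0 < γ) (hγβ : γ ≤ β) (hβ1 : β ≤ 1)
    (α : ℝ) {u : HolderSpace 1 β} (hu : u ∈ positiveCone β) :
    ContDiffAt ℝ ∞ (densityFamily he hγ hγβ hβ1 α : HolderSpace 1 β → _) u := by
  unfold densityFamily
  exact ((translateFamily V hγ _).contDiff.pow _).contDiffAt.mul
    ((HolderFamily.contDiffAt_rpow _ (distanceFamily_isPositive he hγ hγβ hβ1 hu)).comp u
      (contDiff_distanceFamily he hγ hγβ hβ1).contDiffAt)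

/-- All nonlinearity sits in the density, already smooth as a map into the algebra of families; the
singular integration is performed by bounded bilinear and linear maps, so no differentiation under
the integral sign is required. -/
theorem contDiffAt_curvatureMap [Nontrivial V] {e : V} (he : ‖e‖ = 1) (hα : 0 < α) (hαβ : α < β)
    (hβ : β < 1) {u : HolderSpace 1 β} (hu : u ∈ positiveCone β) :
    ContDiffAt ℝ ∞ (curvatureMap he hα hαβ hβ) u := by
  unfold curvatureMap
  have hd := contDiffAt_densityFamily he (sub_pos.2 hαβ) (sub_le_self β hα.le) hβ.le α hu
  refine ContDiffAt.const_smul _ (ContDiffAt.add ?_ ?_)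
  · exact (bilinearCLM he hα hαβ).contDiff.contDiffAt.clm_apply hd
  · exact (defectCLM he hα _ _).contDiff.contDiffAt.comp u
      ((valueFamily V _ _).contDiff.contDiffAt.mul hd)

/-- The squared distance between `(s, u(s) e)` and `(s - τ, u(s - τ) σ)`. -/
def ringDistance (e : V) (u : HolderSpace 1 β) (s : ℝ) (q : ℝ × Metric.sphere (0 : V) 1) : ℝ :=
  q.1 ^ 2 + (u s - u (s - q.1)) ^ 2 + 2 * u s * u (s - q.1) * sphereDefect e q.2

/-- The integrand of the surface integral representing the nonlocal mean curvature. -/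
def surfaceIntegrand (e : V) (α : ℝ) (u : HolderSpace 1 β) (s : ℝ)
    (q : ℝ × Metric.sphere (0 : V) 1) : ℝ :=
  (q.1 * taylorRemainder u s q.1 + sphereDefect e q.2 * u s) *
    u (s - q.1) ^ (Module.finrank ℝ V - 1) * ringDistance e u s q ^ (-kernelExponent V α)

/-- The squared distance factors as `distanceFamily` times τ² + 2(1-⟨σ,e⟩), and real powers split
over nonnegative factors. The u-dependence is thereby separated from the singularity. -/
theorem densityFamily_mul_ringKernel {e : V} (he : ‖e‖ = 1) (hγ : 0 < γ) (hγβ : γ ≤ β)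
    (hβ1 : β ≤ 1) (α : ℝ) {u : HolderSpace 1 β} (hu : u ∈ positiveCone β) (s : ℝ)
    {q : ℝ × Metric.sphere (0 : V) 1} (hq : q.1 ≠ 0) :
    densityFamily he hγ hγβ hβ1 α u s q * ringKernel e (kernelExponent V α) q =
      u (s - q.1) ^ (Module.finrank ℝ V - 1) * ringDistance e u s q ^ (-kernelExponent V α) := by
  have hpos := distanceFamily_isPositive he hγ hγβ hβ1 hu
  have hc := sphereDefect_nonneg he q.2
  have hD : 0 < q.1 ^ 2 + 2 * sphereDefect e q.2 := by positivity
  have h0 : 0 ≤ distanceFamily he hγ hγβ hβ1 u s q := by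
    obtain ⟨c, hc, hcF⟩ := hpos
    exact hc.le.trans (hcF s q)
  rw [densityFamily, HolderFamily.mul_apply, HolderFamily.rpow_apply _ hpos, mul_assoc, ringKernel,
    ← Real.mul_rpow h0 hD.le, HolderFamily.pow_apply]
  congr 2
  change (ringWeight e q * (1 + ((u s - u (s - q.1)) / q.1) ^ 2) +
    (1 - ringWeight e q) * (u (s - 0) * u (s - q.1))) * (q.1 ^ 2 + 2 * sphereDefect e q.2) = _
  rw [ringWeight, ringDistance, sub_zero]
  field_simp
  ring

theorem curvatureMap_apply [Nontrivial V] {e : V} (he : ‖e‖ = 1) (hα : 0 < α) (hαβ : α < β)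
    (hβ : β < 1) {u : HolderSpace 1 β} (hu : u ∈ positiveCone β) (s : ℝ) :
    Integrable (surfaceIntegrand e α u s) (volume.prod (surfaceMeasure V)) ∧
    curvatureMap he hα hαβ hβ u s =
      2 / α * ∫ q, surfaceIntegrand e α u s q ∂(volume.prod (surfaceMeasure V)) := by
  set M := densityFamily he (sub_pos.2 hαβ) (sub_le_self β hα.le) hβ.le α u with hM
  have h1 := integrable_bilinearIntegrand he hα hαβ u M s
  have h2 := integrable_mul_sphereDefect_mul_ringKernel he hα (hαβ.trans hβ)
    (valueFamily V (sub_pos.2 hαβ) ((sub_le_self β hα.le).trans hβ.le) u * M) s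
  have hae : ∀ᵐ q ∂(volume.prod (surfaceMeasure V)), bilinearIntegrand e α u M s q +
      (valueFamily V (sub_pos.2 hαβ) ((sub_le_self β hα.le).trans hβ.le) u * M) s q *
        (sphereDefect e q.2 * ringKernel e (kernelExponent V α) q) =
      surfaceIntegrand e α u s q := by
    filter_upwards [ae_fst_ne_zero] with q hq
    have hk := densityFamily_mul_ringKernel he (sub_pos.2 hαβ) (sub_le_self β hα.le) hβ.le α hu s hq
    have hv : valueFamily V (sub_pos.2 hαβ) ((sub_le_self β hα.le).trans hβ.le) u s q =
        u (s - 0) := rfl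
    rw [surfaceIntegrand, mul_assoc _ (u (s - q.1) ^ _), ← hk, ← hM, HolderFamily.mul_apply, hv,
      sub_zero, bilinearIntegrand]
    ring
  refine ⟨(h1.add h2).congr hae, ?_⟩
  rw [← integral_congr_ae hae, integral_add h1 h2, ← bilinearCLM_apply he hα hαβ,
    ← defectCLM_apply he hα (hαβ.trans hβ) (sub_pos.2 hαβ)]
  rfl

end CurvatureMap

/-! ### A regularized divergence theorem over cylindrical graphs -/

section Divergence

variable {V : Type*} [NormedAddCommGroup V] [InnerProductSpace ℝ V]

/-- The regularized squared distance between `(0, a e)` and `(τ, ρ w(τ) σ)`, as a function of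
`(τ, σ, ρ)`. -/
def coneDistance (e : V) (w : ℝ → ℝ) (a ε : ℝ) (q : ℝ × (Metric.sphere (0 : V) 1 × ℝ)) : ℝ :=
  q.1 ^ 2 + ε ^ 2 + (q.2.2 ^ 2 * w q.1 ^ 2 - 2 * a * (q.2.2 * w q.1) * inner ℝ (q.2.1 : V) e + a ^ 2)

/-- With r = ρw and x = ⟨σ,e⟩, the remaining part of the squared distance is (r - ax)² + a²(1 - x²)
≥ 0. -/
theorem le_coneDistance {e : V} (he : ‖e‖ = 1) (w : ℝ → ℝ) (a ε : ℝ)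
    (q : ℝ × (Metric.sphere (0 : V) 1 × ℝ)) :
    q.1 ^ 2 + ε ^ 2 ≤ coneDistance e w a ε q := by
  have h := abs_inner_sphere_le he q.2.1
  have h1 : inner ℝ (q.2.1 : V) e ^ 2 ≤ 1 := by
    rw [← sq_abs]; exact pow_le_one₀ (abs_nonneg _) h
  unfold coneDistance
  set x : ℝ := inner ℝ (q.2.1 : V) e
  have h2 : 0 ≤ a ^ 2 * (1 - x ^ 2) := mul_nonneg (sq_nonneg _) (by linarith)
  nlinarith [sq_nonneg (q.2.2 * w q.1 - a * x)]

theorem coneDistance_pos {e : V} (he : ‖e‖ = 1) (w : ℝ → ℝ) (a : ℝ) {ε : ℝ} (hε : 0 < ε)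
    (q : ℝ × (Metric.sphere (0 : V) 1 × ℝ)) : 0 < coneDistance e w a ε q :=
  lt_of_lt_of_le (by positivity) (le_coneDistance he w a ε q)

/-- The tangential flux density. -/
def fluxTangential (e : V) (w : ℝ → ℝ) (a ε p : ℝ) (k : ℕ)
    (q : ℝ × (Metric.sphere (0 : V) 1 × ℝ)) : ℝ :=
  q.1 * q.2.2 ^ k * w q.1 ^ (k + 1) * coneDistance e w a ε q ^ (-p)

/-- The derivative of `fluxTangential` in `τ`. -/
def fluxTangentialDeriv (e : V) (w w' : ℝ → ℝ) (a ε p : ℝ) (k : ℕ)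
    (q : ℝ × (Metric.sphere (0 : V) 1 × ℝ)) : ℝ :=
  q.2.2 ^ k * w q.1 ^ (k + 1) * coneDistance e w a ε q ^ (-p) +
    (k + 1) * q.2.2 ^ k * w q.1 ^ k * w' q.1 * (q.1 * coneDistance e w a ε q ^ (-p)) -
    2 * p * q.2.2 ^ k * w q.1 ^ (k + 1) * (q.1 ^ 2 * coneDistance e w a ε q ^ (-p - 1)) -
    2 * p * q.2.2 ^ k * w q.1 ^ (k + 1) * w' q.1 *
      (q.2.2 ^ 2 * w q.1 - a * q.2.2 * inner ℝ (q.2.1 : V) e) *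
      (q.1 * coneDistance e w a ε q ^ (-p - 1))

/-- The radial flux density. -/
def fluxRadial (e : V) (w w' : ℝ → ℝ) (a ε p : ℝ) (k : ℕ)
    (q : ℝ × (Metric.sphere (0 : V) 1 × ℝ)) : ℝ :=
  q.2.2 ^ k * w q.1 ^ k * (q.2.2 * w q.1 - a * inner ℝ (q.2.1 : V) e - q.2.2 * (q.1 * w' q.1)) *
    coneDistance e w a ε q ^ (-p)

/-- The regularized kernel in the coordinates `(τ, σ, ρ)`, with the volume density. -/
def coneKernel (e : V) (w : ℝ → ℝ) (a ε p α : ℝ) (k : ℕ)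
    (q : ℝ × (Metric.sphere (0 : V) 1 × ℝ)) : ℝ :=
  q.2.2 ^ k * w q.1 ^ (k + 1) * (coneDistance e w a ε q ^ (-p) -
    2 * p / α * ε ^ 2 * coneDistance e w a ε q ^ (-p - 1))

/-- The spherical part of the divergence. -/
def fluxSpherical (e : V) (w : ℝ → ℝ) (a ε p : ℝ) (k : ℕ)
    (q : ℝ × (Metric.sphere (0 : V) 1 × ℝ)) : ℝ :=
  2 * p * q.2.2 ^ k * w q.1 ^ (k + 1) * a ^ 2 * (1 - inner ℝ (q.2.1 : V) e ^ 2) *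
      coneDistance e w a ε q ^ (-p - 1) -
    k * q.2.2 ^ (k - 1) * w q.1 ^ k * a * inner ℝ (q.2.1 : V) e * coneDistance e w a ε q ^ (-p)

variable {e : V} {w w' : ℝ → ℝ} {a ε p α : ℝ} {k : ℕ}

theorem hasDerivAt_fluxTangential (he : ‖e‖ = 1) (hε : 0 < ε)
    (hw : ∀ τ, HasDerivAt w (w' τ) τ) (y : Metric.sphere (0 : V) 1 × ℝ) (τ : ℝ) :
    HasDerivAt (fun τ => fluxTangential e w a ε p k (τ, y))
      (fluxTangentialDeriv e w w' a ε p k (τ, y)) τ := by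
  have hpos := coneDistance_pos he w a hε (τ, y)
  have hQ : HasDerivAt (fun τ => coneDistance e w a ε (τ, y))
      (2 * τ + (y.2 ^ 2 * (2 * w τ * w' τ) - 2 * a * (y.2 * w' τ) * inner ℝ (y.1 : V) e)) τ := by
    have h1 : HasDerivAt (fun τ : ℝ => τ ^ 2 + ε ^ 2) (2 * τ) τ := by
      simpa using (hasDerivAt_pow 2 τ).add_const (ε ^ 2)
    have h2 : HasDerivAt (fun τ => w τ ^ 2) (2 * w τ * w' τ) τ := by
      simpa using (hw τ).fun_pow 2
    exact h1.fun_add (((h2.const_mul (y.2 ^ 2)).fun_sub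
      ((((hw τ).const_mul y.2).const_mul (2 * a)).mul_const (inner ℝ (y.1 : V) e))).add_const
        (a ^ 2))
  have hQp := hQ.rpow_const (p := -p) (Or.inl hpos.ne')
  have h3 : HasDerivAt (fun τ => τ * y.2 ^ k * w τ ^ (k + 1))
      (1 * y.2 ^ k * w τ ^ (k + 1) + τ * y.2 ^ k * ((k + 1) * w τ ^ k * w' τ)) τ := by
    refine (((hasDerivAt_id τ).mul_const (y.2 ^ k)).fun_mul ((hw τ).fun_pow (k + 1))).congr_deriv ?_
    simp
  refine (h3.fun_mul hQp).congr_deriv ?_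
  simp only [fluxTangentialDeriv]
  ring

/-- The pointwise divergence theorem: in the coordinates (τ,σ,ρ), with density ρ^k w^{k+1}, the
divergence of z(|z|²+ε²)^{-p} splits into a ρ-derivative, a τ-derivative and a spherical part. The
hypothesis 2p = k + 2 + α says that k + 2 is the ambient dimension. -/
theorem hasDerivAt_fluxRadial (he : ‖e‖ = 1) (hε : 0 < ε) (hα : α ≠ 0)
    (hp : 2 * p = k + 2 + α) (τ : ℝ) (σ : Metric.sphere (0 : V) 1) (ρ : ℝ) :
    HasDerivAt (fun ρ => fluxRadial e w w' a ε p k (τ, σ, ρ))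
      (-α * coneKernel e w a ε p α k (τ, σ, ρ) + fluxSpherical e w a ε p k (τ, σ, ρ) -
        fluxTangentialDeriv e w w' a ε p k (τ, σ, ρ)) ρ := by
  have hpos := coneDistance_pos he w a hε (τ, σ, ρ)
  set x : ℝ := inner ℝ (σ : V) e with hx
  have hQ : HasDerivAt (fun ρ => coneDistance e w a ε (τ, σ, ρ))
      (2 * ρ * w τ ^ 2 - 2 * a * w τ * x) ρ := by
    have h2 : HasDerivAt (fun ρ : ℝ => ρ ^ 2) (2 * ρ) ρ := by simpa using hasDerivAt_pow 2 ρ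
    refine ((((h2.mul_const (w τ ^ 2)).fun_sub ((((hasDerivAt_id ρ).mul_const (w τ)).const_mul
      (2 * a)).mul_const x)).add_const (a ^ 2)).const_add (τ ^ 2 + ε ^ 2)).congr_deriv ?_
    ring
  have hQp := hQ.rpow_const (p := -p) (Or.inl hpos.ne')
  have h3 : HasDerivAt (fun ρ => ρ ^ k * w τ ^ k * (ρ * w τ - a * x - ρ * (τ * w' τ)))
      (k * ρ ^ (k - 1) * w τ ^ k * (ρ * w τ - a * x - ρ * (τ * w' τ)) +
        ρ ^ k * w τ ^ k * (w τ - τ * w' τ)) ρ := by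
    refine (((hasDerivAt_pow k ρ).mul_const (w τ ^ k)).fun_mul
      ((((hasDerivAt_id ρ).mul_const (w τ)).sub_const (a * x)).fun_sub
        ((hasDerivAt_id ρ).mul_const (τ * w' τ)))).congr_deriv ?_
    simp
  refine (h3.fun_mul hQp).congr_deriv ?_
  have hk : (k : ℝ) * ρ ^ (k - 1) * ρ = k * ρ ^ k := by
    rcases Nat.eq_zero_or_pos k with h | h
    · simp [h]
    · rw [mul_assoc, ← pow_succ, Nat.sub_add_cancel h]
  -- Every power is expressed through Q^{-p-1}, so that the claim becomes polynomial once α is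
  -- replaced by 2p - k - 2 and Q by its formula.
  have hP : coneDistance e w a ε (τ, σ, ρ) ^ (-p) =
      coneDistance e w a ε (τ, σ, ρ) * coneDistance e w a ε (τ, σ, ρ) ^ (-p - 1) := by
    rw [mul_comm, ← Real.rpow_add_one hpos.ne']; congr 1; ring
  simp only [fluxTangentialDeriv, coneKernel, fluxSpherical, ← hx]
  rw [hP]
  set R := coneDistance e w a ε (τ, σ, ρ) ^ (-p - 1) with hR
  have hQe : coneDistance e w a ε (τ, σ, ρ) =
      τ ^ 2 + ε ^ 2 + (ρ ^ 2 * w τ ^ 2 - 2 * a * (ρ * w τ) * x + a ^ 2) := rfl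
  set Q := coneDistance e w a ε (τ, σ, ρ) with hQdef
  have hα' : α = 2 * p - k - 2 := by linarith
  have e1 : -α * (ρ ^ k * w τ ^ (k + 1) * (Q * R - 2 * p / α * ε ^ 2 * R)) =
      ρ ^ k * w τ ^ (k + 1) * R * (2 * p * ε ^ 2 - α * Q) := by
    field_simp
    ring
  rw [e1, hα']
  have e2 : (k : ℝ) * ρ ^ (k - 1) * w τ ^ k * (ρ * w τ - a * x - ρ * (τ * w' τ)) =
      k * ρ ^ k * w τ ^ k * (w τ - τ * w' τ) - k * ρ ^ (k - 1) * w τ ^ k * a * x := by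
    rw [← hk]; ring
  rw [e2, pow_succ (w τ) k]
  clear_value Q R
  subst hQe
  ring

end Divergence

/-! ### Densities dominated by a function of τ -/

section Dominated

variable {V : Type*} [NormedAddCommGroup V] [InnerProductSpace ℝ V] [FiniteDimensional ℝ V]
  [MeasurableSpace V] [BorelSpace V]

/-- `F(τ, σ, ρ)` is measurable and bounded by a multiple of `h(τ)` for `0 ≤ ρ ≤ 1`. -/
def DominatedBy (h : ℝ → ℝ) (F : ℝ × (Metric.sphere (0 : V) 1 × ℝ) → ℝ) : Prop :=
  Measurable F ∧ ∃ C, ∀ q : ℝ × (Metric.sphere (0 : V) 1 × ℝ), q.2.2 ∈ Icc (0 : ℝ) 1 →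
    |F q| ≤ C * h q.1

namespace DominatedBy

variable {h : ℝ → ℝ} {F G b : ℝ × (Metric.sphere (0 : V) 1 × ℝ) → ℝ}

theorem add (hF : DominatedBy h F) (hG : DominatedBy h G) : DominatedBy h fun q => F q + G q := by
  obtain ⟨hFm, C, hC⟩ := hF
  obtain ⟨hGm, D, hD⟩ := hG
  refine ⟨hFm.add hGm, C + D, fun q hq => ?_⟩
  rw [add_mul]
  exact (abs_add_le _ _).trans (add_le_add (hC q hq) (hD q hq))

theorem mul (hb : DominatedBy (fun _ => 1) b) (hF : DominatedBy h F) :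
    DominatedBy h fun q => b q * F q := by
  obtain ⟨hbm, C, hC⟩ := hb
  obtain ⟨hFm, D, hD⟩ := hF
  refine ⟨hbm.mul hFm, C * D, fun q hq => ?_⟩
  rw [abs_mul, mul_assoc]
  have := hC q hq
  rw [mul_one] at this
  exact mul_le_mul this (hD q hq) (abs_nonneg _) ((abs_nonneg _).trans this)

theorem const (c : ℝ) : DominatedBy (fun _ => 1)
    fun _ : ℝ × (Metric.sphere (0 : V) 1 × ℝ) => c :=
  ⟨measurable_const, |c|, fun _ _ => by simp⟩

theorem sub (hF : DominatedBy h F) (hG : DominatedBy h G) : DominatedBy h fun q => F q - G q := by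
  have := hF.add ((const (-1)).mul hG)
  simpa [sub_eq_add_neg] using this

theorem pow (hb : DominatedBy (fun _ => 1) b) (n : ℕ) :
    DominatedBy (fun _ => 1) fun q => b q ^ n := by
  induction n with
  | zero => simpa using const (V := V) 1
  | succ n ih => simpa only [pow_succ] using ih.mul hb

theorem radius : DominatedBy (fun _ => 1) fun q : ℝ × (Metric.sphere (0 : V) 1 × ℝ) => q.2.2 :=
  ⟨by fun_prop, 1, fun q hq => by rw [abs_of_nonneg hq.1, mul_one]; exact hq.2⟩

theorem angle {e : V} (he : ‖e‖ = 1) : DominatedBy (fun _ => 1)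
    fun q : ℝ × (Metric.sphere (0 : V) 1 × ℝ) => inner ℝ (q.2.1 : V) e :=
  ⟨by fun_prop, 1, fun q _ => by rw [mul_one]; exact abs_inner_sphere_le he _⟩

theorem of_bounded {w : ℝ → ℝ} (hw : Measurable w) {W : ℝ} (hW : ∀ τ, |w τ| ≤ W) :
    DominatedBy (fun _ => 1) fun q : ℝ × (Metric.sphere (0 : V) 1 × ℝ) => w q.1 :=
  ⟨by fun_prop, W, fun q _ => by rw [mul_one]; exact hW _⟩

theorem ae_mem : ∀ᵐ q ∂((volume : Measure ℝ).prod
    ((surfaceMeasure V).prod (volume.restrict (Ioc (0 : ℝ) 1)))), q.2.2 ∈ Icc (0 : ℝ) 1 := by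
  have h1 : ∀ᵐ ρ ∂(volume.restrict (Ioc (0 : ℝ) 1)), ρ ∈ Icc (0 : ℝ) 1 := by
    filter_upwards [ae_restrict_mem measurableSet_Ioc] with ρ hρ using Ioc_subset_Icc_self hρ
  exact Measure.quasiMeasurePreserving_snd.ae (Measure.quasiMeasurePreserving_snd.ae h1)

theorem integrable (hF : DominatedBy h F) (hh : Integrable h) :
    Integrable F ((volume : Measure ℝ).prod
      ((surfaceMeasure V).prod (volume.restrict (Ioc (0 : ℝ) 1)))) := by
  obtain ⟨hFm, C, hC⟩ := hF
  refine ((hh.const_mul C).comp_fst _).mono' hFm.aestronglyMeasurable ?_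
  filter_upwards [ae_mem] with q hq using hC q hq

theorem integrable_section (hF : DominatedBy h F) (τ : ℝ) :
    Integrable (fun y => F (τ, y))
      ((surfaceMeasure V).prod (volume.restrict (Ioc (0 : ℝ) 1))) := by
  obtain ⟨hFm, C, hC⟩ := hF
  refine Integrable.of_bound (hFm.comp measurable_prodMk_left).aestronglyMeasurable (C * h τ) ?_
  have h1 : ∀ᵐ ρ ∂(volume.restrict (Ioc (0 : ℝ) 1)), ρ ∈ Icc (0 : ℝ) 1 := by
    filter_upwards [ae_restrict_mem measurableSet_Ioc] with ρ hρ using Ioc_subset_Icc_self hρ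
  filter_upwards [Measure.quasiMeasurePreserving_snd.ae h1] with y hy using hC (τ, y) hy

theorem integrable_line (hF : DominatedBy h F) (hh : Integrable h)
    {y : Metric.sphere (0 : V) 1 × ℝ} (hy : y.2 ∈ Icc (0 : ℝ) 1) :
    Integrable fun τ => F (τ, y) := by
  obtain ⟨hFm, C, hC⟩ := hF
  exact (hh.const_mul C).mono' (hFm.comp measurable_prodMk_right).aestronglyMeasurable
    (Eventually.of_forall fun τ => hC (τ, y) hy)

theorem integrable_slice (hF : DominatedBy h F) (hh : Integrable h) {ρ : ℝ}
    (hρ : ρ ∈ Icc (0 : ℝ) 1) :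
    Integrable (fun q : ℝ × Metric.sphere (0 : V) 1 => F (q.1, q.2, ρ))
      ((volume : Measure ℝ).prod (surfaceMeasure V)) := by
  obtain ⟨hFm, C, hC⟩ := hF
  refine ((hh.const_mul C).comp_fst _).mono'
    (hFm.comp (by fun_prop)).aestronglyMeasurable (Eventually.of_forall fun q => ?_)
  exact hC (q.1, q.2, ρ) hρ

theorem integrable_sphere (hF : DominatedBy h F) (τ : ℝ) {ρ : ℝ} (hρ : ρ ∈ Icc (0 : ℝ) 1) :
    Integrable (fun σ : Metric.sphere (0 : V) 1 => F (τ, σ, ρ)) (surfaceMeasure V) := by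
  obtain ⟨hFm, C, hC⟩ := hF
  exact Integrable.of_bound (hFm.comp (by fun_prop)).aestronglyMeasurable (C * h τ)
    (Eventually.of_forall fun σ => hC (τ, σ, ρ) hρ)

end DominatedBy

/-- This single weight dominates all flux densities at fixed ε. It decays like |τ|^{1-2p}, which is
integrable for p > 1. -/
theorem integrable_one_add_abs_mul_rpow {ε p : ℝ} (hε : 0 < ε) (hp : 1 < p) :
    Integrable fun τ : ℝ => (1 + |τ|) * (τ ^ 2 + ε ^ 2) ^ (-p) := by
  refine ((integrable_min_abs_rpow (a := 0) (b := 1 - 2 * p) (by norm_num) (by linarith)).const_mul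
    (2 * max ((ε ^ 2) ^ (-p)) 1)).mono' (by fun_prop : Measurable fun τ : ℝ =>
      (1 + |τ|) * (τ ^ 2 + ε ^ 2) ^ (-p)).aestronglyMeasurable ?_
  have hne : ∀ᵐ τ : ℝ, τ ≠ 0 := by simp [ae_iff, measure_singleton]
  filter_upwards [hne] with τ hτ
  have hτ0 : 0 < |τ| := abs_pos.2 hτ
  rw [Real.norm_of_nonneg (by positivity), Real.rpow_zero]
  rcases le_total |τ| 1 with h | h
  · rw [min_eq_left (Real.one_le_rpow_of_pos_of_le_one_of_nonpos hτ0 h (by linarith)), mul_one]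
    have h1 : (τ ^ 2 + ε ^ 2) ^ (-p) ≤ (ε ^ 2) ^ (-p) :=
      Real.rpow_le_rpow_of_nonpos (by positivity) (by nlinarith) (by linarith)
    exact mul_le_mul (by linarith) (h1.trans (le_max_left _ _)) (by positivity) zero_le_two
  · rw [min_eq_right (Real.rpow_le_one_of_one_le_of_nonpos h (by linarith))]
    have h1 : (τ ^ 2 + ε ^ 2) ^ (-p) ≤ |τ| ^ (-(2 * p)) := by
      rw [← sq_rpow_neg]
      exact Real.rpow_le_rpow_of_nonpos (by positivity) (by nlinarith) (by linarith)
    have h2 : |τ| ^ (1 - 2 * p) = |τ| * |τ| ^ (-(2 * p)) := by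
      rw [sub_eq_neg_add, Real.rpow_add_one hτ0.ne', mul_comm]
    rw [h2]
    calc (1 + |τ|) * (τ ^ 2 + ε ^ 2) ^ (-p) ≤ (2 * |τ|) * |τ| ^ (-(2 * p)) := by
          gcongr; linarith
      _ = 2 * 1 * (|τ| * |τ| ^ (-(2 * p))) := by ring
      _ ≤ _ := by gcongr; exact le_max_right _ _

/-! ### Domination and integration of the flux densities -/

section Flux

variable {e : V} {w w' : ℝ → ℝ} {a ε p α : ℝ} {k : ℕ}

theorem measurable_coneDistance (hw : Measurable w) : Measurable (coneDistance e w a ε) := by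
  unfold coneDistance; fun_prop

/-- These five expressions are the only unbounded or decaying ingredients: every flux density is a
combination of them with coefficients bounded for 0 ≤ ρ ≤ 1. The loss of ε^{-2} is harmless because
ε is fixed here. -/
theorem dominatedBy_coneDistance_rpow (he : ‖e‖ = 1) (hε : 0 < ε) (hp : 0 < p)
    (hw : Measurable w) :
    DominatedBy (fun τ => (1 + |τ|) * (τ ^ 2 + ε ^ 2) ^ (-p))
      (fun q => coneDistance e w a ε q ^ (-p)) ∧
    DominatedBy (fun τ => (1 + |τ|) * (τ ^ 2 + ε ^ 2) ^ (-p))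
      (fun q => q.1 * coneDistance e w a ε q ^ (-p)) ∧
    DominatedBy (fun τ => (1 + |τ|) * (τ ^ 2 + ε ^ 2) ^ (-p))
      (fun q => coneDistance e w a ε q ^ (-p - 1)) ∧
    DominatedBy (fun τ => (1 + |τ|) * (τ ^ 2 + ε ^ 2) ^ (-p))
      (fun q => q.1 * coneDistance e w a ε q ^ (-p - 1)) ∧
    DominatedBy (fun τ => (1 + |τ|) * (τ ^ 2 + ε ^ 2) ^ (-p))
      (fun q => q.1 ^ 2 * coneDistance e w a ε q ^ (-p - 1)) := by
  have hQm := measurable_coneDistance (e := e) (a := a) (ε := ε) hw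
  have hpos := coneDistance_pos he w a hε
  have hle := le_coneDistance he w a ε
  have hT : ∀ q, coneDistance e w a ε q ^ (-p) ≤ (q.1 ^ 2 + ε ^ 2) ^ (-p) := fun q =>
    Real.rpow_le_rpow_of_nonpos (by positivity) (hle q) (by linarith)
  have hP : ∀ q, coneDistance e w a ε q ^ (-p) =
      coneDistance e w a ε q * coneDistance e w a ε q ^ (-p - 1) := fun q => by
    rw [mul_comm, ← Real.rpow_add_one (hpos q).ne']; congr 1; ring
  have hR : ∀ q, 0 < coneDistance e w a ε q ^ (-p - 1) := fun q => Real.rpow_pos_of_pos (hpos q) _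
  have hR1 : ∀ q, coneDistance e w a ε q ^ (-p - 1) ≤
      (ε ^ 2)⁻¹ * (q.1 ^ 2 + ε ^ 2) ^ (-p) := fun q => by
    rw [le_inv_mul_iff₀ (by positivity)]
    refine le_trans ?_ (hT q)
    rw [hP q]
    exact mul_le_mul_of_nonneg_right (by nlinarith [hle q, sq_nonneg q.1]) (hR q).le
  refine ⟨⟨by fun_prop, 1, fun q _ => ?_⟩, ⟨by fun_prop, 1, fun q _ => ?_⟩,
    ⟨by fun_prop, (ε ^ 2)⁻¹, fun q _ => ?_⟩, ⟨by fun_prop, (ε ^ 2)⁻¹, fun q _ => ?_⟩,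
    ⟨by fun_prop, 1, fun q _ => ?_⟩⟩
  · rw [abs_of_pos (Real.rpow_pos_of_pos (hpos q) _), one_mul]
    exact (hT q).trans (le_mul_of_one_le_left (by positivity)
      (le_add_of_nonneg_right (abs_nonneg _)))
  · rw [abs_mul, abs_of_pos (Real.rpow_pos_of_pos (hpos q) _), one_mul]
    exact mul_le_mul (by linarith) (hT q) (Real.rpow_pos_of_pos (hpos q) _).le (by positivity)
  · rw [abs_of_pos (hR q)]
    refine (hR1 q).trans ?_
    gcongr
    exact le_mul_of_one_le_left (by positivity) (le_add_of_nonneg_right (abs_nonneg _))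
  · rw [abs_mul, abs_of_pos (hR q)]
    calc |q.1| * coneDistance e w a ε q ^ (-p - 1)
        ≤ (1 + |q.1|) * ((ε ^ 2)⁻¹ * (q.1 ^ 2 + ε ^ 2) ^ (-p)) :=
          mul_le_mul (by linarith) (hR1 q) (hR q).le (by positivity)
      _ = _ := by ring
  · rw [abs_mul, abs_of_pos (hR q), abs_of_nonneg (sq_nonneg _), one_mul]
    have h1 : q.1 ^ 2 * coneDistance e w a ε q ^ (-p - 1) ≤ coneDistance e w a ε q ^ (-p) := by
      rw [hP q]
      exact mul_le_mul_of_nonneg_right (by nlinarith [hle q, sq_nonneg ε]) (hR q).le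
    exact (h1.trans (hT q)).trans (le_mul_of_one_le_left (by positivity)
      (le_add_of_nonneg_right (abs_nonneg _)))

variable {W W' : ℝ}

theorem dominatedBy_fluxTangential (he : ‖e‖ = 1) (hε : 0 < ε) (hp : 0 < p)
    (hwm : Measurable w) (hW : ∀ τ, |w τ| ≤ W) :
    DominatedBy (fun τ => (1 + |τ|) * (τ ^ 2 + ε ^ 2) ^ (-p)) (fluxTangential e w a ε p k) := by
  obtain ⟨-, h2, -⟩ := dominatedBy_coneDistance_rpow (a := a) he hε hp hwm
  have hw := DominatedBy.of_bounded (V := V) hwm hW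
  have := (((DominatedBy.radius (V := V)).pow k).mul (hw.pow (k + 1))).mul h2
  convert this using 1
  funext q
  simp only [fluxTangential]; ring

theorem dominatedBy_fluxTangentialDeriv (he : ‖e‖ = 1) (hε : 0 < ε) (hp : 0 < p)
    (hwm : Measurable w) (hW : ∀ τ, |w τ| ≤ W) (hwm' : Measurable w') (hW' : ∀ τ, |w' τ| ≤ W') :
    DominatedBy (fun τ => (1 + |τ|) * (τ ^ 2 + ε ^ 2) ^ (-p))
      (fluxTangentialDeriv e w w' a ε p k) := by
  obtain ⟨h1, h2, h3, h4, h5⟩ := dominatedBy_coneDistance_rpow (a := a) he hε hp hwm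
  have hw := DominatedBy.of_bounded (V := V) hwm hW
  have hw' := DominatedBy.of_bounded (V := V) hwm' hW'
  have hρ := DominatedBy.radius (V := V)
  have hx := DominatedBy.angle he
  have hc := DominatedBy.const (V := V)
  exact ((((hρ.pow k).mul (hw.pow (k + 1))).mul h1).add
    (((((hc (k + 1)).mul (hρ.pow k)).mul (hw.pow k)).mul hw').mul h2)).sub
    ((((hc (2 * p)).mul (hρ.pow k)).mul (hw.pow (k + 1))).mul h5) |>.sub
    ((((((hc (2 * p)).mul (hρ.pow k)).mul (hw.pow (k + 1))).mul hw').mul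
      (((hρ.pow 2).mul hw).sub (((hc a).mul hρ).mul hx))).mul h4)

theorem dominatedBy_fluxRadial (he : ‖e‖ = 1) (hε : 0 < ε) (hp : 0 < p)
    (hwm : Measurable w) (hW : ∀ τ, |w τ| ≤ W) (hwm' : Measurable w') (hW' : ∀ τ, |w' τ| ≤ W') :
    DominatedBy (fun τ => (1 + |τ|) * (τ ^ 2 + ε ^ 2) ^ (-p)) (fluxRadial e w w' a ε p k) := by
  obtain ⟨h1, h2, h3, h4, h5⟩ := dominatedBy_coneDistance_rpow (a := a) he hε hp hwm
  have hw := DominatedBy.of_bounded (V := V) hwm hW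
  have hw' := DominatedBy.of_bounded (V := V) hwm' hW'
  have hρ := DominatedBy.radius (V := V)
  have hx := DominatedBy.angle he
  have hc := DominatedBy.const (V := V)
  have := ((((hρ.pow k).mul (hw.pow k)).mul ((hρ.mul hw).sub ((hc a).mul hx))).mul h1).sub
    ((((hρ.pow k).mul (hw.pow k)).mul (hρ.mul hw')).mul h2)
  convert this using 1
  funext q
  simp only [fluxRadial]; ring

theorem dominatedBy_coneKernel (he : ‖e‖ = 1) (hε : 0 < ε) (hp : 0 < p)
    (hwm : Measurable w) (hW : ∀ τ, |w τ| ≤ W) :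
    DominatedBy (fun τ => (1 + |τ|) * (τ ^ 2 + ε ^ 2) ^ (-p)) (coneKernel e w a ε p α k) := by
  obtain ⟨h1, h2, h3, h4, h5⟩ := dominatedBy_coneDistance_rpow (a := a) he hε hp hwm
  have hw := DominatedBy.of_bounded (V := V) hwm hW
  have hρ := DominatedBy.radius (V := V)
  have hc := DominatedBy.const (V := V)
  exact ((hρ.pow k).mul (hw.pow (k + 1))).mul (h1.sub ((hc (2 * p / α * ε ^ 2)).mul h3))

theorem dominatedBy_fluxSpherical (he : ‖e‖ = 1) (hε : 0 < ε) (hp : 0 < p)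
    (hwm : Measurable w) (hW : ∀ τ, |w τ| ≤ W) :
    DominatedBy (fun τ => (1 + |τ|) * (τ ^ 2 + ε ^ 2) ^ (-p)) (fluxSpherical e w a ε p k) := by
  obtain ⟨h1, h2, h3, h4, h5⟩ := dominatedBy_coneDistance_rpow (a := a) he hε hp hwm
  have hw := DominatedBy.of_bounded (V := V) hwm hW
  have hρ := DominatedBy.radius (V := V)
  have hx := DominatedBy.angle he
  have hc := DominatedBy.const (V := V)
  exact ((((((hc (2 * p)).mul (hρ.pow k)).mul (hw.pow (k + 1))).mul (hc (a ^ 2))).mul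
    ((hc 1).sub (hx.pow 2))).mul h3).sub
    ((((((hc k).mul (hρ.pow (k - 1))).mul (hw.pow k)).mul (hc a)).mul hx).mul h1)

/-- At fixed τ and ρ, the distance depends on σ only through x = ⟨σ,e⟩. The integrand is a multiple
of the spherical divergence identity for f(x) = Q(x)^{-p}, where f' = 2p a ρ w Q^{-p-1}; the
prefactor contains ρ⁻¹, hence ρ ≠ 0. -/
theorem integral_fluxSpherical [Nontrivial V] (he : ‖e‖ = 1) (hε : 0 < ε)
    (hk : Module.finrank ℝ V = k + 1) (τ : ℝ) {ρ : ℝ} (hρ : ρ ≠ 0) :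
    ∫ σ : Metric.sphere (0 : V) 1, fluxSpherical e w a ε p k (τ, σ, ρ) ∂(surfaceMeasure V) = 0 := by
  set f : ℝ → ℝ := fun x =>
    (τ ^ 2 + ε ^ 2 + (ρ ^ 2 * w τ ^ 2 - 2 * a * (ρ * w τ) * x + a ^ 2)) ^ (-p) with hf
  have hposx : ∀ x ∈ Icc (-1 : ℝ) 1,
      0 < τ ^ 2 + ε ^ 2 + (ρ ^ 2 * w τ ^ 2 - 2 * a * (ρ * w τ) * x + a ^ 2) := fun x hx => by
    have hx2 : x ^ 2 ≤ 1 := by rw [← sq_abs]; exact pow_le_one₀ (abs_nonneg _) (abs_le.2 hx)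
    have h2 : 0 ≤ a ^ 2 * (1 - x ^ 2) := mul_nonneg (sq_nonneg _) (by linarith)
    nlinarith [sq_nonneg (ρ * w τ - a * x), sq_nonneg τ, pow_pos hε 2]
  have hd : ∀ x ∈ Icc (-1 : ℝ) 1, HasDerivAt f (2 * p * a * (ρ * w τ) *
      (τ ^ 2 + ε ^ 2 + (ρ ^ 2 * w τ ^ 2 - 2 * a * (ρ * w τ) * x + a ^ 2)) ^ (-p - 1)) x := by
    intro x hx
    have h1 : HasDerivAt (fun x : ℝ =>
        τ ^ 2 + ε ^ 2 + (ρ ^ 2 * w τ ^ 2 - 2 * a * (ρ * w τ) * x + a ^ 2))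
        (-(2 * a * (ρ * w τ))) x := by
      refine (((((hasDerivAt_id x).const_mul (2 * a * (ρ * w τ))).const_sub
        (ρ ^ 2 * w τ ^ 2)).add_const (a ^ 2)).const_add (τ ^ 2 + ε ^ 2)).congr_deriv ?_
      ring
    refine (h1.rpow_const (p := -p) (Or.inl (hposx x hx).ne')).congr_deriv ?_
    ring
  have hcd : ∀ x ∈ Icc (-1 : ℝ) 1, ContDiffAt ℝ 1 f x := fun x hx =>
    ContDiffAt.rpow_const_of_ne (by fun_prop) (hposx x hx).ne'
  have h := integral_sphere_divergence_eq_zero he hcd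
  have hkr : (Module.finrank ℝ V : ℝ) - 1 = k := by rw [hk]; push_cast; ring
  rw [hkr] at h
  have hpt : ∀ σ : Metric.sphere (0 : V) 1, fluxSpherical e w a ε p k (τ, σ, ρ) =
      ρ⁻¹ * (ρ ^ k * w τ ^ k * a) * ((1 - inner ℝ (σ : V) e ^ 2) * deriv f (inner ℝ (σ : V) e) -
        k * (inner ℝ (σ : V) e * f (inner ℝ (σ : V) e))) := by
    intro σ
    rw [(hd _ (abs_le.1 (abs_inner_sphere_le he σ))).deriv]
    have hk' : (k : ℝ) * ρ ^ (k - 1) = ρ⁻¹ * (k * ρ ^ k) := by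
      rcases Nat.eq_zero_or_pos k with h | h
      · simp [h]
      · obtain ⟨j, rfl⟩ := Nat.exists_eq_add_of_le' h
        rw [Nat.add_sub_cancel, pow_succ]
        field_simp
    simp only [fluxSpherical, hf, coneDistance]
    rw [hk']
    field_simp
    ring
  simp only [hpt, integral_const_mul, h, mul_zero]

/-- The regularized divergence theorem over a cylindrical graph. -/
theorem integral_fluxRadial_eq [Nontrivial V] (he : ‖e‖ = 1) (hε : 0 < ε) (hp : 1 < p)
    (hα : α ≠ 0) (hpk : 2 * p = k + 2 + α) (hk : Module.finrank ℝ V = k + 1)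
    (hw : ∀ τ, HasDerivAt w (w' τ) τ) (hwm' : Measurable w')
    (hW : ∀ τ, |w τ| ≤ W) (hW' : ∀ τ, |w' τ| ≤ W') :
    ∫ q : ℝ × Metric.sphere (0 : V) 1, fluxRadial e w w' a ε p k (q.1, q.2, 1)
      ∂((volume : Measure ℝ).prod (surfaceMeasure V)) =
    -α * ∫ q, coneKernel e w a ε p α k q ∂((volume : Measure ℝ).prod
      ((surfaceMeasure V).prod (volume.restrict (Ioc (0 : ℝ) 1)))) := by
  have hp0 : 0 < p := by linarith
  have hwm : Measurable w :=
    (continuous_iff_continuousAt.2 fun τ => (hw τ).continuousAt).measurable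
  have hh := integrable_one_add_abs_mul_rpow hε hp
  have dT := dominatedBy_fluxTangential (a := a) (k := k) he hε hp0 hwm hW
  have dTd := dominatedBy_fluxTangentialDeriv (a := a) (k := k) he hε hp0 hwm hW hwm' hW'
  have dR := dominatedBy_fluxRadial (a := a) (k := k) he hε hp0 hwm hW hwm' hW'
  have dK := dominatedBy_coneKernel (a := a) (k := k) (α := α) he hε hp0 hwm hW
  have dS := dominatedBy_fluxSpherical (a := a) (k := k) he hε hp0 hwm hW
  have dRd := (((DominatedBy.const (-α)).mul dK).add dS).sub dTd
  -- Integrating in τ first: the derivative along the line of an integrable function with integrable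
  -- derivative has integral zero.
  have iT : ∫ q, fluxTangentialDeriv e w w' a ε p k q ∂((volume : Measure ℝ).prod
      ((surfaceMeasure V).prod (volume.restrict (Ioc (0 : ℝ) 1)))) = 0 := by
    rw [integral_prod_symm _ (dTd.integrable hh)]
    refine integral_eq_zero_of_ae ?_
    have h1 : ∀ᵐ ρ ∂(volume.restrict (Ioc (0 : ℝ) 1)), ρ ∈ Icc (0 : ℝ) 1 := by
      filter_upwards [ae_restrict_mem measurableSet_Ioc] with ρ hρ using Ioc_subset_Icc_self hρ
    filter_upwards [Measure.quasiMeasurePreserving_snd.ae h1] with y hy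
    exact integral_eq_zero_of_hasDerivAt_of_integrable
      (fun τ => hasDerivAt_fluxTangential he hε hw y τ) (dTd.integrable_line hh hy)
      (dT.integrable_line hh hy)
  have iS : ∫ q, fluxSpherical e w a ε p k q ∂((volume : Measure ℝ).prod
      ((surfaceMeasure V).prod (volume.restrict (Ioc (0 : ℝ) 1)))) = 0 := by
    rw [integral_prod _ (dS.integrable hh)]
    refine integral_eq_zero_of_ae (Eventually.of_forall fun τ => ?_)
    simp only [Pi.zero_apply]
    rw [integral_prod_symm _ (dS.integrable_section τ)]
    refine integral_eq_zero_of_ae ?_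
    filter_upwards [ae_restrict_mem measurableSet_Ioc] with ρ hρ
    exact integral_fluxSpherical he hε hk τ hρ.1.ne'
  have iRd : ∫ q, (-α * coneKernel e w a ε p α k q + fluxSpherical e w a ε p k q -
      fluxTangentialDeriv e w w' a ε p k q) ∂((volume : Measure ℝ).prod
      ((surfaceMeasure V).prod (volume.restrict (Ioc (0 : ℝ) 1)))) =
      ∫ q : ℝ × Metric.sphere (0 : V) 1, fluxRadial e w w' a ε p k (q.1, q.2, 1)
      ∂((volume : Measure ℝ).prod (surfaceMeasure V)) := by
    have h1 : (1 : ℝ) ∈ Icc (0 : ℝ) 1 := ⟨zero_le_one, le_rfl⟩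
    have h0 : (0 : ℝ) ∈ Icc (0 : ℝ) 1 := ⟨le_rfl, zero_le_one⟩
    rw [integral_prod _ (dRd.integrable hh), integral_prod _ (dR.integrable_slice hh h1)]
    refine integral_congr_ae (Eventually.of_forall fun τ => ?_)
    simp only
    have hsec := dRd.integrable_section τ
    rw [integral_prod _ hsec]
    have hin : ∀ᵐ σ ∂(surfaceMeasure V), ∫ ρ in Ioc (0 : ℝ) 1,
        (-α * coneKernel e w a ε p α k (τ, σ, ρ) + fluxSpherical e w a ε p k (τ, σ, ρ) -
          fluxTangentialDeriv e w w' a ε p k (τ, σ, ρ)) =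
        fluxRadial e w w' a ε p k (τ, σ, 1) - fluxRadial e w w' a ε p k (τ, σ, 0) := by
      filter_upwards [hsec.prod_right_ae] with σ hσ
      rw [← intervalIntegral.integral_of_le zero_le_one]
      refine intervalIntegral.integral_eq_sub_of_hasDerivAt
        (fun ρ _ => hasDerivAt_fluxRadial he hε hα hpk τ σ ρ) ?_
      rwa [intervalIntegrable_iff_integrableOn_Ioc_of_le zero_le_one]
    rw [integral_congr_ae hin, integral_sub (dR.integrable_sphere τ h1)
      (dR.integrable_sphere τ h0)]
    -- The contribution of the axis ρ = 0 carries the factor 0^k. It need not vanish pointwise when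
    -- k = 0, but it is linear in ⟨σ,e⟩ and cancels under σ ↦ -σ for every k.
    have hz : ∫ σ : Metric.sphere (0 : V) 1, fluxRadial e w w' a ε p k (τ, σ, 0)
        ∂(surfaceMeasure V) = 0 := by
      have : ∀ σ : Metric.sphere (0 : V) 1, fluxRadial e w w' a ε p k (τ, σ, 0) =
          -(0 ^ k * w τ ^ k * a * (τ ^ 2 + ε ^ 2 + a ^ 2) ^ (-p)) * inner ℝ (σ : V) e := by
        intro σ
        simp only [fluxRadial, coneDistance]
        ring_nf
      simp only [this, integral_const_mul, integral_sphere_inner_eq_zero, mul_zero]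
    rw [hz, sub_zero]
  rw [← iRd, integral_sub ((((DominatedBy.const (-α)).mul dK).add dS).integrable hh)
    (dTd.integrable hh), integral_add (((DominatedBy.const (-α)).mul dK).integrable hh)
    (dS.integrable hh), iT, iS, integral_const_mul]
  ring

end Flux

end Dominated

/-! ### Principal values of kernels against almost odd densities -/

section PrincipalValue

variable {F : Type*} [NormedAddCommGroup F] [InnerProductSpace ℝ F] [FiniteDimensional ℝ F]
  [MeasurableSpace F] [BorelSpace F]

/-- The part of the unit ball in a slab of width `δ` has volume `O(δ)`. -/
theorem exists_volume_slab_le {ℓ : F →L[ℝ] ℝ} (hℓ : ℓ ≠ 0) :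
    ∃ C : ℝ, 0 ≤ C ∧ ∀ δ : ℝ, 0 < δ →
      volume {z : F | ‖z‖ < 1 ∧ |ℓ z| ≤ δ} ≤ ENNReal.ofReal (C * δ) := by
  obtain ⟨z₁, hz₁⟩ : ∃ z, ℓ z ≠ 0 := by
    by_contra! h
    exact hℓ (ContinuousLinearMap.ext h)
  obtain ⟨z₀, hz₀⟩ : ∃ z, ℓ z = 1 := ⟨(ℓ z₁)⁻¹ • z₁, by simp [hz₁]⟩
  set B : Set F := Metric.ball 0 (1 + 3 * ‖z₀‖) with hB
  have hBfin : volume B ≠ ⊤ := measure_ball_lt_top.ne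
  refine ⟨(volume B).toReal, ENNReal.toReal_nonneg, fun δ hδ => ?_⟩
  set A : Set F := {z : F | ‖z‖ < 1 ∧ |ℓ z| ≤ δ} with hA
  have hAm : MeasurableSet A :=
    (measurableSet_lt measurable_norm measurable_const).inter
      (measurableSet_le (by fun_prop : Measurable fun z : F => |ℓ z|) measurable_const)
  -- About 1/δ disjoint translates of the slab fit into the fixed ball B, so the slab has volume at
  -- most δ times that of B.
  set K := ⌊1 / δ⌋₊ with hK
  have hKδ : (K : ℝ) * δ ≤ 1 := by
    rw [← le_div_iff₀ hδ]; exact Nat.floor_le (by positivity)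
  have hKδ' : 1 ≤ ((K + 1 : ℕ) : ℝ) * δ := by
    rw [← div_le_iff₀ hδ]; push_cast; exact (Nat.lt_floor_add_one _).le
  -- Since ℓ(z₀) = 1, the k-th translate lies where ℓ is within δ of 3δk; the spacing 3δ exceeds the
  -- width 2δ and makes the translates disjoint. Displacements stay below 3‖z₀‖ because kδ ≤ 1,
  -- hence the radius of B.
  set S : ℕ → Set F := fun k => (fun z => z + (-(3 * δ * k)) • z₀) ⁻¹' A with hS
  have hSm : ∀ k, MeasurableSet (S k) := fun k => hAm.preimage (by fun_prop)
  have hSv : ∀ k, volume (S k) = volume A := fun k => measure_preimage_add_right _ _ _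
  have hSl : ∀ k, ∀ z ∈ S k, |ℓ z - 3 * δ * k| ≤ δ := fun k z hz => by
    have := hz.2
    simpa [hz₀, ← sub_eq_add_neg] using this
  have hdisj : (↑(Finset.range (K + 1)) : Set ℕ).PairwiseDisjoint S := by
    intro i _ j _ hij
    refine Set.disjoint_left.2 fun z hi hj => hij ?_
    have h1 := abs_le.1 (hSl i z hi)
    have h2 := abs_le.1 (hSl j z hj)
    by_contra hne
    rcases Nat.lt_or_gt_of_ne hne with h | h
    · have : (i : ℝ) + 1 ≤ j := by exact_mod_cast h
      nlinarith
    · have : (j : ℝ) + 1 ≤ i := by exact_mod_cast h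
      nlinarith
  have hsub : (⋃ k ∈ Finset.range (K + 1), S k) ⊆ B := by
    intro z hz
    simp only [mem_iUnion, Finset.mem_range] at hz
    obtain ⟨k, hk, hz⟩ := hz
    have h1 : ‖z + (-(3 * δ * k)) • z₀‖ < 1 := hz.1
    have h2 : (k : ℝ) * δ ≤ 1 := by
      have : (k : ℝ) ≤ K := by exact_mod_cast Nat.lt_succ_iff.1 hk
      nlinarith
    rw [hB, mem_ball_zero_iff]
    have h3 : ‖z‖ ≤ ‖z + (-(3 * δ * k)) • z₀‖ + ‖(3 * δ * (k : ℝ)) • z₀‖ := by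
      refine le_trans (le_of_eq ?_) (norm_add_le _ _)
      congr 1
      module
    rw [norm_smul, Real.norm_of_nonneg (by positivity)] at h3
    nlinarith [norm_nonneg z₀]
  have hmeas := measure_mono (μ := volume) hsub
  rw [measure_biUnion_finset hdisj fun k _ => hSm k] at hmeas
  simp only [hSv, Finset.sum_const, Finset.card_range, nsmul_eq_mul] at hmeas
  have hAfin : volume A ≠ ⊤ := by
    refine ((measure_mono (fun z hz => ?_)).trans_lt
      (measure_ball_lt_top (μ := (volume : Measure F)) (x := 0) (r := 1))).ne
    simpa using hz.1
  rw [← ENNReal.ofReal_toReal hAfin]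
  refine ENNReal.ofReal_le_ofReal ?_
  have h4 := ENNReal.toReal_mono hBfin hmeas
  rw [ENNReal.toReal_mul, ENNReal.toReal_natCast] at h4
  have h5 : 0 ≤ (volume A).toReal := ENNReal.toReal_nonneg
  calc (volume A).toReal ≤ (((K + 1 : ℕ) : ℝ) * δ) * (volume A).toReal :=
        le_mul_of_one_le_left h5 hKδ'
    _ = (((K + 1 : ℕ) : ℝ) * (volume A).toReal) * δ := by ring
    _ ≤ _ := mul_le_mul_of_nonneg_right h4 hδ.le

open scoped Pointwise in
/-- An equatorial band of width `δ` has surface measure `O(δ)`. -/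
theorem exists_surfaceMeasure_band_le {ℓ : F →L[ℝ] ℝ} (hℓ : ℓ ≠ 0) :
    ∃ C : ℝ, 0 ≤ C ∧ ∀ δ : ℝ, 0 < δ →
      surfaceMeasure F {σ | |ℓ (σ : F)| ≤ δ} ≤ ENNReal.ofReal (C * δ) := by
  obtain ⟨C, hC, h⟩ := exists_volume_slab_le hℓ
  refine ⟨Module.finrank ℝ F * C, by positivity, fun δ hδ => ?_⟩
  have hm : MeasurableSet {σ : Metric.sphere (0 : F) 1 | |ℓ (σ : F)| ≤ δ} :=
    measurableSet_le (by fun_prop) (by fun_prop)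
  rw [surfaceMeasure, Measure.toSphere_apply' _ hm, mul_assoc, ENNReal.ofReal_mul (by positivity),
    ENNReal.ofReal_natCast]
  gcongr
  refine (measure_mono ?_).trans (h δ hδ)
  intro z hz
  rw [Set.mem_smul] at hz
  obtain ⟨r, hr, _, ⟨σ, hσ, rfl⟩, rfl⟩ := hz
  have hσ' : |ℓ (σ : F)| ≤ δ := hσ
  refine ⟨?_, ?_⟩
  · rw [norm_smul, norm_eq_of_mem_sphere, mul_one, Real.norm_of_nonneg hr.1.le]; exact hr.2
  · rw [map_smul, smul_eq_mul, abs_mul, abs_of_pos hr.1]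
    exact (mul_le_of_le_one_left (abs_nonneg _) hr.2.le).trans hσ'

theorem integrableOn_norm_rpow_neg {ε p : ℝ} (hε : 0 < ε) (hp : (Module.finrank ℝ F : ℝ) < p) :
    IntegrableOn (fun z : F => ‖z‖ ^ (-p)) {z | ε ≤ ‖z‖} := by
  have hp0 : 0 < p := lt_of_le_of_lt (Nat.cast_nonneg _) hp
  have hm : MeasurableSet {z : F | ε ≤ ‖z‖} := measurableSet_le (by fun_prop) (by fun_prop)
  have h1 := ((integrable_one_add_norm (μ := (volume : Measure F)) hp).const_mul
    ((ε / (1 + ε)) ^ (-p))).integrableOn (s := {z : F | ε ≤ ‖z‖})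
  refine Integrable.mono' h1
    (by fun_prop : Measurable fun z : F => ‖z‖ ^ (-p)).aestronglyMeasurable ?_
  filter_upwards [ae_restrict_mem hm] with z hz
  have hz' : ε ≤ ‖z‖ := hz
  rw [Real.norm_of_nonneg (by positivity), ← Real.mul_rpow (by positivity) (by positivity)]
  refine Real.rpow_le_rpow_of_nonpos (by positivity) ?_ (by linarith)
  rw [div_mul_eq_mul_div, div_le_iff₀ (by positivity)]
  nlinarith

/-- At radius r the region cuts the sphere in an equatorial band of width C r^β. With d the
dimension of F, the radial density is r^{d-1} r^{-d-α} r^β = r^{β-α-1}, integrable at 0. -/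
theorem integrable_indicator_band [Nontrivial F] {ℓ : F →L[ℝ] ℝ} (hℓ : ℓ ≠ 0) {α β C r₀ : ℝ}
    (hαβ : α < β) (hC : 0 < C) :
    Integrable ({z : F | ‖z‖ ≤ r₀ ∧ |ℓ z| ≤ C * (‖z‖ * ‖z‖ ^ β)}.indicator fun z =>
      ‖z‖ ^ (-(Module.finrank ℝ F + α))) := by
  obtain ⟨M, hM, hband⟩ := exists_surfaceMeasure_band_le hℓ
  set T : Set F := {z : F | ‖z‖ ≤ r₀ ∧ |ℓ z| ≤ C * (‖z‖ * ‖z‖ ^ β)} with hT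
  have hTm : MeasurableSet T := (measurableSet_le measurable_norm measurable_const).inter
    (measurableSet_le (by fun_prop : Measurable fun z : F => |ℓ z|)
      (by fun_prop : Measurable fun z : F => C * (‖z‖ * ‖z‖ ^ β)))
  have hmeas : Measurable (T.indicator fun z : F => ‖z‖ ^ (-(Module.finrank ℝ F + α))) :=
    (by fun_prop : Measurable fun z : F => ‖z‖ ^ (-(Module.finrank ℝ F + α))).indicator hTm
  have hn : 0 < Module.finrank ℝ F := Module.finrank_pos
  refine ⟨hmeas.aestronglyMeasurable, ?_⟩
  rw [hasFiniteIntegral_iff_ofReal (Eventually.of_forall fun z =>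
    indicator_nonneg (fun z _ => by positivity) z), lintegral_polar (by fun_prop)]
  -- The sphere is integrated first, at fixed radius, so that the band estimate applies.
  rw [lintegral_lintegral_swap (by
    have : Measurable fun q : Metric.sphere (0 : F) 1 × ℝ => q.2 • (q.1 : F) := by fun_prop
    have h2 := hmeas.comp this
    simp only [Function.comp_def] at h2
    exact Measurable.aemeasurable (by fun_prop))]
  have hint : IntegrableOn (fun r : ℝ => M * C * r ^ (β - α - 1)) (Ioc 0 r₀) := by
    rcases le_or_gt r₀ 0 with h0 | h0
    · rw [Ioc_eq_empty (not_lt.2 h0)]; exact integrableOn_empty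
    · rw [← intervalIntegrable_iff_integrableOn_Ioc_of_le h0.le]
      exact (intervalIntegral.intervalIntegrable_rpow' (by linarith)).const_mul _
  calc ∫⁻ r in Ioi (0 : ℝ), (∫⁻ σ : Metric.sphere (0 : F) 1,
        ENNReal.ofReal (r ^ (Module.finrank ℝ F - 1)) * ENNReal.ofReal
          (T.indicator (fun z : F => ‖z‖ ^ (-(Module.finrank ℝ F + α))) (r • (σ : F)))
          ∂(surfaceMeasure F))
      ≤ ∫⁻ r in Ioi (0 : ℝ), (Ioc 0 r₀).indicator
          (fun r => ENNReal.ofReal (M * C * r ^ (β - α - 1))) r := by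
        refine setLIntegral_mono' measurableSet_Ioi fun r hr => ?_
        have hr : 0 < r := hr
        have hnorm : ∀ σ : Metric.sphere (0 : F) 1, ‖r • (σ : F)‖ = r := fun σ => by
          rw [norm_smul, norm_eq_of_mem_sphere, mul_one, Real.norm_of_nonneg hr.le]
        by_cases hr0 : r ≤ r₀
        · rw [indicator_of_mem (show r ∈ Ioc 0 r₀ from ⟨hr, hr0⟩)]
          have hbm : MeasurableSet {σ : Metric.sphere (0 : F) 1 | |ℓ (σ : F)| ≤ C * r ^ β} :=
            measurableSet_le (by fun_prop) (by fun_prop)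
          have hle : ∀ σ : Metric.sphere (0 : F) 1,
              ENNReal.ofReal (r ^ (Module.finrank ℝ F - 1)) * ENNReal.ofReal
                (T.indicator (fun z : F => ‖z‖ ^ (-(Module.finrank ℝ F + α))) (r • (σ : F))) ≤
              {σ : Metric.sphere (0 : F) 1 | |ℓ (σ : F)| ≤ C * r ^ β}.indicator
                (fun _ => ENNReal.ofReal (r ^ (-1 - α))) σ := by
            intro σ
            by_cases hσ : r • (σ : F) ∈ T
            · have h1 : |ℓ (σ : F)| ≤ C * r ^ β := by
                have h2 := hσ.2
                rw [hnorm, map_smul, smul_eq_mul, abs_mul, abs_of_pos hr] at h2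
                refine le_of_mul_le_mul_left ?_ hr
                linarith
              rw [indicator_of_mem hσ, indicator_of_mem (show σ ∈ {σ : Metric.sphere (0 : F) 1 |
                |ℓ (σ : F)| ≤ C * r ^ β} from h1), hnorm, ← ENNReal.ofReal_mul (by positivity)]
              refine ENNReal.ofReal_le_ofReal (le_of_eq ?_)
              rw [← Real.rpow_natCast, ← Real.rpow_add hr, Nat.cast_sub hn]
              congr 1; push_cast; ring
            · rw [indicator_of_notMem hσ, ENNReal.ofReal_zero, mul_zero]; exact zero_le
          refine (lintegral_mono hle).trans ?_
          rw [lintegral_indicator_const hbm]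
          refine (mul_le_mul_right (hband _ (by positivity)) _).trans ?_
          rw [← ENNReal.ofReal_mul (by positivity)]
          refine ENNReal.ofReal_le_ofReal (le_of_eq ?_)
          have : r ^ (β - α - 1) = r ^ (-1 - α) * r ^ β := by
            rw [← Real.rpow_add hr]; congr 1; ring
          rw [this]; ring
        · rw [indicator_of_notMem fun h => hr0 h.2]
          refine le_of_eq ?_
          rw [lintegral_eq_zero_iff' (by
            have : Measurable fun σ : Metric.sphere (0 : F) 1 => r • (σ : F) := by fun_prop
            have h2 := hmeas.comp this
            simp only [Function.comp_def] at h2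
            exact Measurable.aemeasurable (by fun_prop))]
          refine Eventually.of_forall fun σ => ?_
          have : r • (σ : F) ∉ T := fun h => hr0 (by have := h.1; rwa [hnorm] at this)
          simp [indicator_of_notMem this]
    _ ≤ ∫⁻ r, (Ioc 0 r₀).indicator (fun r => ENNReal.ofReal (M * C * r ^ (β - α - 1))) r :=
        setLIntegral_le_lintegral _ _
    _ = ∫⁻ r in Ioc 0 r₀, ENNReal.ofReal (M * C * r ^ (β - α - 1)) :=
        lintegral_indicator measurableSet_Ioc _
    _ < ⊤ := by
        have h := hint.2
        rwa [hasFiniteIntegral_iff_ofReal] at h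
        filter_upwards [ae_restrict_mem measurableSet_Ioc] with r hr
        have := hr.1
        positivity

/-- A function that is bounded by `‖z‖^{-(d+α)}` and supported near the origin in the region
`|ℓ z| ≤ C ‖z‖^{1+β}` is integrable. -/
theorem integrable_of_band [Nontrivial F] {ℓ : F →L[ℝ] ℝ} (hℓ : ℓ ≠ 0) {α β C r₀ M : ℝ}
    (hα : 0 < α) (hαβ : α < β) (hC : 0 < C) (hr₀ : 0 < r₀) {g : F → ℝ} (hg : Measurable g)
    (hle : ∀ z, |g z| ≤ M * ‖z‖ ^ (-(Module.finrank ℝ F + α)))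
    (hband : ∀ z, ‖z‖ ≤ r₀ → g z ≠ 0 → |ℓ z| ≤ C * (‖z‖ * ‖z‖ ^ β)) : Integrable g := by
  have h1 := (integrable_indicator_band hℓ (r₀ := r₀) hαβ hC).const_mul M
  have hm : MeasurableSet {z : F | r₀ ≤ ‖z‖} := measurableSet_le (by fun_prop) (by fun_prop)
  have h2 := (((integrable_indicator_iff hm).2 (integrableOn_norm_rpow_neg (F := F) hr₀
    (show (Module.finrank ℝ F : ℝ) < Module.finrank ℝ F + α by linarith))).const_mul M)
  refine (h1.add h2).mono' hg.aestronglyMeasurable (Eventually.of_forall fun z => ?_)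
  rw [Real.norm_eq_abs]
  have h0 : 0 ≤ M * ‖z‖ ^ (-(Module.finrank ℝ F + α)) := (abs_nonneg _).trans (hle z)
  simp only [Pi.add_apply]
  by_cases hz : r₀ ≤ ‖z‖
  · rw [indicator_of_mem (show z ∈ {z : F | r₀ ≤ ‖z‖} from hz)]
    refine (hle z).trans (le_add_of_nonneg_left ?_)
    rw [indicator_apply]; split_ifs
    · exact h0
    · simp
  · rw [indicator_of_notMem (show z ∉ {z : F | r₀ ≤ ‖z‖} from hz), mul_zero, add_zero]
    by_cases hg0 : g z = 0
    · rw [hg0, abs_zero, indicator_apply]; split_ifs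
      · exact h0
      · simp
    · rw [indicator_of_mem (show z ∈ {z : F | ‖z‖ ≤ r₀ ∧ |ℓ z| ≤ C * (‖z‖ * ‖z‖ ^ β)} from
        ⟨(not_le.1 hz).le, hband z (not_le.1 hz).le hg0⟩)]
      exact hle z

/-- Even kernels dominated by `k` see only the even part of a density. -/
theorem tendsto_integral_mul_even {ι : Type*} {l : Filter ι} [l.IsCountablyGenerated]
    {χ : F → ℝ} {k : F → ℝ} {K : ι → F → ℝ} {C : ℝ}
    (hint : ∀ᶠ i in l, Integrable fun z => χ z * K i z)
    (heven : ∀ i z, K i (-z) = K i z)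
    (hle : ∀ᶠ i in l, ∀ z, z ≠ 0 → |K i z| ≤ C * k z)
    (hk : Integrable fun z => (χ z + χ (-z)) * k z)
    (hlim : ∀ z, z ≠ 0 → Tendsto (fun i => K i z) l (𝓝 (k z))) [Nontrivial F] :
    Tendsto (fun i => ∫ z, χ z * K i z) l (𝓝 (1 / 2 * ∫ z, (χ z + χ (-z)) * k z)) := by
  have hae : ∀ᵐ z : F, z ≠ 0 := by simp [ae_iff]
  -- Averaging with the substitution z ↦ -z replaces χ by its even part. Only then is there a
  -- dominating function independent of i.
  have h1 : ∀ᶠ i in l, 1 / 2 * ∫ z, (χ z + χ (-z)) * K i z = ∫ z, χ z * K i z := by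
    filter_upwards [hint] with i hi
    have h2 := hi.comp_neg
    simp only [heven] at h2
    have h3 := integral_neg_eq_self (fun z => χ z * K i z) (volume : Measure F)
    simp only [heven] at h3
    simp only [add_mul]
    rw [integral_add hi h2, h3]; ring
  have h4 : Tendsto (fun i => ∫ z, (χ z + χ (-z)) * K i z) l
      (𝓝 (∫ z, (χ z + χ (-z)) * k z)) := by
    refine tendsto_integral_filter_of_dominated_convergence
      (fun z => |C| * |(χ z + χ (-z)) * k z|) ?_ ?_ (hk.abs.const_mul |C|) ?_
    · filter_upwards [hint] with i hi
      have h2 := hi.comp_neg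
      simp only [heven] at h2
      simp only [add_mul]
      exact (hi.add h2).aestronglyMeasurable
    · filter_upwards [hle] with i hi
      filter_upwards [hae] with z hz
      have h5 : |K i z| ≤ |C| * |k z| := abs_mul C _ ▸ (hi z hz).trans (le_abs_self _)
      rw [Real.norm_eq_abs, abs_mul, abs_mul]
      calc |χ z + χ (-z)| * |K i z| ≤ |χ z + χ (-z)| * (|C| * |k z|) :=
            mul_le_mul_of_nonneg_left h5 (abs_nonneg _)
        _ = _ := by ring
    · filter_upwards [hae] with z hz
      exact (hlim z hz).const_mul _
  exact (h4.const_mul (1 / 2)).congr' h1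

/-- The kernel `(‖z‖² + ε²)^{-p} - (2p/α) ε² (‖z‖² + ε²)^{-p-1}`, whose integral vanishes. -/
def regularKernel (F : Type*) [NormedAddCommGroup F] (p α ε : ℝ) (z : F) : ℝ :=
  (‖z‖ ^ 2 + ε ^ 2) ^ (-p) - 2 * p / α * ε ^ 2 * (‖z‖ ^ 2 + ε ^ 2) ^ (-p - 1)

theorem measurable_regularKernel (p α ε : ℝ) : Measurable (regularKernel F p α ε) := by
  unfold regularKernel; fun_prop

omit [InnerProductSpace ℝ F] [FiniteDimensional ℝ F] [MeasurableSpace F] [BorelSpace F] in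
theorem abs_regularKernel_le {p α ε : ℝ} (hp : 0 < p) (hα : 0 < α) (z : F)
    (h : 0 < ‖z‖ ^ 2 + ε ^ 2) :
    |regularKernel F p α ε z| ≤ (1 + 2 * p / α) * (‖z‖ ^ 2 + ε ^ 2) ^ (-p) := by
  have h1 : (‖z‖ ^ 2 + ε ^ 2) ^ (-p) = (‖z‖ ^ 2 + ε ^ 2) * (‖z‖ ^ 2 + ε ^ 2) ^ (-p - 1) := by
    rw [mul_comm, ← Real.rpow_add_one h.ne']; congr 1; ring
  have h2 : 0 < (‖z‖ ^ 2 + ε ^ 2) ^ (-p - 1) := Real.rpow_pos_of_pos h _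
  have h3 : ε ^ 2 * (‖z‖ ^ 2 + ε ^ 2) ^ (-p - 1) ≤ (‖z‖ ^ 2 + ε ^ 2) ^ (-p) := by
    rw [h1]
    exact mul_le_mul_of_nonneg_right (by nlinarith [sq_nonneg ‖z‖]) h2.le
  have h4 : 0 ≤ ε ^ 2 * (‖z‖ ^ 2 + ε ^ 2) ^ (-p - 1) := by positivity
  have h5 : 0 < (‖z‖ ^ 2 + ε ^ 2) ^ (-p) := Real.rpow_pos_of_pos h _
  have h6 := mul_le_mul_of_nonneg_left h3 (show 0 ≤ 2 * p / α by positivity)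
  have h7 := mul_nonneg (show 0 ≤ 2 * p / α by positivity) h4
  rw [regularKernel, mul_assoc, abs_le]
  constructor <;> linarith

theorem integrable_norm_sq_add_rpow {p ε : ℝ} (hε : 0 < ε)
    (hp : (Module.finrank ℝ F : ℝ) < 2 * p) :
    Integrable fun z : F => (‖z‖ ^ 2 + ε ^ 2) ^ (-p) := by
  have hp0 : 0 ≤ p := by
    have : (0 : ℝ) ≤ Module.finrank ℝ F := Nat.cast_nonneg _
    linarith
  have hint1 : Integrable (fun y : F => (1 + ‖y‖ ^ 2) ^ (-p)) := by
    have := integrable_rpow_neg_one_add_norm_sq (μ := (volume : Measure F)) hp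
    simpa [neg_div] using this
  refine (hint1.const_mul ((ε ^ 2 / (1 + ε ^ 2)) ^ (-p))).mono' (by fun_prop : Measurable fun y : F =>
    (‖y‖ ^ 2 + ε ^ 2) ^ (-p)).aestronglyMeasurable (Eventually.of_forall fun y => ?_)
  rw [Real.norm_of_nonneg (Real.rpow_nonneg (by positivity) _),
    ← Real.mul_rpow (by positivity) (by positivity)]
  refine Real.rpow_le_rpow_of_nonpos (by positivity) ?_ (by linarith)
  rw [div_mul_eq_mul_div, div_le_iff₀ (by positivity)]
  nlinarith [sq_nonneg ‖y‖, sq_nonneg ε, mul_nonneg (sq_nonneg ‖y‖) (sq_nonneg ε),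
    mul_nonneg (sq_nonneg ε) (sq_nonneg ε)]

theorem integrable_regularKernel {p α ε : ℝ} (hε : 0 < ε) (hα : 0 < α)
    (hp : (Module.finrank ℝ F : ℝ) < 2 * p) : Integrable (regularKernel F p α ε) := by
  have hp0 : 0 < p := by
    have : (0 : ℝ) ≤ Module.finrank ℝ F := Nat.cast_nonneg _
    linarith
  exact ((integrable_norm_sq_add_rpow hε hp).const_mul (1 + 2 * p / α)).mono'
    (measurable_regularKernel p α ε).aestronglyMeasurable
    (Eventually.of_forall fun z => abs_regularKernel_le hp0 hα z (by positivity))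

/-- In radial form, with n the dimension, the kernel times r^{n-1} is the derivative of -(1/α) r^n
(r²+ε²)^{-p}. This vanishes at the origin and decays like r^{-α}. -/
theorem integral_regularKernel [Nontrivial F] {p α ε : ℝ} (hε : 0 < ε) (hα : 0 < α)
    (hp : 2 * p = Module.finrank ℝ F + α) : ∫ z, regularKernel F p α ε z = 0 := by
  have hn : 0 < Module.finrank ℝ F := Module.finrank_pos
  set n := Module.finrank ℝ F with hnd
  have hpd : (Module.finrank ℝ F : ℝ) < 2 * p := by rw [hp]; linarith
  have hint := integrable_regularKernel (F := F) hε hα hpd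
  have h0 := integral_fun_norm_addHaar (volume : Measure F) (fun r : ℝ =>
    (r ^ 2 + ε ^ 2) ^ (-p) - 2 * p / α * ε ^ 2 * (r ^ 2 + ε ^ 2) ^ (-p - 1))
  have h1 := (integrable_fun_norm_addHaar (volume : Measure F) (f := fun r : ℝ =>
    (r ^ 2 + ε ^ 2) ^ (-p) - 2 * p / α * ε ^ 2 * (r ^ 2 + ε ^ 2) ^ (-p - 1))).1 hint
  change ∫ z, regularKernel F p α ε z = _ at h0
  rw [h0]
  have hpos : ∀ r : ℝ, 0 < r ^ 2 + ε ^ 2 := fun r => by positivity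
  have hder : ∀ r : ℝ, HasDerivAt (fun r : ℝ => -(1 / α) * (r ^ n * (r ^ 2 + ε ^ 2) ^ (-p)))
      (r ^ (n - 1) • ((r ^ 2 + ε ^ 2) ^ (-p) -
        2 * p / α * ε ^ 2 * (r ^ 2 + ε ^ 2) ^ (-p - 1))) r := by
    intro r
    have h2 : HasDerivAt (fun r : ℝ => r ^ 2 + ε ^ 2) (2 * r) r := by
      simpa using (hasDerivAt_pow 2 r).add_const (ε ^ 2)
    refine (((hasDerivAt_pow n r).fun_mul (h2.rpow_const (p := -p)
      (Or.inl (hpos r).ne'))).const_mul (-(1 / α))).congr_deriv ?_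
    have h3 : (r ^ 2 + ε ^ 2) ^ (-p) = (r ^ 2 + ε ^ 2) * (r ^ 2 + ε ^ 2) ^ (-p - 1) := by
      rw [mul_comm, ← Real.rpow_add_one (hpos r).ne']; congr 1; ring
    have h4 : r ^ n = r ^ (n - 1) * r := by rw [← pow_succ, Nat.sub_add_cancel hn]
    rw [h3, h4, smul_eq_mul]
    have h5 : (n : ℝ) = 2 * p - α := by linarith
    rw [h5]
    field_simp
    ring
  have hlim : Tendsto (fun r : ℝ => -(1 / α) * (r ^ n * (r ^ 2 + ε ^ 2) ^ (-p))) atTop (𝓝 0) := by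
    have h6 : Tendsto (fun r : ℝ => r ^ (-α)) atTop (𝓝 0) := tendsto_rpow_neg_atTop hα
    have h7 : Tendsto (fun r : ℝ => r ^ n * (r ^ 2 + ε ^ 2) ^ (-p)) atTop (𝓝 0) := by
      refine squeeze_zero' ?_ ?_ h6
      · filter_upwards [eventually_gt_atTop 0] with r hr
        positivity
      · filter_upwards [eventually_gt_atTop 0] with r hr
        calc r ^ n * (r ^ 2 + ε ^ 2) ^ (-p) ≤ r ^ n * (r ^ 2) ^ (-p) := by
              refine mul_le_mul_of_nonneg_left (Real.rpow_le_rpow_of_nonpos (by positivity)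
                (by nlinarith [sq_nonneg ε]) ?_) (by positivity)
              have : (0 : ℝ) ≤ n := Nat.cast_nonneg _
              linarith
          _ = r ^ (-α) := by
              rw [sq_rpow_neg, abs_of_pos hr, ← Real.rpow_natCast, ← Real.rpow_add hr]
              congr 1; linarith
    simpa using h7.const_mul (-(1 / α))
  rw [integral_Ioi_of_hasDerivAt_of_tendsto (hder 0).continuousAt.continuousWithinAt
    (fun r _ => hder r) h1 hlim]
  simp [hn.ne']

theorem integral_principalValue_eq {χ : F → ℝ} (q : ℝ) (x : F) (ε : ℝ) :
    ∫ y in {y | ε ≤ ‖y - x‖}, χ y / ‖x - y‖ ^ q =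
      ∫ z, χ (x + z) * {z : F | ε ≤ ‖z‖}.indicator (fun z => ‖z‖ ^ (-q)) z := by
  rw [← integral_indicator (measurableSet_le (by fun_prop) (by fun_prop)),
    ← integral_add_left_eq_self _ x]
  refine integral_congr_ae (Eventually.of_forall fun z => ?_)
  by_cases hz : ε ≤ ‖z‖
  · simp only
    rw [indicator_of_mem (show z ∈ {z : F | ε ≤ ‖z‖} from hz), indicator_of_mem (by simpa using hz)]
    rw [Real.rpow_neg (norm_nonneg _), div_eq_mul_inv]
    simp
  · simp only
    rw [indicator_of_notMem (show z ∉ {z : F | ε ≤ ‖z‖} from hz),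
      indicator_of_notMem (by simpa using hz), mul_zero]

/-- A principal value is the limit of the integrals against `regularKernel`, for a bounded density
whose even part is supported in a thin region around a hyperplane. -/
theorem hasPrincipalValue_of_tendsto_regularKernel [Nontrivial F] {χ : F → ℝ} (hχ : Measurable χ)
    (hχ1 : ∀ y, |χ y| ≤ 1) {ℓ : F →L[ℝ] ℝ} (hℓ : ℓ ≠ 0) {α β C r₀ p L : ℝ} (hα : 0 < α)
    (hαβ : α < β) (hC : 0 < C) (hr₀ : 0 < r₀) (hp : 2 * p = Module.finrank ℝ F + α) {x : F}
    (hband : ∀ z, ‖z‖ ≤ r₀ → χ (x + z) + χ (x - z) ≠ 0 → |ℓ z| ≤ C * (‖z‖ * ‖z‖ ^ β))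
    (hL : Tendsto (fun ε => ∫ z, χ (x + z) * regularKernel F p α ε z) (𝓝[>] 0) (𝓝 L)) :
    HasPrincipalValue (fun y => χ y / ‖x - y‖ ^ (Module.finrank ℝ F + α)) x L := by
  have hp0 : 0 < p := by
    have : (0 : ℝ) ≤ Module.finrank ℝ F := Nat.cast_nonneg _
    linarith
  have hmt : ∀ ε : ℝ, MeasurableSet {z : F | ε ≤ ‖z‖} := fun ε =>
    measurableSet_le (by fun_prop) (by fun_prop)
  have htail : ∀ ε : ℝ, 0 < ε → Integrable fun z => χ (x + z) *
      {z : F | ε ≤ ‖z‖}.indicator (fun z => ‖z‖ ^ (-(Module.finrank ℝ F + α))) z := by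
    intro ε hε
    have h := (integrable_indicator_iff (hmt ε)).2 (integrableOn_norm_rpow_neg (F := F) hε
      (show (Module.finrank ℝ F : ℝ) < Module.finrank ℝ F + α by linarith))
    exact h.bdd_mul (c := 1) (by fun_prop : Measurable fun z => χ (x + z)).aestronglyMeasurable
      (Eventually.of_forall fun z => hχ1 _)
  set k : F → ℝ := fun z => ‖z‖ ^ (-(Module.finrank ℝ F + α)) with hk
  have hsym : Integrable fun z => (χ (x + z) + χ (x + -z)) * k z := by
    refine integrable_of_band hℓ (M := 2) hα hαβ hC hr₀ (by fun_prop) (fun z => ?_)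
      (fun z hz hne => ?_)
    · rw [abs_mul, abs_of_nonneg (show 0 ≤ k z by positivity)]
      refine mul_le_mul_of_nonneg_right ?_ (by positivity)
      refine (abs_add_le _ _).trans ?_
      linarith [hχ1 (x + z), hχ1 (x + -z)]
    · rw [← sub_eq_add_neg] at hne
      exact hband z hz (left_ne_zero_of_mul hne)
  have hpos : ∀ᶠ ε : ℝ in 𝓝[>] 0, 0 < ε := eventually_mem_nhdsWithin
  have hsq : ∀ z : F, (‖z‖ ^ 2) ^ (-p) = k z := fun z => by
    rw [sq_rpow_neg, abs_norm, hp]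
  have hreg : Tendsto (fun ε => ∫ z, χ (x + z) * regularKernel F p α ε z) (𝓝[>] 0)
      (𝓝 (1 / 2 * ∫ z, (χ (x + z) + χ (x + -z)) * k z)) := by
    refine tendsto_integral_mul_even (C := 1 + 2 * p / α) ?_ (fun ε z => by simp [regularKernel])
      ?_ hsym ?_
    · filter_upwards [hpos] with ε hε
      exact (integrable_regularKernel hε hα (by rw [hp]; linarith)).bdd_mul (c := 1)
        (by fun_prop : Measurable fun z => χ (x + z)).aestronglyMeasurable
        (Eventually.of_forall fun z => hχ1 _)
    · filter_upwards [hpos] with ε hε z hz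
      have hz' : 0 < ‖z‖ := norm_pos_iff.2 hz
      refine (abs_regularKernel_le hp0 hα z (by positivity)).trans ?_
      rw [← hsq]
      refine mul_le_mul_of_nonneg_left ?_ (by positivity)
      exact Real.rpow_le_rpow_of_nonpos (by positivity) (by nlinarith [sq_nonneg ε]) (by linarith)
    · intro z hz
      have hz' : 0 < ‖z‖ := norm_pos_iff.2 hz
      have h1 : ContinuousAt (fun ε : ℝ => regularKernel F p α ε z) 0 := by
        unfold regularKernel
        have : ∀ q : ℝ, ContinuousAt (fun ε : ℝ => (‖z‖ ^ 2 + ε ^ 2) ^ q) 0 := fun q =>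
          ContinuousAt.rpow_const (by fun_prop) (Or.inl (by simpa using hz))
        exact (this _).sub ((by fun_prop : ContinuousAt (fun ε : ℝ => 2 * p / α * ε ^ 2) 0).mul
          (this _))
      have h2 : Tendsto (fun ε : ℝ => regularKernel F p α ε z) (𝓝[>] 0)
          (𝓝 (regularKernel F p α 0 z)) := h1.tendsto.mono_left nhdsWithin_le_nhds
      have h3 : regularKernel F p α 0 z = k z := by
        rw [← hsq]; simp [regularKernel]
      rwa [h3] at h2
  -- The regularized limit is half the absolutely convergent integral of the even part. The sharp
  -- truncations are shown below to have the same limit.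
  have hL' := tendsto_nhds_unique hL hreg
  refine ⟨fun ε hε => ?_, ?_⟩
  · rw [← integrable_indicator_iff (measurableSet_le (by fun_prop) (by fun_prop))]
    refine ((htail ε hε).comp_sub_right x).congr (Eventually.of_forall fun y => ?_)
    simp only [add_sub_cancel]
    by_cases hy : ε ≤ ‖y - x‖
    · rw [indicator_of_mem (show y - x ∈ {z : F | ε ≤ ‖z‖} from hy),
        indicator_of_mem (show y ∈ {y : F | ε ≤ ‖y - x‖} from hy)]
      change χ y * ‖y - x‖ ^ (-(Module.finrank ℝ F + α)) = _
      rw [Real.rpow_neg (norm_nonneg _), div_eq_mul_inv, norm_sub_rev]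
    · rw [indicator_of_notMem (show y - x ∉ {z : F | ε ≤ ‖z‖} from hy),
        indicator_of_notMem (show y ∉ {y : F | ε ≤ ‖y - x‖} from hy), mul_zero]
  · rw [hL']
    simp only [integral_principalValue_eq]
    refine tendsto_integral_mul_even (C := 1) ?_ (fun ε z => by simp [indicator_apply]) ?_ hsym ?_
    · filter_upwards [hpos] with ε hε using htail ε hε
    · refine Eventually.of_forall fun ε z _ => ?_
      rw [one_mul, indicator_apply]
      split_ifs
      · rw [abs_of_nonneg (by positivity)]
      · rw [abs_zero]; positivity
    · intro z hz
      refine tendsto_const_nhds.congr' ?_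
      have : ∀ᶠ ε : ℝ in 𝓝[>] 0, ε < ‖z‖ :=
        nhdsWithin_le_nhds (eventually_lt_nhds (norm_pos_iff.2 hz))
      filter_upwards [this] with ε hε
      rw [indicator_of_mem (show z ∈ {z : F | ε ≤ ‖z‖} from hε.le)]

end PrincipalValue

/-! ### The geometry of cylindrical graphs -/

section Graph

variable {V : Type*} [NormedAddCommGroup V] [InnerProductSpace ℝ V] {β : ℝ}

/-- The region `{(s, ζ) : ‖ζ‖ < u(s)}` in `ℝ × V`. -/
def graphRegion (V : Type*) [NormedAddCommGroup V] (u : ℝ → ℝ) : Set (WithLp 2 (ℝ × V)) :=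
  {y | ‖y.snd‖ < u y.fst}

/-- The difference of the indicators of the complement and of the region. -/
def graphSign (V : Type*) [NormedAddCommGroup V] (u : ℝ → ℝ) (y : WithLp 2 (ℝ × V)) : ℝ :=
  (graphRegion V u)ᶜ.indicator (fun _ => (1 : ℝ)) y - (graphRegion V u).indicator (fun _ => (1 : ℝ)) y

/-- The boundary point `(s, u(s) e)`. -/
def graphPoint (u : ℝ → ℝ) (s : ℝ) (e : V) : WithLp 2 (ℝ × V) := WithLp.toLp 2 (s, u s • e)

omit [InnerProductSpace ℝ V] in
theorem graphSign_eq (u : ℝ → ℝ) (y : WithLp 2 (ℝ × V)) :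
    graphSign V u y = 1 - 2 * (graphRegion V u).indicator (fun _ => (1 : ℝ)) y := by
  by_cases h : y ∈ graphRegion V u
  · simp [graphSign, h]; norm_num
  · simp [graphSign, h]

omit [InnerProductSpace ℝ V] in
theorem graphSign_of_lt {u : ℝ → ℝ} {y : WithLp 2 (ℝ × V)} (h : ‖y.snd‖ - u y.fst < 0) :
    graphSign V u y = -1 := by
  have : y ∈ graphRegion V u := by simpa [graphRegion] using h
  simp [graphSign_eq, this]; norm_num

omit [InnerProductSpace ℝ V] in
theorem graphSign_of_ge {u : ℝ → ℝ} {y : WithLp 2 (ℝ × V)} (h : 0 ≤ ‖y.snd‖ - u y.fst) :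
    graphSign V u y = 1 := by
  have : y ∉ graphRegion V u := by simpa [graphRegion] using h
  simp [graphSign_eq, this]

omit [InnerProductSpace ℝ V] in
theorem abs_graphSign_le (u : ℝ → ℝ) (y : WithLp 2 (ℝ × V)) : |graphSign V u y| ≤ 1 := by
  rcases lt_or_ge (‖y.snd‖ - u y.fst) 0 with h | h
  · simp [graphSign_of_lt h]
  · simp [graphSign_of_ge h]

omit [InnerProductSpace ℝ V] in
theorem measurableSet_graphRegion [MeasurableSpace V] [BorelSpace V] {u : ℝ → ℝ}
    (hu : Measurable u) : MeasurableSet (graphRegion V u) := by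
  have h := (MeasurableEquiv.toLp 2 (ℝ × V)).symm.measurable
  have h1 : Measurable fun y : WithLp 2 (ℝ × V) => y.fst := measurable_fst.comp h
  have h2 : Measurable fun y : WithLp 2 (ℝ × V) => y.snd := measurable_snd.comp h
  exact measurableSet_lt h2.norm (hu.comp h1)

omit [InnerProductSpace ℝ V] in
theorem measurable_graphSign [MeasurableSpace V] [BorelSpace V] {u : ℝ → ℝ}
    (hu : Measurable u) : Measurable (graphSign V u) := by
  have := measurableSet_graphRegion (V := V) hu
  exact (measurable_const.indicator this.compl).sub (measurable_const.indicator this)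

/-- The norm of a vector is `O(‖w‖²)`-close to its linearization at `a e`. -/
theorem abs_norm_smul_add_sub_le {e : V} (he : ‖e‖ = 1) {a : ℝ} (ha : 0 < a) {w : V}
    (hw : ‖w‖ ≤ a / 2) : |‖a • e + w‖ - a - inner ℝ w e| ≤ ‖w‖ ^ 2 / a := by
  have hx := abs_le.1 (abs_real_inner_le_norm w e)
  rw [he, mul_one] at hx
  have hsq : ‖a • e + w‖ ^ 2 = a ^ 2 + 2 * a * inner ℝ w e + ‖w‖ ^ 2 := by
    rw [norm_add_sq_real, norm_smul, he, Real.norm_of_nonneg ha.le, real_inner_smul_left,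
      real_inner_comm]
    ring
  set x : ℝ := inner ℝ w e
  have hn := norm_nonneg (a • e + w)
  set r := ‖a • e + w‖
  have hq : ‖w‖ ^ 2 / a * a = ‖w‖ ^ 2 := by field_simp
  have hq0 : 0 ≤ ‖w‖ ^ 2 / a := by positivity
  set q := ‖w‖ ^ 2 / a
  have h1 : a + x ≤ r := by
    refine abs_le_of_sq_le_sq' ?_ hn |>.2
    nlinarith [sq_nonneg x, norm_nonneg w]
  have h2 : r ≤ a + x + q := by
    refine abs_le_of_sq_le_sq' ?_ (by linarith) |>.2
    nlinarith [sq_nonneg x, sq_nonneg q]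
  rw [abs_le]
  constructor <;> linarith

/-- The linearization at the origin of the defining function of the translated graph. -/
def graphConormal (u : ℝ → ℝ) (s : ℝ) (e : V) : WithLp 2 (ℝ × V) →L[ℝ] ℝ :=
  innerSL ℝ (WithLp.toLp 2 (-deriv u s, e))

theorem graphConormal_apply (u : ℝ → ℝ) (s : ℝ) (e : V) (z : WithLp 2 (ℝ × V)) :
    graphConormal u s e z = inner ℝ z.snd e - z.fst * deriv u s := by
  rw [graphConormal, innerSL_apply_apply, WithLp.prod_inner_apply, real_inner_comm e]
  simp
  ring

theorem graphConormal_ne_zero (u : ℝ → ℝ) (s : ℝ) {e : V} (he : ‖e‖ = 1) :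
    graphConormal u s e ≠ 0 := by
  intro h
  have h1 := graphConormal_apply u s e (WithLp.toLp 2 (0, e))
  rw [h] at h1
  simp [he] at h1

/-- The norm is linearized with quadratic error, and u with error |τ|^{1+β} by Taylor. For ‖z‖ ≤ 1
the quadratic error is absorbed since β ≤ 1. -/
theorem abs_graphFunction_sub_le {e : V} (he : ‖e‖ = 1) (hβ : 0 ≤ β) (hβ1 : β ≤ 1)
    {u : HolderSpace 1 β} {s : ℝ} (hu : 0 < u s) {z : WithLp 2 (ℝ × V)}
    (hz : ‖z‖ ≤ min 1 (u s / 2)) :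
    |‖(graphPoint u s e + z).snd‖ - u (graphPoint u s e + z).fst - graphConormal u s e z| ≤
      (‖u‖ + 1 / u s) * (‖z‖ * ‖z‖ ^ β) := by
  have hz1 := hz.trans (min_le_left _ _)
  have hz2 := hz.trans (min_le_right _ _)
  have hsq := WithLp.prod_norm_sq_eq_of_L2 z
  have hw : ‖z.snd‖ ≤ ‖z‖ := abs_le_of_sq_le_sq' (by nlinarith [sq_nonneg ‖z.fst‖])
    (norm_nonneg _) |>.2
  have hτ : |z.fst| ≤ ‖z‖ := by
    rw [← Real.norm_eq_abs]
    exact abs_le_of_sq_le_sq' (by nlinarith [sq_nonneg ‖z.snd‖]) (norm_nonneg _) |>.2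
  have h1 := abs_norm_smul_add_sub_le he hu (hw.trans hz2)
  have h2 := u.abs_taylor_le hβ (s + z.fst) z.fst
  rw [add_sub_cancel_right] at h2
  have h3 : ‖z.snd‖ ^ 2 / u s ≤ 1 / u s * (‖z‖ * ‖z‖ ^ β) := by
    rw [div_eq_inv_mul, one_div]
    refine mul_le_mul_of_nonneg_left ?_ (by positivity)
    rw [sq]
    refine mul_le_mul hw (hw.trans ?_) (norm_nonneg _) (norm_nonneg _)
    exact Real.self_le_rpow_of_le_one (norm_nonneg _) hz1 hβ1
  have h4 : ‖u‖ * |z.fst| ^ β * |z.fst| ≤ ‖u‖ * (‖z‖ * ‖z‖ ^ β) := by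
    rw [mul_assoc, mul_comm ‖z‖]
    gcongr
  rw [graphConormal_apply]
  have e1 : (graphPoint u s e + z).snd = u s • e + z.snd := rfl
  have e2 : (graphPoint u s e + z).fst = s + z.fst := rfl
  rw [e1, e2]
  rw [abs_le] at *
  constructor <;> nlinarith

/-- If the linear part exceeds the linearization error, the defining function has opposite signs at
x + z and x - z, and the two signs cancel. -/
theorem abs_graphConormal_le_of_graphSign {e : V} (he : ‖e‖ = 1) (hβ : 0 ≤ β) (hβ1 : β ≤ 1)
    {u : HolderSpace 1 β} {s : ℝ} (hu : 0 < u s) {z : WithLp 2 (ℝ × V)}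
    (hz : ‖z‖ ≤ min 1 (u s / 2))
    (h : graphSign V u (graphPoint u s e + z) + graphSign V u (graphPoint u s e - z) ≠ 0) :
    |graphConormal u s e z| ≤ (‖u‖ + 1 / u s) * (‖z‖ * ‖z‖ ^ β) := by
  by_contra! hlt
  have h1 := abs_graphFunction_sub_le he hβ hβ1 hu hz
  have h2 := abs_graphFunction_sub_le he hβ hβ1 hu (z := -z) (by rwa [norm_neg])
  rw [norm_neg, map_neg, ← sub_eq_add_neg (graphPoint _ _ _)] at h2
  rw [abs_le] at h1 h2
  rcases lt_abs.1 hlt with h3 | h3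
  · rw [graphSign_of_ge (by linarith), graphSign_of_lt (by linarith)] at h
    norm_num at h
  · rw [graphSign_of_lt (by linarith), graphSign_of_ge (by linarith)] at h
    norm_num at h

end Graph

/-! ### The regularized volume integral in conical coordinates -/

section Representation

variable {V : Type*} [NormedAddCommGroup V] [InnerProductSpace ℝ V] [FiniteDimensional ℝ V]
  [MeasurableSpace V] [BorelSpace V] [Nontrivial V] {α β : ℝ}

/-- Polar coordinates in a ball of radius `w`. -/
theorem integral_ball_eq {w : ℝ} (hw : 0 < w) {g : V → ℝ} (hg : Measurable g)
    (hint : Integrable ({ζ : V | ‖ζ‖ < w}.indicator g))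
    (hint' : Integrable (fun q : Metric.sphere (0 : V) 1 × ℝ => q.2 ^ (Module.finrank ℝ V - 1) *
      w ^ (Module.finrank ℝ V - 1 + 1) * g ((q.2 * w) • (q.1 : V)))
      ((surfaceMeasure V).prod (volume.restrict (Ioc (0 : ℝ) 1)))) :
    ∫ ζ, {ζ : V | ‖ζ‖ < w}.indicator g ζ =
      ∫ q : Metric.sphere (0 : V) 1 × ℝ, q.2 ^ (Module.finrank ℝ V - 1) *
        w ^ (Module.finrank ℝ V - 1 + 1) * g ((q.2 * w) • (q.1 : V))
        ∂((surfaceMeasure V).prod (volume.restrict (Ioc (0 : ℝ) 1))) := by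
  set n := Module.finrank ℝ V - 1
  have hm : MeasurableSet {ζ : V | ‖ζ‖ < w} := measurableSet_lt (by fun_prop) (by fun_prop)
  have hgm := (hg.indicator hm).aestronglyMeasurable (μ := volume)
  rw [← integral_polar hgm, integral_prod _ ((integrable_polar_iff hgm).2 hint),
    integral_prod _ hint']
  refine integral_congr_ae (Eventually.of_forall fun σ => ?_)
  simp only
  rw [integral_radialMeasure]
  have h1 := integral_comp_mul_right_Ioi (fun r => r ^ n *
    {ζ : V | ‖ζ‖ < w}.indicator g (r • (σ : V))) 0 hw
  rw [zero_mul, smul_eq_mul, eq_inv_mul_iff_mul_eq₀ hw.ne', ← integral_const_mul] at h1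
  -- The ball is open while the parameter interval contains ρ = 1; the endpoint is negligible.
  rw [← h1, integral_Ioc_eq_integral_Ioo, ← integral_indicator measurableSet_Ioi,
    ← integral_indicator measurableSet_Ioo]
  congr 1
  ext ρ
  by_cases h0 : 0 < ρ
  · rw [indicator_of_mem (show ρ ∈ Ioi (0 : ℝ) from h0)]
    have hn : ‖(ρ * w) • (σ : V)‖ = ρ * w := by
      rw [norm_smul, norm_eq_of_mem_sphere, mul_one, Real.norm_of_nonneg (by positivity)]
    by_cases h2 : ρ < 1
    · rw [indicator_of_mem (show ρ ∈ Ioo (0 : ℝ) 1 from ⟨h0, h2⟩), indicator_of_mem (by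
        change ‖(ρ * w) • (σ : V)‖ < w
        rw [hn]; nlinarith)]
      ring
    · rw [indicator_of_notMem (show ρ ∉ Ioo (0 : ℝ) 1 from fun h => h2 h.2),
        indicator_of_notMem (by
          change ¬ ‖(ρ * w) • (σ : V)‖ < w
          rw [hn]; nlinarith)]
      ring
  · rw [indicator_of_notMem (show ρ ∉ Ioi (0 : ℝ) from h0), indicator_of_notMem fun h => h0 h.1]

theorem finrank_withLp_prod : Module.finrank ℝ (WithLp 2 (ℝ × V)) = Module.finrank ℝ V + 1 := by
  rw [(WithLp.linearEquiv 2 ℝ (ℝ × V)).finrank_eq, Module.finrank_prod, Module.finrank_self,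
    add_comm]

/-- The integral of the regularized kernel over the region below the graph. -/
theorem integral_graphRegion_regularKernel {e : V} (he : ‖e‖ = 1) (hα : 0 < α)
    {u : HolderSpace 1 β} (hu : u ∈ positiveCone β) (s : ℝ) {ε : ℝ} (hε : 0 < ε) :
    ∫ z, (graphRegion V u).indicator (fun _ => (1 : ℝ)) (graphPoint u s e + z) *
      regularKernel (WithLp 2 (ℝ × V)) (kernelExponent V α) α ε z =
    ∫ q, coneKernel e (fun τ => u (s - τ)) (u s) ε (kernelExponent V α) α
      (Module.finrank ℝ V - 1) q ∂((volume : Measure ℝ).prod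
      ((surfaceMeasure V).prod (volume.restrict (Ioc (0 : ℝ) 1)))) := by
  obtain ⟨m, hm, hmu⟩ := exists_pos_le_of_mem_positiveCone hu
  have hpos : ∀ t, 0 < u t := fun t => hm.trans_le (hmu t)
  have hp1 := one_lt_kernelExponent (V := V) hα
  have hum := u.continuous.measurable
  set p := kernelExponent V α with hp
  set x := graphPoint u s e with hx
  set E := graphRegion V u with hE
  set K := regularKernel (WithLp 2 (ℝ × V)) p α ε with hK
  have hEm : MeasurableSet E := measurableSet_graphRegion hum
  have hKm : Measurable K := measurable_regularKernel p α ε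
  have hKi : Integrable K := integrable_regularKernel hε hα (by
    rw [finrank_withLp_prod, hp, kernelExponent]; push_cast; linarith)
  have hind : Measurable (E.indicator fun _ => (1 : ℝ)) := measurable_const.indicator hEm
  have hGi : Integrable fun y => E.indicator (fun _ => (1 : ℝ)) y * K (y - x) :=
    (hKi.comp_sub_right x).bdd_mul (c := 1) hind.aestronglyMeasurable
      (Eventually.of_forall fun y => by
        by_cases h : y ∈ E <;> simp [h])
  have hcd := dominatedBy_coneKernel (V := V) (e := e) (w := fun τ => u (s - τ)) (a := u s)
    (k := Module.finrank ℝ V - 1) (α := α) he hε (by linarith : 0 < p) (by fun_prop)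
    (fun τ => u.abs_apply_le (s - τ))
  have hmp := WithLp.volume_preserving_toLp ℝ V
  have hemb : MeasurableEmbedding (WithLp.toLp 2 : ℝ × V → WithLp 2 (ℝ × V)) :=
    (MeasurableEquiv.toLp 2 (ℝ × V)).measurableEmbedding
  have hGi' := (hmp.integrable_comp_emb hemb).2 hGi
  calc ∫ z, E.indicator (fun _ => (1 : ℝ)) (x + z) * K z
      = ∫ y, E.indicator (fun _ => (1 : ℝ)) y * K (y - x) := by
        rw [← integral_add_left_eq_self
          (fun y => E.indicator (fun _ => (1 : ℝ)) y * K (y - x)) x]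
        simp only [add_sub_cancel_left]
    _ = ∫ q : ℝ × V, E.indicator (fun _ => (1 : ℝ)) (WithLp.toLp 2 q) *
          K (WithLp.toLp 2 q - x) := (hmp.integral_comp hemb _).symm
    _ = ∫ t, ∫ ζ, E.indicator (fun _ => (1 : ℝ)) (WithLp.toLp 2 (t, ζ)) *
          K (WithLp.toLp 2 (t, ζ) - x) := integral_prod _ hGi'
    _ = ∫ τ, ∫ ζ, E.indicator (fun _ => (1 : ℝ)) (WithLp.toLp 2 (s - τ, ζ)) *
          K (WithLp.toLp 2 (s - τ, ζ) - x) := (integral_sub_left_eq_self (fun t => ∫ ζ,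
            E.indicator (fun _ => (1 : ℝ)) (WithLp.toLp 2 (t, ζ)) *
            K (WithLp.toLp 2 (t, ζ) - x)) volume s).symm
    _ = ∫ τ, ∫ y, coneKernel e (fun τ => u (s - τ)) (u s) ε p α (Module.finrank ℝ V - 1) (τ, y)
          ∂((surfaceMeasure V).prod (volume.restrict (Ioc (0 : ℝ) 1))) := by
        refine integral_congr_ae (Eventually.of_forall fun τ => ?_)
        have hcone : ∀ y : Metric.sphere (0 : V) 1 × ℝ,
            y.2 ^ (Module.finrank ℝ V - 1) * u (s - τ) ^ (Module.finrank ℝ V - 1 + 1) *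
              K (WithLp.toLp 2 (s - τ, (y.2 * u (s - τ)) • (y.1 : V)) - x) =
            coneKernel e (fun τ => u (s - τ)) (u s) ε p α (Module.finrank ℝ V - 1) (τ, y) := by
          intro y
          have hn : ‖WithLp.toLp 2 (s - τ, (y.2 * u (s - τ)) • (y.1 : V)) - x‖ ^ 2 + ε ^ 2 =
              coneDistance e (fun τ => u (s - τ)) (u s) ε (τ, y) := by
            rw [WithLp.prod_norm_sq_eq_of_L2]
            have e1 : (WithLp.toLp 2 (s - τ, (y.2 * u (s - τ)) • (y.1 : V)) - x).fst =
              -τ := by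
              change s - τ - s = -τ
              ring
            have e2 : (WithLp.toLp 2 (s - τ, (y.2 * u (s - τ)) • (y.1 : V)) - x).snd =
              (y.2 * u (s - τ)) • (y.1 : V) - u s • e := rfl
            rw [e1, e2, norm_sub_sq_real, norm_smul, norm_smul, he, norm_eq_of_mem_sphere,
              real_inner_smul_left, real_inner_smul_right, coneDistance, Real.norm_eq_abs,
              Real.norm_eq_abs, Real.norm_eq_abs, mul_one, mul_one, sq_abs, sq_abs, sq_abs]
            ring
          rw [hK, regularKernel, hn, coneKernel]
        have hsec : Integrable (fun y => coneKernel e (fun τ => u (s - τ)) (u s) ε p α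
          (Module.finrank ℝ V - 1) (τ, y)) ((surfaceMeasure V).prod
            (volume.restrict (Ioc (0 : ℝ) 1))) := hcd.integrable_section τ
        simp only [← hcone] at hsec ⊢
        have hind2 : ∀ ζ : V, E.indicator (fun _ => (1 : ℝ)) (WithLp.toLp 2 (s - τ, ζ)) *
            K (WithLp.toLp 2 (s - τ, ζ) - x) = {ζ : V | ‖ζ‖ < u (s - τ)}.indicator
            (fun ζ => K (WithLp.toLp 2 (s - τ, ζ) - x)) ζ := by
          intro ζ
          by_cases h : ‖ζ‖ < u (s - τ)
          · rw [indicator_of_mem (show WithLp.toLp 2 (s - τ, ζ) ∈ E from h),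
              indicator_of_mem (show ζ ∈ {ζ : V | ‖ζ‖ < u (s - τ)} from h), one_mul]
          · rw [indicator_of_notMem (show WithLp.toLp 2 (s - τ, ζ) ∉ E from h),
              indicator_of_notMem (show ζ ∉ {ζ : V | ‖ζ‖ < u (s - τ)} from h), zero_mul]
        simp only [hind2]
        have hgm : Measurable fun ζ : V => K (WithLp.toLp 2 (s - τ, ζ) - x) :=
          hKm.comp ((hemb.measurable.comp measurable_prodMk_left).sub_const x)
        refine integral_ball_eq (hpos _) hgm ?_ hsec
        refine Integrable.mono' (g := {ζ : V | ‖ζ‖ < u (s - τ)}.indicator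
          (fun _ => (1 + 2 * p / α) * (ε ^ 2) ^ (-p))) ?_
          (hgm.indicator (measurableSet_lt (by fun_prop) (by fun_prop))).aestronglyMeasurable
          (Eventually.of_forall fun ζ => ?_)
        · rw [integrable_indicator_iff (measurableSet_lt (by fun_prop) (by fun_prop))]
          refine integrableOn_const ?_
          have : {ζ : V | ‖ζ‖ < u (s - τ)} = Metric.ball 0 (u (s - τ)) := by ext; simp
          rw [this]
          exact measure_ball_lt_top.ne
        · rw [norm_indicator_eq_indicator_norm]
          refine indicator_le_indicator ?_
          refine (abs_regularKernel_le (by linarith) hα _ (by positivity)).trans ?_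
          refine mul_le_mul_of_nonneg_left (Real.rpow_le_rpow_of_nonpos (by positivity)
            (by nlinarith [sq_nonneg ‖WithLp.toLp 2 (s - τ, ζ) - x‖]) (by linarith)) ?_
          have : 0 < p := by linarith
          positivity
    _ = _ := (integral_prod _ (hcd.integrable (integrable_one_add_abs_mul_rpow hε hp1))).symm

end Representation

/-! ### The curvature as an absolutely convergent surface integral -/

section Representation

variable {V : Type*} [NormedAddCommGroup V] [InnerProductSpace ℝ V] [FiniteDimensional ℝ V]
  [MeasurableSpace V] [BorelSpace V] [Nontrivial V] {α β : ℝ}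

/-- The surface integrand with the squared distance shifted by `ε²`. -/
def regularSurfaceIntegrand (e : V) (α : ℝ) (u : HolderSpace 1 β) (s ε : ℝ)
    (q : ℝ × Metric.sphere (0 : V) 1) : ℝ :=
  (q.1 * taylorRemainder u s q.1 + sphereDefect e q.2 * u s) *
    u (s - q.1) ^ (Module.finrank ℝ V - 1) *
      (ringDistance e u s q + ε ^ 2) ^ (-kernelExponent V α)

omit [Nontrivial V] in
theorem measurable_ringDistance (e : V) (u : HolderSpace 1 β) (s : ℝ) :
    Measurable (ringDistance e u s) := by
  have h1 := u.continuous.measurable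
  have h2 := measurable_sphereDefect e
  unfold ringDistance; fun_prop

omit [Nontrivial V] in
theorem measurable_regularSurfaceIntegrand (e : V) (u : HolderSpace 1 β) (s ε : ℝ) :
    Measurable (regularSurfaceIntegrand e α u s ε) := by
  have h1 := u.continuous.measurable
  have h2 := measurable_sphereDefect e
  have h3 := measurable_ringDistance e u s
  have h4 := measurable_taylorRemainder u s
  unfold regularSurfaceIntegrand; fun_prop

omit [FiniteDimensional ℝ V] [MeasurableSpace V] [BorelSpace V] [Nontrivial V] in
theorem sq_le_ringDistance {e : V} (he : ‖e‖ = 1) {u : HolderSpace 1 β} (hu : u ∈ positiveCone β)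
    (s : ℝ) (q : ℝ × Metric.sphere (0 : V) 1) : q.1 ^ 2 ≤ ringDistance e u s q := by
  obtain ⟨m, hm, hmu⟩ := exists_pos_le_of_mem_positiveCone hu
  have h1 := hm.trans_le (hmu s)
  have h2 := hm.trans_le (hmu (s - q.1))
  have h3 := sphereDefect_nonneg he q.2
  have h4 : 0 ≤ 2 * u s * u (s - q.1) * sphereDefect e q.2 := by positivity
  rw [ringDistance]
  linarith [sq_nonneg (u s - u (s - q.1))]

/-- The sign is 1 - 2·1_E. The constant contributes nothing because the kernel has integral zero,
and the divergence theorem evaluates -2 times the integral over E as 2/α times a flux. -/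
theorem integral_graphSign_regularKernel {e : V} (he : ‖e‖ = 1) (hα : 0 < α)
    {u : HolderSpace 1 β} (hu : u ∈ positiveCone β) (s : ℝ) {ε : ℝ} (hε : 0 < ε) :
    ∫ z, graphSign V u (graphPoint u s e + z) *
      regularKernel (WithLp 2 (ℝ × V)) (kernelExponent V α) α ε z =
    2 / α * ∫ q, regularSurfaceIntegrand e α u s ε q ∂(volume.prod (surfaceMeasure V)) := by
  have hn : 0 < Module.finrank ℝ V := Module.finrank_pos
  have hp1 := one_lt_kernelExponent (V := V) hα
  have h1 := integral_graphRegion_regularKernel he hα hu s hε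
  have hp : 2 * kernelExponent V α = Module.finrank ℝ (WithLp 2 (ℝ × V)) + α := by
    rw [finrank_withLp_prod, kernelExponent]; push_cast; ring
  have hpk : 2 * kernelExponent V α = ((Module.finrank ℝ V - 1 : ℕ) : ℝ) + 2 + α := by
    rw [kernelExponent, Nat.cast_sub hn]; push_cast; ring
  have hder : ∀ τ, HasDerivAt (fun τ => u (s - τ)) (-deriv u (s - τ)) τ := fun τ => by
    simpa using (u.hasDerivAt (s - τ)).comp_const_sub s τ
  have hud := u.continuous_deriv.measurable
  have h2 := integral_fluxRadial_eq (V := V) (a := u s) he hε hp1 hα.ne' hpk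
    (Nat.sub_add_cancel hn).symm hder (by fun_prop) (W := ‖u‖) (W' := ‖u‖)
    (fun τ => u.abs_apply_le _)
    (fun τ => by rw [abs_neg]; exact u.abs_deriv_le _)
  rw [← h1] at h2
  have hK := integrable_regularKernel (F := WithLp 2 (ℝ × V)) (p := kernelExponent V α) hε hα
    (by rw [hp]; linarith)
  have hind : Measurable ((graphRegion V u).indicator fun _ => (1 : ℝ)) :=
    measurable_const.indicator (measurableSet_graphRegion u.continuous.measurable)
  have hKi : Integrable fun z => (graphRegion V u).indicator (fun _ => (1 : ℝ))
      (graphPoint u s e + z) * regularKernel (WithLp 2 (ℝ × V)) (kernelExponent V α) α ε z :=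
    hK.bdd_mul (c := 1) (hind.comp (measurable_const_add _)).aestronglyMeasurable
      (Eventually.of_forall fun z => by
        by_cases h : graphPoint u s e + z ∈ graphRegion V u <;> simp [h])
  have h3 : ∀ q : ℝ × Metric.sphere (0 : V) 1, fluxRadial e (fun τ => u (s - τ))
      (fun τ => -deriv u (s - τ)) (u s) ε (kernelExponent V α) (Module.finrank ℝ V - 1)
      (q.1, q.2, 1) = regularSurfaceIntegrand e α u s ε q := by
    intro q
    rw [fluxRadial, regularSurfaceIntegrand]
    have e1 : coneDistance e (fun τ => u (s - τ)) (u s) ε (q.1, q.2, 1) =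
        ringDistance e u s q + ε ^ 2 := by
      rw [coneDistance, ringDistance, sphereDefect]; ring
    -- At τ = 0 the quotient takes the default value 0, and the identity survives since both sides
    -- vanish.
    have e2 : q.1 * taylorRemainder u s q.1 =
        q.1 * deriv u (s - q.1) - (u s - u (s - q.1)) := by
      rw [taylorRemainder]
      rcases eq_or_ne q.1 0 with h | h
      · simp [h]
      · field_simp
    rw [e1, e2, sphereDefect]
    ring
  simp only [h3] at h2
  simp only [graphSign_eq, sub_mul, one_mul, mul_assoc]
  rw [integral_sub hK (hKi.const_mul 2), integral_regularKernel hε hα hp, integral_const_mul, h2]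
  field_simp
  ring

/-- Dominated convergence: adding ε² to the distance only decreases the integrand in absolute value,
and the integrand at ε = 0 is integrable. -/
theorem tendsto_integral_graphSign_regularKernel {e : V} (he : ‖e‖ = 1) (hα : 0 < α)
    (hαβ : α < β) (hβ : β < 1) {u : HolderSpace 1 β} (hu : u ∈ positiveCone β) (s : ℝ) :
    Tendsto (fun ε => ∫ z, graphSign V u (graphPoint u s e + z) *
      regularKernel (WithLp 2 (ℝ × V)) (kernelExponent V α) α ε z) (𝓝[>] 0)
      (𝓝 (curvatureMap he hα hαβ hβ u s)) := by
  obtain ⟨hint, heq⟩ := curvatureMap_apply he hα hαβ hβ hu s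
  have hp1 := one_lt_kernelExponent (V := V) hα
  rw [heq]
  have hpos : ∀ᶠ ε : ℝ in 𝓝[>] 0, 0 < ε := eventually_mem_nhdsWithin
  refine Tendsto.congr' (f₁ := fun ε => 2 / α * ∫ q, regularSurfaceIntegrand e α u s ε q
    ∂(volume.prod (surfaceMeasure V))) ?_ (Tendsto.const_mul _ ?_)
  · filter_upwards [hpos] with ε hε
    exact (integral_graphSign_regularKernel he hα hu s hε).symm
  · refine tendsto_integral_filter_of_dominated_convergence
      (fun q => |surfaceIntegrand e α u s q|) (Eventually.of_forall fun ε =>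
        (measurable_regularSurfaceIntegrand e u s ε).aestronglyMeasurable)
      (Eventually.of_forall fun ε => ?_) hint.abs ?_
    · filter_upwards [ae_fst_ne_zero] with q hq
      have h1 := sq_le_ringDistance he hu s q
      have h2 : 0 < q.1 ^ 2 := by positivity
      have h3 : (0 : ℝ) < ringDistance e u s q := by linarith
      rw [Real.norm_eq_abs, regularSurfaceIntegrand, surfaceIntegrand, abs_mul,
        abs_mul (_ * _) (ringDistance e u s q ^ _)]
      refine mul_le_mul_of_nonneg_left ?_ (abs_nonneg _)
      rw [abs_of_nonneg (Real.rpow_nonneg (by positivity) _),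
        abs_of_nonneg (Real.rpow_nonneg h3.le _)]
      exact Real.rpow_le_rpow_of_nonpos h3 (by nlinarith [sq_nonneg ε]) (by linarith)
    · filter_upwards [ae_fst_ne_zero] with q hq
      have h1 := sq_le_ringDistance he hu s q
      have h2 : 0 < q.1 ^ 2 := by positivity
      have h3 : ContinuousAt (fun ε : ℝ => regularSurfaceIntegrand e α u s ε q) 0 := by
        unfold regularSurfaceIntegrand
        refine ContinuousAt.mul continuousAt_const (ContinuousAt.rpow_const (by fun_prop)
          (Or.inl ?_))
        simp only [ne_eq, OfNat.ofNat_ne_zero, not_false_eq_true, zero_pow, add_zero]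
        exact (by linarith : (0 : ℝ) < ringDistance e u s q).ne'
      have h4 : regularSurfaceIntegrand e α u s 0 q = surfaceIntegrand e α u s q := by
        simp [regularSurfaceIntegrand, surfaceIntegrand]
      rw [← h4]
      exact h3.tendsto.mono_left nhdsWithin_le_nhds

/-- `curvatureMap` computes the nonlocal mean curvature. -/
theorem hasPrincipalValue_graphSign {e : V} (he : ‖e‖ = 1) (hα : 0 < α)
    (hαβ : α < β) (hβ : β < 1) {u : HolderSpace 1 β} (hu : u ∈ positiveCone β) (s : ℝ) :
    HasPrincipalValue (fun y => graphSign V u y /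
      ‖graphPoint u s e - y‖ ^ (((Module.finrank ℝ V + 1 : ℕ) : ℝ) + α))
      (graphPoint u s e) (curvatureMap he hα hαβ hβ u s) := by
  obtain ⟨m, hm, hmu⟩ := exists_pos_le_of_mem_positiveCone hu
  have hus := hm.trans_le (hmu s)
  have hp : 2 * kernelExponent V α = Module.finrank ℝ (WithLp 2 (ℝ × V)) + α := by
    rw [finrank_withLp_prod, kernelExponent]; push_cast; ring
  have h := hasPrincipalValue_of_tendsto_regularKernel
    (measurable_graphSign (V := V) u.continuous.measurable)
    (abs_graphSign_le u) (graphConormal_ne_zero u s he) hα hαβ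
    (show 0 < ‖u‖ + 1 / u s by positivity) (show 0 < min 1 (u s / 2) by positivity) hp
    (fun z hz hne => abs_graphConormal_le_of_graphSign he (hα.trans hαβ).le hβ.le hus hz hne)
    (tendsto_integral_graphSign_regularKernel he hα hαβ hβ hu s)
  rwa [finrank_withLp_prod] at h

/-- For fixed τ the surface integrand is a function of ⟨σ,e⟩ alone, so its spherical integral does
not see the direction of e. -/
theorem curvatureMap_apply_eq {e e' : V} (he : ‖e‖ = 1) (he' : ‖e'‖ = 1) (hα : 0 < α)
    (hαβ : α < β) (hβ : β < 1) {u : HolderSpace 1 β} (hu : u ∈ positiveCone β) (s : ℝ) :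
    curvatureMap he hα hαβ hβ u s = curvatureMap he' hα hαβ hβ u s := by
  obtain ⟨hint, heq⟩ := curvatureMap_apply he hα hαβ hβ hu s
  obtain ⟨hint', heq'⟩ := curvatureMap_apply he' hα hαβ hβ hu s
  rw [heq, heq', integral_prod _ hint, integral_prod _ hint']
  congr 1
  refine integral_congr_ae (Eventually.of_forall fun τ => ?_)
  exact integral_sphere_inner_eq (fun x => (τ * taylorRemainder u s τ + (1 - x) * u s) *
    u (s - τ) ^ (Module.finrank ℝ V - 1) * (τ ^ 2 + (u s - u (s - τ)) ^ 2 +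
      2 * u s * u (s - τ) * (1 - x)) ^ (-kernelExponent V α)) (he.trans he'.symm)

end Representation

/-! ### The linearization at a straight cylinder -/

section Linearization

variable {V : Type*} [NormedAddCommGroup V] [InnerProductSpace ℝ V] [FiniteDimensional ℝ V]
  [MeasurableSpace V] [BorelSpace V] {α β κ : ℝ}

/-- The squared distance between `(0, κ e)` and `(τ, κ σ)`. -/
def cylinderDistance (e : V) (κ : ℝ) (q : ℝ × Metric.sphere (0 : V) 1) : ℝ :=
  q.1 ^ 2 + 2 * κ ^ 2 * sphereDefect e q.2

/-- The derivative of `surfaceIntegrand` at the constant function `κ` in the direction `v`. -/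
def linearizedIntegrand (e : V) (α κ : ℝ) (v : HolderSpace 1 β) (s : ℝ)
    (q : ℝ × Metric.sphere (0 : V) 1) : ℝ :=
  κ ^ (Module.finrank ℝ V - 1) *
    (q.1 * taylorRemainder v s q.1 * cylinderDistance e κ q ^ (-kernelExponent V α) +
      sphereDefect e q.2 * (v s + ((Module.finrank ℝ V : ℝ) - 1) * v (s - q.1)) *
        cylinderDistance e κ q ^ (-kernelExponent V α) -
      2 * kernelExponent V α * κ ^ 2 * sphereDefect e q.2 ^ 2 * (v s + v (s - q.1)) *
        cylinderDistance e κ q ^ (-kernelExponent V α - 1))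

theorem const_mem_positiveCone (hκ : 0 < κ) : HolderSpace.const 1 β κ ∈ positiveCone β :=
  mem_positiveCone_of_le hκ fun _ => le_rfl

theorem taylorRemainder_const (s τ : ℝ) :
    taylorRemainder (HolderSpace.const 1 β κ) s τ = 0 := by
  have : deriv (HolderSpace.const 1 β κ : ℝ → ℝ) (s - τ) = 0 := deriv_const _ _
  rw [taylorRemainder, this]
  simp [HolderSpace.const]

theorem ringDistance_const (e : V) (s : ℝ) (q : ℝ × Metric.sphere (0 : V) 1) :
    ringDistance e (HolderSpace.const 1 β κ) s q = cylinderDistance e κ q := by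
  simp only [ringDistance, cylinderDistance, HolderSpace.const]
  ring

/-- The derivative of the density at a constant, multiplied by the ring kernel. -/
theorem fderiv_densityFamily_mul_ringKernel [Nontrivial V] {γ : ℝ} {e : V} (he : ‖e‖ = 1)
    (hγ : 0 < γ) (hγβ : γ ≤ β) (hβ1 : β ≤ 1) (α : ℝ) (hκ : 0 < κ) (v : HolderSpace 1 β) (s : ℝ)
    {q : ℝ × Metric.sphere (0 : V) 1} (hq : q.1 ≠ 0) :
    κ * (fderiv ℝ (densityFamily he hγ hγβ hβ1 α) (HolderSpace.const 1 β κ) v s q *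
      ringKernel e (kernelExponent V α) q) =
    κ ^ (Module.finrank ℝ V - 1) * (((Module.finrank ℝ V : ℝ) - 1) * v (s - q.1) *
        cylinderDistance e κ q ^ (-kernelExponent V α) -
      2 * kernelExponent V α * κ ^ 2 * sphereDefect e q.2 * (v s + v (s - q.1)) *
        cylinderDistance e κ q ^ (-kernelExponent V α - 1)) := by
  set u₀ := HolderSpace.const 1 β κ with hu₀
  have hu₀m : u₀ ∈ positiveCone β := const_mem_positiveCone hκ
  have hn : 0 < Module.finrank ℝ V := Module.finrank_pos
  set n := Module.finrank ℝ V - 1 with hnd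
  have hnr : (Module.finrank ℝ V : ℝ) - 1 = n := by rw [hnd, Nat.cast_sub hn]; simp
  set p := kernelExponent V α
  have hline : HasDerivAt (fun t : ℝ => u₀ + t • v) v 0 := by
    simpa using ((hasDerivAt_id (0 : ℝ)).smul_const v).const_add u₀
  have hline0 : u₀ + (0 : ℝ) • v = u₀ := by simp
  have h1 : HasDerivAt (fun t : ℝ => densityFamily he hγ hγβ hβ1 α (u₀ + t • v))
      (fderiv ℝ (densityFamily he hγ hγβ hβ1 α) u₀ v) 0 := by
    have hd := ((contDiffAt_densityFamily he hγ hγβ hβ1 α hu₀m).differentiableAt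
      (by simp)).hasFDerivAt
    rw [← hline0] at hd
    have := hd.comp_hasDerivAt (0 : ℝ) hline
    rwa [hline0] at this
  have h2 := ((HolderFamily.evalCLM s q).hasFDerivAt.comp_hasDerivAt (0 : ℝ) h1).mul_const
    (ringKernel e p q)
  have hc := sphereDefect_nonneg he q.2
  have hD : 0 < cylinderDistance e κ q := by unfold cylinderDistance; positivity
  have h3 : HasDerivAt (fun t : ℝ => ringDistance e (u₀ + t • v) s q)
      (2 * κ * (v s + v (s - q.1)) * sphereDefect e q.2) 0 := by
    have e1 : ∀ t : ℝ, ringDistance e (u₀ + t • v) s q = q.1 ^ 2 +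
        (t * (v s - v (s - q.1))) ^ 2 + 2 * (κ + t * v s) * (κ + t * v (s - q.1)) *
          sphereDefect e q.2 := by
      intro t
      have : ∀ x, (u₀ + t • v : HolderSpace 1 β) x = κ + t * v x := fun x => rfl
      simp only [ringDistance, this]
      ring
    simp only [e1]
    have a1 : ∀ b : ℝ, HasDerivAt (fun t : ℝ => t * b) b 0 := fun b => by
      simpa using (hasDerivAt_id (0 : ℝ)).mul_const b
    refine ((((a1 _).fun_pow 2).const_add (q.1 ^ 2)).fun_add
      (((((a1 (v s)).const_add κ).const_mul 2).fun_mul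
        ((a1 (v (s - q.1))).const_add κ)).mul_const (sphereDefect e q.2))).congr_deriv ?_
    simp
    left
    ring
  have hrd0 : ringDistance e (u₀ + (0 : ℝ) • v) s q = cylinderDistance e κ q := by
    rw [hline0]; exact ringDistance_const e s q
  have h4 := h3.rpow_const (p := -p) (Or.inl (by rw [hrd0]; exact hD.ne'))
  have h5 : HasDerivAt (fun t : ℝ => (u₀ + t • v : HolderSpace 1 β) (s - q.1) ^ n)
      (n * κ ^ (n - 1) * v (s - q.1)) 0 := by
    have e1 : ∀ t : ℝ, (u₀ + t • v : HolderSpace 1 β) (s - q.1) = κ + t * v (s - q.1) :=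
      fun t => rfl
    simp only [e1]
    have a1 : HasDerivAt (fun t : ℝ => t * v (s - q.1)) (v (s - q.1)) 0 := by
      simpa using (hasDerivAt_id (0 : ℝ)).mul_const (v (s - q.1))
    refine ((a1.const_add κ).fun_pow n).congr_deriv ?_
    simp
  have h6 := h5.fun_mul h4
  have h7 : ∀ᶠ t : ℝ in 𝓝 0, (u₀ + t • v) ∈ positiveCone β :=
    hline.continuousAt.eventually_mem ((isOpen_positiveCone β).mem_nhds (by rwa [hline0]))
  -- Near t = 0 the line stays in the positive cone, where density times kernel is an explicit
  -- scalar function of t. Uniqueness of derivatives then gives the value without differentiating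
  -- `rpow` in the algebra.
  have h8 := h2.congr_of_eventuallyEq (f₁ := fun t : ℝ =>
    (u₀ + t • v : HolderSpace 1 β) (s - q.1) ^ n * ringDistance e (u₀ + t • v) s q ^ (-p)) (by
      filter_upwards [h7] with t ht
      exact (densityFamily_mul_ringKernel he hγ hγβ hβ1 α ht s hq).symm)
  have h9 := h8.unique h6
  simp only [HolderFamily.evalCLM_apply, hrd0] at h9
  rw [h9, hline0, hnr]
  have e2 : u₀ (s - q.1) = κ := rfl
  have e3 : κ * (n * κ ^ (n - 1)) = n * κ ^ n := by
    rcases Nat.eq_zero_or_pos n with h | h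
    · simp [h]
    · rw [mul_left_comm, ← pow_succ', Nat.sub_add_cancel h]
  rw [e2]
  linear_combination (v (s - q.1) * cylinderDistance e κ q ^ (-p)) * e3

/-- The product rule for the bilinear and linear pieces, reassembled into one integrand for almost
every (τ,σ). -/
theorem fderiv_curvatureMap_const [Nontrivial V] {e : V} (he : ‖e‖ = 1) (hα : 0 < α)
    (hαβ : α < β) (hβ : β < 1) (hκ : 0 < κ) (v : HolderSpace 1 β) (s : ℝ) :
    Integrable (linearizedIntegrand e α κ v s) (volume.prod (surfaceMeasure V)) ∧
    fderiv ℝ (curvatureMap he hα hαβ hβ) (HolderSpace.const 1 β κ) v s =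
      2 / α * ∫ q, linearizedIntegrand e α κ v s q ∂(volume.prod (surfaceMeasure V)) := by
  set u₀ := HolderSpace.const 1 β κ with hu₀
  have hu₀m : u₀ ∈ positiveCone β := const_mem_positiveCone hκ
  have hγ := sub_pos.2 hαβ
  have hγβ := sub_le_self β hα.le
  set M : HolderSpace 1 β → HolderFamily (β - α) (ℝ × Metric.sphere (0 : V) 1) :=
    densityFamily he hγ hγβ hβ.le α with hM
  set W := valueFamily (β := β) V hγ (hγβ.trans hβ.le) with hW
  set M' := fderiv ℝ M u₀ v with hM'
  have hdM : HasFDerivAt M (fderiv ℝ M u₀) u₀ :=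
    ((contDiffAt_densityFamily he hγ hγβ hβ.le α hu₀m).differentiableAt (by simp)).hasFDerivAt
  have hdH : HasFDerivAt (curvatureMap he hα hαβ hβ) (fderiv ℝ (curvatureMap he hα hαβ hβ) u₀) u₀ :=
    ((contDiffAt_curvatureMap he hα hαβ hβ hu₀m).differentiableAt (by simp)).hasFDerivAt
  have hdB := (((bilinearCLM (V := V) he hα hαβ).hasFDerivAt (x := u₀)).clm_apply hdM).add
    ((defectCLM he hα (hαβ.trans hβ) hγ).hasFDerivAt.comp u₀ ((W.hasFDerivAt (x := u₀)).mul hdM))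
  have hdH' := hdB.const_smul (2 / α)
  have heq := hdH.unique hdH'
  -- The Taylor remainder of a constant is zero, so the derivative of the density enters only
  -- through the linear part.
  have hB0 : ∀ F, bilinearCLM (V := V) he hα hαβ u₀ F s = 0 := fun F => by
    rw [bilinearCLM_apply]
    simp [bilinearIntegrand, hu₀, taylorRemainder_const]
  have hval : fderiv ℝ (curvatureMap he hα hαβ hβ) u₀ v s =
      2 / α * (bilinearCLM he hα hαβ v (M u₀) s +
        defectCLM he hα (hαβ.trans hβ) hγ (W u₀ * M' + W v * M u₀) s) := by
    rw [heq]
    change 2 / α * ((bilinearCLM he hα hαβ u₀ M' s + bilinearCLM he hα hαβ v (M u₀) s) +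
      defectCLM he hα (hαβ.trans hβ) hγ (W u₀ * M' + M u₀ * W v) s) = _
    rw [hB0, zero_add, mul_comm (M u₀)]
  have i1 := integrable_bilinearIntegrand he hα hαβ v (M u₀) s
  have i2 := integrable_mul_sphereDefect_mul_ringKernel he hα (hαβ.trans hβ)
    (W u₀ * M' + W v * M u₀) s
  have hae : ∀ᵐ q ∂(volume.prod (surfaceMeasure V)), bilinearIntegrand e α v (M u₀) s q +
      (W u₀ * M' + W v * M u₀) s q * (sphereDefect e q.2 * ringKernel e (kernelExponent V α) q) =
      linearizedIntegrand e α κ v s q := by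
    filter_upwards [ae_fst_ne_zero] with q hq
    have h1 := densityFamily_mul_ringKernel he hγ hγβ hβ.le α hu₀m s hq
    have h2 := fderiv_densityFamily_mul_ringKernel he hγ hγβ hβ.le α hκ v s hq
    rw [ringDistance_const] at h1
    have e1 : u₀ (s - q.1) = κ := rfl
    have e2 : W u₀ s q = κ := rfl
    have e3 : W v s q = v (s - 0) := rfl
    rw [e1] at h1
    rw [HolderFamily.add_apply, HolderFamily.mul_apply, HolderFamily.mul_apply, e2, e3, sub_zero,
      bilinearIntegrand, linearizedIntegrand, mul_assoc _ (M u₀ s q), hM, h1]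
    calc _ = q.1 * taylorRemainder v s q.1 * (κ ^ (Module.finrank ℝ V - 1) *
          cylinderDistance e κ q ^ (-kernelExponent V α)) + sphereDefect e q.2 *
          (κ * (M' s q * ringKernel e (kernelExponent V α) q) +
            v s * (M u₀ s q * ringKernel e (kernelExponent V α) q)) := by rw [hM]; ring
      _ = _ := by rw [hM', hM, h2, h1]; ring
  refine ⟨(i1.add i2).congr hae, ?_⟩
  rw [hval, ← integral_congr_ae hae, integral_add i1 i2, bilinearCLM_apply, defectCLM_apply]

end Linearization

/-! ### The kernel of the linearization and its two integrations by parts -/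

section CylinderKernel

variable {V : Type*} [NormedAddCommGroup V] [InnerProductSpace ℝ V] [FiniteDimensional ℝ V]
  [MeasurableSpace V] [BorelSpace V] {α β κ p : ℝ} {e : V}

theorem measurable_cylinderDistance : Measurable (cylinderDistance e κ) := by
  have := measurable_sphereDefect e
  unfold cylinderDistance; fun_prop

theorem sq_le_cylinderDistance (he : ‖e‖ = 1) (q : ℝ × Metric.sphere (0 : V) 1) :
    q.1 ^ 2 ≤ cylinderDistance e κ q := by
  have := sphereDefect_nonneg he q.2
  unfold cylinderDistance
  have : 0 ≤ 2 * κ ^ 2 * sphereDefect e q.2 := by positivity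
  linarith

theorem cylinderDistance_pos (he : ‖e‖ = 1) {q : ℝ × Metric.sphere (0 : V) 1} (hq : q.1 ≠ 0) :
    0 < cylinderDistance e κ q :=
  lt_of_lt_of_le (by positivity) (sq_le_cylinderDistance he q)

theorem cylinderDistance_rpow_le (he : ‖e‖ = 1) (hp : 0 ≤ p) {q : ℝ × Metric.sphere (0 : V) 1}
    (hq : q.1 ≠ 0) : cylinderDistance e κ q ^ (-p) ≤ |q.1| ^ (-(2 * p)) := by
  rw [← sq_rpow_neg]
  exact Real.rpow_le_rpow_of_nonpos (by positivity) (sq_le_cylinderDistance he q) (by linarith)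

theorem cylinderDistance_rpow_eq (he : ‖e‖ = 1) {q : ℝ × Metric.sphere (0 : V) 1}
    (hq : q.1 ≠ 0) : cylinderDistance e κ q ^ (-p) =
      cylinderDistance e κ q * cylinderDistance e κ q ^ (-p - 1) := by
  rw [mul_comm, ← Real.rpow_add_one (cylinderDistance_pos he hq).ne']; congr 1; ring

/-- The kernel of the linearization at a straight cylinder of radius `κ`. -/
def cylinderKernel (e : V) (α κ τ : ℝ) : ℝ :=
  ∫ σ, cylinderDistance e κ (τ, σ) ^ (-kernelExponent V α) ∂(surfaceMeasure V)

theorem integrable_cylinderDistance_section (he : ‖e‖ = 1) (hp : 0 ≤ p) {τ : ℝ}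
    (hτ : τ ≠ 0) :
    Integrable (fun σ => cylinderDistance e κ (τ, σ) ^ (-p)) (surfaceMeasure V) := by
  have hm := measurable_cylinderDistance (e := e) (κ := κ)
  refine Integrable.of_bound ((hm.comp measurable_prodMk_left).pow_const (-p)).aestronglyMeasurable
    (|τ| ^ (-(2 * p))) (Eventually.of_forall fun σ => ?_)
  rw [Real.norm_of_nonneg (Real.rpow_nonneg (cylinderDistance_pos he (q := (τ, σ)) hτ).le _)]
  exact cylinderDistance_rpow_le he hp (q := (τ, σ)) hτ

/-- The cylinder distance is at least min(1,κ²) times the base of the ring kernel, so this reduces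
to the unit case. -/
theorem exists_cylinderKernel_le [Nontrivial V] (he : ‖e‖ = 1) (hα : 0 < α) (hκ : 0 < κ) :
    ∃ C, 0 ≤ C ∧ ∀ τ, τ ≠ 0 → cylinderKernel e α κ τ ≤ C * |τ| ^ (-2 - α) := by
  have hp1 := one_lt_kernelExponent (V := V) hα
  obtain ⟨C, hC, h⟩ := exists_integral_ringKernel_le he (p := kernelExponent V α)
    (by unfold kernelExponent; linarith)
  have hm : 0 < min 1 (κ ^ 2) := by positivity
  refine ⟨(min 1 (κ ^ 2)) ^ (-kernelExponent V α) * C, by positivity, fun τ hτ => ?_⟩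
  have h1 : cylinderKernel e α κ τ ≤ ∫ σ, (min 1 (κ ^ 2)) ^ (-kernelExponent V α) *
      ringKernel e (kernelExponent V α) (τ, σ) ∂(surfaceMeasure V) := by
    refine integral_mono (integrable_cylinderDistance_section he (by linarith) hτ)
      ((integrable_ringKernel_section he (by linarith) hτ).const_mul _) fun σ => ?_
    have hc := sphereDefect_nonneg he σ
    have h2 : (0 : ℝ) < τ ^ 2 + 2 * sphereDefect e σ := by positivity
    simp only [ringKernel]
    rw [← Real.mul_rpow hm.le h2.le]
    refine Real.rpow_le_rpow_of_nonpos (by positivity) ?_ (by linarith)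
    have h3 := mul_le_mul_of_nonneg_right (min_le_left 1 (κ ^ 2)) (sq_nonneg τ)
    have h4 := mul_le_mul_of_nonneg_right (min_le_right 1 (κ ^ 2)) hc
    simp only [cylinderDistance]
    linarith
  refine h1.trans ?_
  rw [integral_const_mul, mul_assoc]
  refine mul_le_mul_of_nonneg_left ((h τ hτ).trans (le_of_eq ?_)) (by positivity)
  congr 2
  unfold kernelExponent
  ring

/-- The coefficient that remains after the integration by parts. -/
def reducedCoefficient (e : V) (α κ : ℝ) (q : ℝ × Metric.sphere (0 : V) 1) : ℝ :=
  (2 * kernelExponent V α - 2 - ((Module.finrank ℝ V : ℝ) - 1) * sphereDefect e q.2) *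
      cylinderDistance e κ q ^ (-kernelExponent V α) -
    2 * kernelExponent V α * κ ^ 2 * (sphereDefect e q.2 * (2 - sphereDefect e q.2)) *
      cylinderDistance e κ q ^ (-kernelExponent V α - 1)

theorem measurable_reducedCoefficient : Measurable (reducedCoefficient e α κ) := by
  have h1 := measurable_cylinderDistance (e := e) (κ := κ)
  have h2 := measurable_sphereDefect e
  unfold reducedCoefficient; fun_prop

theorem abs_reducedCoefficient_le [Nontrivial V] (he : ‖e‖ = 1) (hα : 0 < α)
    {q : ℝ × Metric.sphere (0 : V) 1} (hq : q.1 ≠ 0) :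
    |reducedCoefficient e α κ q| ≤
      (4 * kernelExponent V α + 2 + 2 * Module.finrank ℝ V) *
        |q.1| ^ (-(2 * kernelExponent V α)) := by
  have hp1 := one_lt_kernelExponent (V := V) hα
  have hn : (1 : ℝ) ≤ Module.finrank ℝ V := by exact_mod_cast Module.finrank_pos
  have hc := sphereDefect_nonneg he q.2
  have hc2 := sphereDefect_le he q.2
  have hD := cylinderDistance_pos (κ := κ) he hq
  have hle := cylinderDistance_rpow_le (κ := κ) he (zero_le_one.trans hp1.le) hq
  have heq := cylinderDistance_rpow_eq (κ := κ) (p := kernelExponent V α) he hq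
  have hR : 0 < cylinderDistance e κ q ^ (-kernelExponent V α - 1) := Real.rpow_pos_of_pos hD _
  have hP : 0 < cylinderDistance e κ q ^ (-kernelExponent V α) := Real.rpow_pos_of_pos hD _
  rw [reducedCoefficient]
  refine le_trans ?_ (mul_le_mul_of_nonneg_left hle (by positivity))
  have h1 : 2 * κ ^ 2 * sphereDefect e q.2 * cylinderDistance e κ q ^ (-kernelExponent V α - 1) ≤
      cylinderDistance e κ q ^ (-kernelExponent V α) := by
    rw [heq]
    refine mul_le_mul_of_nonneg_right ?_ hR.le
    rw [cylinderDistance]; linarith [sq_nonneg q.1]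
  have h0 : 0 ≤ 2 * κ ^ 2 * sphereDefect e q.2 *
      cylinderDistance e κ q ^ (-kernelExponent V α - 1) := by positivity
  set p := kernelExponent V α
  set c := sphereDefect e q.2
  set P := cylinderDistance e κ q ^ (-p)
  set R := cylinderDistance e κ q ^ (-p - 1)
  set n := (Module.finrank ℝ V : ℝ)
  refine (abs_sub _ _).trans ?_
  have h2 : |(2 * p - 2 - (n - 1) * c) * P| ≤ (2 * p + 2 + 2 * n) * P := by
    rw [abs_mul, abs_of_pos hP]
    refine mul_le_mul_of_nonneg_right ?_ hP.le
    rw [abs_le]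
    constructor <;> nlinarith
  have h3 : |2 * p * κ ^ 2 * (c * (2 - c)) * R| ≤ 2 * p * P := by
    have e1 : 2 * p * κ ^ 2 * (c * (2 - c)) * R = (p * (2 - c)) * (2 * κ ^ 2 * c * R) := by ring
    have h4 : 0 ≤ p * (2 - c) := mul_nonneg (by linarith) (by linarith)
    rw [e1, abs_of_nonneg (mul_nonneg h4 h0)]
    exact mul_le_mul (by nlinarith) h1 h0 (by linarith)
  linarith

/-- With x = ⟨σ,e⟩ and 2p = n + 1 + α, the coefficient is αf(x) minus the spherical divergence
(1-x²)f' - (n-1)xf for f(x) = (τ²+2κ²(1-x))^{-p}, and the latter integrates to zero. -/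
theorem integral_reducedCoefficient [Nontrivial V] (he : ‖e‖ = 1) (hα : 0 < α) {τ : ℝ}
    (hτ : τ ≠ 0) :
    ∫ σ, reducedCoefficient e α κ (τ, σ) ∂(surfaceMeasure V) = α * cylinderKernel e α κ τ := by
  have hp1 := one_lt_kernelExponent (V := V) hα
  set p := kernelExponent V α with hp
  have hpn : 2 * p = Module.finrank ℝ V + 1 + α := by rw [hp, kernelExponent]; ring
  have hpos : ∀ x ∈ Icc (-1 : ℝ) 1, 0 < τ ^ 2 + 2 * κ ^ 2 * (1 - x) := fun x hx => by
    have h1 : 0 ≤ 1 - x := by linarith [hx.2]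
    positivity
  have h := integral_sphere_divergence_eq_zero he
    (f := fun x => (τ ^ 2 + 2 * κ ^ 2 * (1 - x)) ^ (-p)) fun x hx =>
      ContDiffAt.rpow_const_of_ne (by fun_prop) (hpos x hx).ne'
  have hder : ∀ x ∈ Icc (-1 : ℝ) 1, deriv (fun x => (τ ^ 2 + 2 * κ ^ 2 * (1 - x)) ^ (-p)) x =
      2 * p * κ ^ 2 * (τ ^ 2 + 2 * κ ^ 2 * (1 - x)) ^ (-p - 1) := fun x hx => by
    have h1 : HasDerivAt (fun x : ℝ => τ ^ 2 + 2 * κ ^ 2 * (1 - x)) (2 * κ ^ 2 * -1) x :=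
      (((hasDerivAt_id x).const_sub 1).const_mul (2 * κ ^ 2)).const_add (τ ^ 2)
    rw [(h1.rpow_const (p := -p) (Or.inl (hpos x hx).ne')).deriv]
    ring
  have hmem : ∀ σ : Metric.sphere (0 : V) 1, inner ℝ (σ : V) e ∈ Icc (-1 : ℝ) 1 := fun σ =>
    abs_le.1 (abs_inner_sphere_le he σ)
  have hpt : ∀ σ : Metric.sphere (0 : V) 1, reducedCoefficient e α κ (τ, σ) =
      α * cylinderDistance e κ (τ, σ) ^ (-p) - ((1 - inner ℝ (σ : V) e ^ 2) *
        deriv (fun x => (τ ^ 2 + 2 * κ ^ 2 * (1 - x)) ^ (-p)) (inner ℝ (σ : V) e) -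
      ((Module.finrank ℝ V : ℝ) - 1) * (inner ℝ (σ : V) e *
        (fun x => (τ ^ 2 + 2 * κ ^ 2 * (1 - x)) ^ (-p)) (inner ℝ (σ : V) e))) := by
    intro σ
    rw [hder _ (hmem σ)]
    simp only [reducedCoefficient, ← hp, cylinderDistance, sphereDefect]
    rw [show Module.finrank ℝ V = 2 * p - 1 - α by linarith]
    ring
  have hi1 := (integrable_cylinderDistance_section (κ := κ) he (by linarith : 0 ≤ p) hτ).const_mul α
  have hi2 : Integrable (fun σ => reducedCoefficient e α κ (τ, σ)) (surfaceMeasure V) := by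
    refine Integrable.of_bound (measurable_reducedCoefficient.comp
      measurable_prodMk_left).aestronglyMeasurable ((4 * p + 2 + 2 * Module.finrank ℝ V) *
        |τ| ^ (-(2 * p))) (Eventually.of_forall fun σ => abs_reducedCoefficient_le he hα (q := (τ, σ)) hτ)
  have hi3 := hi1.sub hi2
  simp only [hpt] at hi3 ⊢
  rw [integral_sub hi1 (hi3.congr (Eventually.of_forall fun σ => by simp)), h, sub_zero, integral_const_mul]
  rfl

/-- The primitive used in the integration by parts. -/
def incrementPrimitive (e : V) (p κ : ℝ) (v : HolderSpace 1 β) (s : ℝ)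
    (q : ℝ × Metric.sphere (0 : V) 1) : ℝ :=
  (v s - v (s - q.1)) * (q.1 * cylinderDistance e κ q ^ (-p))

/-- The derivative of `incrementPrimitive` in `τ`. -/
def incrementDerivative (e : V) (p κ : ℝ) (v : HolderSpace 1 β) (s : ℝ)
    (q : ℝ × Metric.sphere (0 : V) 1) : ℝ :=
  deriv v (s - q.1) * (q.1 * cylinderDistance e κ q ^ (-p)) +
    (v s - v (s - q.1)) * (cylinderDistance e κ q ^ (-p) -
      2 * p * (q.1 ^ 2 * cylinderDistance e κ q ^ (-p - 1)))

variable {v : HolderSpace 1 β} {s : ℝ}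

theorem hasDerivAt_incrementPrimitive (he : ‖e‖ = 1) {τ : ℝ} (hτ : τ ≠ 0)
    (σ : Metric.sphere (0 : V) 1) :
    HasDerivAt (fun τ => incrementPrimitive e p κ v s (τ, σ))
      (incrementDerivative e p κ v s (τ, σ)) τ := by
  have h1 : HasDerivAt (fun τ : ℝ => v s - v (s - τ)) (deriv v (s - τ)) τ := by
    simpa using ((v.hasDerivAt (s - τ)).comp_const_sub s τ).const_sub (v s)
  have h2 : HasDerivAt (fun τ => cylinderDistance e κ (τ, σ)) (2 * τ) τ := by
    simpa [cylinderDistance] using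
      (hasDerivAt_pow 2 τ).add_const (2 * κ ^ 2 * sphereDefect e σ)
  have h3 := h2.rpow_const (p := -p) (Or.inl (cylinderDistance_pos he (q := (τ, σ)) hτ).ne')
  refine (h1.fun_mul ((hasDerivAt_id τ).fun_mul h3)).congr_deriv ?_
  simp only [incrementDerivative, id]
  ring

theorem measurable_incrementDerivative : Measurable (incrementDerivative e p κ v s) := by
  have h1 := measurable_cylinderDistance (e := e) (κ := κ)
  have h2 := v.continuous.measurable
  have h3 := v.continuous_deriv.measurable
  unfold incrementDerivative; fun_prop

theorem HolderSpace.abs_increment_le (v : HolderSpace 1 β) (s τ : ℝ) :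
    |v s - v (s - τ)| ≤ 2 * ‖v‖ := by
  have h1 := abs_le.1 (v.abs_apply_le s)
  have h2 := abs_le.1 (v.abs_apply_le (s - τ))
  rw [abs_le]; constructor <;> linarith

theorem abs_incrementPrimitive_le (he : ‖e‖ = 1) (hp : 0 ≤ p) {q : ℝ × Metric.sphere (0 : V) 1}
    (hq : q.1 ≠ 0) :
    |incrementPrimitive e p κ v s q| ≤ 2 * ‖v‖ * |q.1| ^ (1 - 2 * p) := by
  have h1 : |q.1| ^ (1 - 2 * p) = |q.1| * |q.1| ^ (-(2 * p)) := by
    rw [sub_eq_neg_add, Real.rpow_add_one (abs_pos.2 hq).ne', mul_comm]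
  have hD := cylinderDistance_pos (κ := κ) he hq
  rw [incrementPrimitive, abs_mul, abs_mul, abs_of_pos (Real.rpow_pos_of_pos hD _), h1]
  exact mul_le_mul (v.abs_increment_le s q.1)
    (mul_le_mul_of_nonneg_left (cylinderDistance_rpow_le he hp hq) (abs_nonneg _))
    (by positivity) (by positivity)

theorem abs_incrementDerivative_le (he : ‖e‖ = 1) (hp : 0 ≤ p) {q : ℝ × Metric.sphere (0 : V) 1}
    {δ : ℝ} (hδ : 0 < δ) (hq : δ ≤ |q.1|) :
    |incrementDerivative e p κ v s q| ≤
      ‖v‖ * (1 + (2 + 4 * p) / δ) * |q.1| ^ (1 - 2 * p) := by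
  have hq0 : 0 < |q.1| := hδ.trans_le hq
  have hqne : q.1 ≠ 0 := abs_pos.1 hq0
  have h1 : |q.1| ^ (1 - 2 * p) = |q.1| * |q.1| ^ (-(2 * p)) := by
    rw [sub_eq_neg_add, Real.rpow_add_one hq0.ne', mul_comm]
  have hD := cylinderDistance_pos (κ := κ) he hqne
  have hR : 0 < cylinderDistance e κ q ^ (-p - 1) := Real.rpow_pos_of_pos hD _
  have hP : 0 < cylinderDistance e κ q ^ (-p) := Real.rpow_pos_of_pos hD _
  have h2 : q.1 ^ 2 * cylinderDistance e κ q ^ (-p - 1) ≤ cylinderDistance e κ q ^ (-p) := by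
    rw [cylinderDistance_rpow_eq he hqne]
    exact mul_le_mul_of_nonneg_right (sq_le_cylinderDistance he q) hR.le
  have hle := cylinderDistance_rpow_le (κ := κ) he hp hqne
  have h3 : |cylinderDistance e κ q ^ (-p) - 2 * p * (q.1 ^ 2 * cylinderDistance e κ q ^ (-p - 1))| ≤
      (1 + 2 * p) * |q.1| ^ (-(2 * p)) := by
    have h4 : 0 ≤ 2 * p * (q.1 ^ 2 * cylinderDistance e κ q ^ (-p - 1)) := by positivity
    have h5 := mul_le_mul_of_nonneg_left h2 (by linarith : 0 ≤ 2 * p)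
    have h6 := mul_le_mul_of_nonneg_left hle (by linarith : 0 ≤ 2 * p)
    rw [abs_le]
    constructor <;> nlinarith
  have h7 : |q.1| ^ (-(2 * p)) ≤ 1 / δ * (|q.1| * |q.1| ^ (-(2 * p))) := by
    rw [← mul_assoc]
    refine le_mul_of_one_le_left (by positivity) ?_
    rw [one_div, inv_mul_eq_div, one_le_div hδ]
    exact hq
  rw [incrementDerivative, h1]
  set X := |q.1| ^ (-(2 * p))
  calc |deriv v (s - q.1) * (q.1 * cylinderDistance e κ q ^ (-p)) +
        (v s - v (s - q.1)) * (cylinderDistance e κ q ^ (-p) -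
          2 * p * (q.1 ^ 2 * cylinderDistance e κ q ^ (-p - 1)))|
      ≤ ‖v‖ * (|q.1| * X) + 2 * ‖v‖ * ((1 + 2 * p) * (1 / δ * (|q.1| * X))) := by
        refine (abs_add_le _ _).trans (add_le_add ?_ ?_)
        · rw [abs_mul, abs_mul, abs_of_pos hP]
          exact mul_le_mul (v.abs_deriv_le _) (mul_le_mul_of_nonneg_left hle (abs_nonneg _))
            (by positivity) (by positivity)
        · rw [abs_mul]
          refine mul_le_mul (v.abs_increment_le s q.1) (h3.trans ?_) (by positivity) (by positivity)
          exact mul_le_mul_of_nonneg_left h7 (by positivity)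
    _ = _ := by ring

/-- The integration by parts on `|τ| ≥ δ`. -/
theorem integral_incrementDerivative (he : ‖e‖ = 1) (hp : 1 < p) {δ : ℝ} (hδ : 0 < δ)
    (σ : Metric.sphere (0 : V) 1) :
    ∫ τ in {τ : ℝ | δ ≤ |τ|}, incrementDerivative e p κ v s (τ, σ) =
      incrementPrimitive e p κ v s (-δ, σ) - incrementPrimitive e p κ v s (δ, σ) := by
  have hset : {τ : ℝ | δ ≤ |τ|} = Iic (-δ) ∪ Ici δ := by
    ext τ
    simp only [mem_union, mem_Iic, mem_Ici]
    change δ ≤ |τ| ↔ _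
    rw [le_abs, or_comm, le_neg]
  have hint : IntegrableOn (fun τ => incrementDerivative e p κ v s (τ, σ)) {τ : ℝ | δ ≤ |τ|} := by
    have h1 := integrableOn_norm_rpow_neg (F := ℝ) (p := 2 * p - 1) hδ (by simp; linarith)
    simp only [Real.norm_eq_abs, neg_sub] at h1
    refine Integrable.mono' (h1.const_mul (‖v‖ * (1 + (2 + 4 * p) / δ)))
      (measurable_incrementDerivative.comp measurable_prodMk_right).aestronglyMeasurable ?_
    filter_upwards [ae_restrict_mem (measurableSet_le measurable_const
      (by fun_prop : Measurable fun τ : ℝ => |τ|))] with τ hτ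
    exact abs_incrementDerivative_le he (by linarith) hδ (q := (τ, σ)) hτ
  rw [hset] at hint ⊢
  have hdisj : Disjoint (Iic (-δ)) (Ici δ) := by
    rw [Set.disjoint_left]
    intro x h1 h2
    have h1 : x ≤ -δ := h1
    have h2 : δ ≤ x := h2
    linarith
  have hlim : ∀ (l : Filter ℝ), Tendsto (fun τ : ℝ => |τ|) l atTop →
      Tendsto (fun τ => incrementPrimitive e p κ v s (τ, σ)) l (𝓝 0) := by
    intro l hl
    have h2 : Tendsto (fun τ : ℝ => 2 * ‖v‖ * |τ| ^ (1 - 2 * p)) l (𝓝 0) := by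
      have := ((tendsto_rpow_neg_atTop (show 0 < 2 * p - 1 by linarith)).comp hl).const_mul
        (2 * ‖v‖)
      simpa [Function.comp_def] using this
    refine squeeze_zero_norm' ?_ h2
    filter_upwards [hl.eventually_gt_atTop 0] with τ hτ
    exact abs_incrementPrimitive_le he (by linarith) (q := (τ, σ)) (abs_pos.1 hτ)
  rw [setIntegral_union hdisj measurableSet_Ici (hint.mono_set subset_union_left)
    (hint.mono_set subset_union_right), integral_Ici_eq_integral_Ioi,
    integral_Ioi_of_hasDerivAt_of_tendsto
      (hasDerivAt_incrementPrimitive he hδ.ne' σ).continuousAt.continuousWithinAt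
      (fun τ hτ => hasDerivAt_incrementPrimitive he (hδ.trans hτ).ne' σ)
      ((hint.mono_set subset_union_right).mono_set Ioi_subset_Ici_self)
      (hlim _ tendsto_abs_atTop_atTop),
    integral_Iic_of_hasDerivAt_of_tendsto
      (hasDerivAt_incrementPrimitive he (neg_ne_zero.2 hδ.ne') σ).continuousAt.continuousWithinAt
      (fun τ hτ => hasDerivAt_incrementPrimitive he
        (show τ ≠ 0 from (lt_trans hτ (neg_lt_zero.2 hδ)).ne) σ)
      (hint.mono_set subset_union_left)
      (hlim _ tendsto_abs_atBot_atTop)]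
  ring

/-- The linearized integrand with the contribution of constants removed. -/
theorem linearizedIntegrand_sub_const (he : ‖e‖ = 1) {q : ℝ × Metric.sphere (0 : V) 1}
    (hq : q.1 ≠ 0) :
    linearizedIntegrand e α κ v s q -
      v s * linearizedIntegrand e α κ (HolderSpace.const 1 β 1) s q =
    κ ^ (Module.finrank ℝ V - 1) * (incrementDerivative e (kernelExponent V α) κ v s q +
      (v s - v (s - q.1)) * reducedCoefficient e α κ q) := by
  have heq := cylinderDistance_rpow_eq (κ := κ) (p := kernelExponent V α) he hq
  have hD : cylinderDistance e κ q = q.1 ^ 2 + 2 * κ ^ 2 * sphereDefect e q.2 := rfl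
  have e1 : q.1 * taylorRemainder v s q.1 = q.1 * deriv v (s - q.1) - (v s - v (s - q.1)) := by
    rw [taylorRemainder]; field_simp
  have e2 : ∀ t, (HolderSpace.const 1 β 1) t = 1 := fun t => rfl
  rw [linearizedIntegrand, linearizedIntegrand, taylorRemainder_const, e1, incrementDerivative,
    reducedCoefficient, e2, e2, heq]
  set R := cylinderDistance e κ q ^ (-kernelExponent V α - 1)
  set D := cylinderDistance e κ q
  clear_value R D
  subst hD
  ring

end CylinderKernel

/-! ### The principal value formula at a straight cylinder -/

section CylinderPrincipalValue

variable {V : Type*} [NormedAddCommGroup V] [InnerProductSpace ℝ V] [FiniteDimensional ℝ V]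
  [MeasurableSpace V] [BorelSpace V] [Nontrivial V] {α β κ : ℝ} {e : V}
  {v : HolderSpace 1 β} {s : ℝ}

theorem measurableSet_le_abs (δ : ℝ) : MeasurableSet {τ : ℝ | δ ≤ |τ|} :=
  measurableSet_le measurable_const (by fun_prop)

theorem ae_le_abs_fst (δ : ℝ) : ∀ᵐ q : ℝ × Metric.sphere (0 : V) 1
    ∂((volume.restrict {τ : ℝ | δ ≤ |τ|}).prod (surfaceMeasure V)), δ ≤ |q.1| :=
  Measure.quasiMeasurePreserving_fst.ae (ae_restrict_mem (measurableSet_le_abs δ))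

theorem integrable_prod_of_abs_le {δ a C : ℝ} (hδ : 0 < δ) (ha : a < -1)
    {F : ℝ × Metric.sphere (0 : V) 1 → ℝ} (hF : Measurable F)
    (hle : ∀ q, δ ≤ |q.1| → |F q| ≤ C * |q.1| ^ a) :
    Integrable F ((volume.restrict {τ : ℝ | δ ≤ |τ|}).prod (surfaceMeasure V)) := by
  have h1 := integrableOn_norm_rpow_neg (F := ℝ) (p := -a) hδ (by simp; linarith)
  simp only [Real.norm_eq_abs, neg_neg] at h1
  refine (Integrable.comp_fst (h1.const_mul C) _).mono' hF.aestronglyMeasurable ?_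
  filter_upwards [ae_le_abs_fst δ] with q hq using hle q hq

theorem integrable_increment_mul_cylinderDistance (he : ‖e‖ = 1) (hα : 0 < α) {δ : ℝ}
    (hδ : 0 < δ) :
    Integrable (fun q : ℝ × Metric.sphere (0 : V) 1 => (v s - v (s - q.1)) *
      cylinderDistance e κ q ^ (-kernelExponent V α))
      ((volume.restrict {τ : ℝ | δ ≤ |τ|}).prod (surfaceMeasure V)) := by
  have hp1 := one_lt_kernelExponent (V := V) hα
  have hm := measurable_cylinderDistance (e := e) (κ := κ)
  have hv := v.continuous.measurable
  refine integrable_prod_of_abs_le (a := -(2 * kernelExponent V α)) (C := 2 * ‖v‖) hδ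
    (by linarith) (by fun_prop) fun q hq => ?_
  have hq0 : q.1 ≠ 0 := abs_pos.1 (hδ.trans_le hq)
  rw [abs_mul, abs_of_pos (Real.rpow_pos_of_pos (cylinderDistance_pos he hq0) _)]
  exact mul_le_mul (v.abs_increment_le s q.1) (cylinderDistance_rpow_le he (by linarith) hq0)
    (Real.rpow_pos_of_pos (cylinderDistance_pos he hq0) _).le (by positivity)

/-- The truncated integral of the linearized integrand, after integration by parts. -/
theorem setIntegral_linearizedIntegrand_sub (he : ‖e‖ = 1) (hα : 0 < α) {δ : ℝ} (hδ : 0 < δ) :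
    ∫ q, (linearizedIntegrand e α κ v s q -
      v s * linearizedIntegrand e α κ (HolderSpace.const 1 β 1) s q)
      ∂((volume.restrict {τ : ℝ | δ ≤ |τ|}).prod (surfaceMeasure V)) =
    κ ^ (Module.finrank ℝ V - 1) *
      (-(δ * ((v s - v (s - δ)) + (v s - v (s + δ))) * cylinderKernel e α κ δ) +
        α * ∫ τ in {τ : ℝ | δ ≤ |τ|}, (v s - v (s - τ)) * cylinderKernel e α κ τ) := by
  have hp1 := one_lt_kernelExponent (V := V) hα
  have hv := v.continuous.measurable
  have hae : ∀ᵐ q : ℝ × Metric.sphere (0 : V) 1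
      ∂((volume.restrict {τ : ℝ | δ ≤ |τ|}).prod (surfaceMeasure V)),
      linearizedIntegrand e α κ v s q -
        v s * linearizedIntegrand e α κ (HolderSpace.const 1 β 1) s q =
      κ ^ (Module.finrank ℝ V - 1) * (incrementDerivative e (kernelExponent V α) κ v s q +
        (v s - v (s - q.1)) * reducedCoefficient e α κ q) := by
    filter_upwards [ae_le_abs_fst δ] with q hq
    exact linearizedIntegrand_sub_const he (abs_pos.1 (hδ.trans_le hq))
  have hR := measurable_reducedCoefficient (e := e) (α := α) (κ := κ)
  have i1 : Integrable (incrementDerivative e (kernelExponent V α) κ v s)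
      ((volume.restrict {τ : ℝ | δ ≤ |τ|}).prod (surfaceMeasure V)) :=
    integrable_prod_of_abs_le hδ (by linarith) measurable_incrementDerivative
      fun q hq => abs_incrementDerivative_le he (by linarith) hδ hq
  have i2 : Integrable (fun q : ℝ × Metric.sphere (0 : V) 1 =>
      (v s - v (s - q.1)) * reducedCoefficient e α κ q)
      ((volume.restrict {τ : ℝ | δ ≤ |τ|}).prod (surfaceMeasure V)) := by
    refine integrable_prod_of_abs_le (a := -(2 * kernelExponent V α))
      (C := 2 * ‖v‖ * (4 * kernelExponent V α + 2 + 2 * Module.finrank ℝ V)) hδ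
      (by linarith) (by fun_prop) fun q hq => ?_
    rw [abs_mul, mul_assoc]
    exact mul_le_mul (v.abs_increment_le s q.1)
      (abs_reducedCoefficient_le he hα (abs_pos.1 (hδ.trans_le hq))) (abs_nonneg _) (by positivity)
  -- The exact derivative is integrated in τ first, the other term over the sphere first. Truncation
  -- at |τ| ≥ δ justifies both orders.
  rw [integral_congr_ae hae, integral_const_mul, integral_add i1 i2, integral_prod_symm _ i1,
    integral_prod _ i2]
  simp only [integral_incrementDerivative he hp1 hδ]
  congr 2
  · rw [cylinderKernel, ← integral_const_mul, ← integral_neg]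
    refine integral_congr_ae (Eventually.of_forall fun σ => ?_)
    have h1 : cylinderDistance e κ (-δ, σ) = cylinderDistance e κ (δ, σ) := by
      simp [cylinderDistance]
    simp only [incrementPrimitive, h1, sub_neg_eq_add]
    ring
  · rw [← integral_const_mul]
    refine setIntegral_congr_fun (measurableSet_le_abs δ) fun τ hτ => ?_
    have hτ : δ ≤ |τ| := hτ
    rw [integral_const_mul, integral_reducedCoefficient he hα (abs_pos.1 (hδ.trans_le hτ))]
    ring

/-- The two boundary points combine into a second difference of v, of size δ^{1+β}, against a kernel
of size δ^{-2-α}. With the factor δ the product is O(δ^{β-α}). -/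
theorem tendsto_boundary_term (he : ‖e‖ = 1) (hα : 0 < α) (hαβ : α < β) (hκ : 0 < κ) :
    Tendsto (fun δ => δ * ((v s - v (s - δ)) + (v s - v (s + δ))) * cylinderKernel e α κ δ)
      (𝓝[>] 0) (𝓝 0) := by
  obtain ⟨C, hC, h⟩ := exists_cylinderKernel_le he hα hκ
  have h1 : Tendsto (fun δ : ℝ => ‖v‖ * C * δ ^ (β - α)) (𝓝[>] 0) (𝓝 0) := by
    have h2 : Tendsto (fun δ : ℝ => δ ^ (β - α)) (𝓝 0) (𝓝 (0 ^ (β - α))) :=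
      (Real.continuousAt_rpow_const 0 (β - α) (Or.inr (sub_pos.2 hαβ).le)).tendsto
    rw [Real.zero_rpow (sub_pos.2 hαβ).ne'] at h2
    simpa using (h2.mono_left nhdsWithin_le_nhds).const_mul (‖v‖ * C)
  refine squeeze_zero_norm' ?_ h1
  filter_upwards [self_mem_nhdsWithin] with δ hδ
  have hδ : 0 < δ := hδ
  have h3 := v.abs_increment_sub_le s (s + δ) δ
  rw [add_sub_cancel_right, show s - (s + δ) = -δ by ring, abs_neg, abs_of_pos hδ] at h3
  have h4 : 0 ≤ cylinderKernel e α κ δ := integral_nonneg fun σ =>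
    Real.rpow_nonneg (cylinderDistance_pos he (q := (δ, σ)) hδ.ne').le _
  have h5 := h δ hδ.ne'
  rw [abs_of_pos hδ] at h5
  have h6 : v s - v (s - δ) + (v s - v (s + δ)) =
      v s - v (s - δ) - (v (s + δ) - v s) := by ring
  rw [Real.norm_eq_abs, abs_mul, abs_mul, abs_of_pos hδ, abs_of_nonneg h4, h6]
  calc δ * |v s - v (s - δ) - (v (s + δ) - v s)| * cylinderKernel e α κ δ
      ≤ δ * (‖v‖ * δ ^ β * δ) * (C * δ ^ (-2 - α)) := by gcongr
    _ = ‖v‖ * C * (δ ^ (2 : ℕ) * δ ^ β * δ ^ (-2 - α)) := by ring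
    _ = _ := by
      rw [← Real.rpow_natCast, ← Real.rpow_add hδ, ← Real.rpow_add hδ]
      congr 2; push_cast; ring

theorem tendsto_integral_le_abs {J : ℝ × Metric.sphere (0 : V) 1 → ℝ}
    (hJ : Integrable J (volume.prod (surfaceMeasure V))) :
    Tendsto (fun δ : ℝ => ∫ q, J q
      ∂((volume.restrict {τ : ℝ | δ ≤ |τ|}).prod (surfaceMeasure V))) (𝓝[>] 0)
      (𝓝 (∫ q, J q ∂(volume.prod (surfaceMeasure V)))) := by
  have hm : ∀ δ : ℝ, MeasurableSet {q : ℝ × Metric.sphere (0 : V) 1 | δ ≤ |q.1|} := fun δ =>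
    measurableSet_le measurable_const (by fun_prop)
  have h1 : ∀ δ : ℝ, ∫ q, J q ∂((volume.restrict {τ : ℝ | δ ≤ |τ|}).prod (surfaceMeasure V)) =
      ∫ q, {q : ℝ × Metric.sphere (0 : V) 1 | δ ≤ |q.1|}.indicator J q
        ∂(volume.prod (surfaceMeasure V)) := by
    intro δ
    rw [integral_indicator (hm δ)]
    have h2 := Measure.prod_restrict (μ := (volume : Measure ℝ)) (ν := surfaceMeasure V)
      {τ : ℝ | δ ≤ |τ|} univ
    rw [Measure.restrict_univ] at h2
    rw [h2]
    congr 2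
    ext q
    simp
  simp only [h1]
  refine tendsto_integral_filter_of_dominated_convergence (fun q => |J q|)
    (Eventually.of_forall fun δ => hJ.aestronglyMeasurable.indicator (hm δ))
    (Eventually.of_forall fun δ => Eventually.of_forall fun q => ?_) hJ.abs ?_
  · exact norm_indicator_le_norm_self _ _
  · filter_upwards [ae_fst_ne_zero] with q hq
    refine tendsto_const_nhds.congr' ?_
    have : ∀ᶠ δ : ℝ in 𝓝[>] 0, δ < |q.1| :=
      nhdsWithin_le_nhds (eventually_lt_nhds (abs_pos.2 hq))
    filter_upwards [this] with δ hδ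
    rw [indicator_of_mem (show q ∈ {q : ℝ × Metric.sphere (0 : V) 1 | δ ≤ |q.1|} from hδ.le)]

/-- The principal value of the increments of `v` against the cylinder kernel. -/
theorem hasPrincipalValue_cylinderKernel (he : ‖e‖ = 1) (hα : 0 < α) (hαβ : α < β) (hβ : β < 1)
    (hκ : 0 < κ) (v : HolderSpace 1 β) (s : ℝ) :
    HasPrincipalValue (fun τ => (v s - v (s - τ)) * cylinderKernel e α κ τ) 0
      ((fderiv ℝ (curvatureMap he hα hαβ hβ) (HolderSpace.const 1 β κ) v s -
        v s * fderiv ℝ (curvatureMap he hα hαβ hβ) (HolderSpace.const 1 β κ)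
          (HolderSpace.const 1 β 1) s) / (2 * κ ^ (Module.finrank ℝ V - 1))) := by
  obtain ⟨i1, h1⟩ := fderiv_curvatureMap_const he hα hαβ hβ hκ v s
  obtain ⟨i2, h2⟩ := fderiv_curvatureMap_const he hα hαβ hβ hκ (HolderSpace.const 1 β 1) s
  have hset : ∀ δ : ℝ, {τ : ℝ | δ ≤ ‖τ - 0‖} = {τ : ℝ | δ ≤ |τ|} := fun δ => by
    simp only [sub_zero, Real.norm_eq_abs]
  refine ⟨fun δ hδ => ?_, ?_⟩
  · rw [hset]
    have h3 := (integrable_increment_mul_cylinderDistance (κ := κ) (v := v) (s := s) he hα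
      hδ).integral_prod_left
    simp only [integral_const_mul] at h3
    exact h3
  · simp only [hset]
    -- The linearized integrand is integrable, so its truncations converge. As the boundary terms
    -- vanish in the limit, the truncated integrals of the increments against the kernel must
    -- converge as well.
    have h4 := tendsto_integral_le_abs (i1.sub (i2.const_mul (v s)))
    have h5 := (h4.const_mul ((κ ^ (Module.finrank ℝ V - 1))⁻¹)).add
      (tendsto_boundary_term (v := v) (s := s) he hα hαβ hκ)
    have h6 := h5.const_mul (α⁻¹)
    have hlim : α⁻¹ * ((κ ^ (Module.finrank ℝ V - 1))⁻¹ * (∫ q, (linearizedIntegrand e α κ v s -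
        fun q => v s * linearizedIntegrand e α κ (HolderSpace.const 1 β 1) s q) q
        ∂(volume.prod (surfaceMeasure V))) + 0) =
        (fderiv ℝ (curvatureMap he hα hαβ hβ) (HolderSpace.const 1 β κ) v s -
        v s * fderiv ℝ (curvatureMap he hα hαβ hβ) (HolderSpace.const 1 β κ)
          (HolderSpace.const 1 β 1) s) / (2 * κ ^ (Module.finrank ℝ V - 1)) := by
      rw [h1, h2]
      simp only [Pi.sub_apply]
      rw [integral_sub i1 (i2.const_mul _), integral_const_mul]
      field_simp
      ring
    rw [hlim] at h6
    refine h6.congr' ?_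
    filter_upwards [self_mem_nhdsWithin] with δ hδ
    have h7 := setIntegral_linearizedIntegrand_sub (κ := κ) (v := v) (s := s) he hα
      (show 0 < δ from hδ)
    simp only [Pi.sub_apply]
    rw [h7]
    field_simp
    ring

/-- The curvature of a straight cylinder. -/
theorem curvatureMap_const (he : ‖e‖ = 1) (hα : 0 < α) (hαβ : α < β) (hβ : β < 1)
    (hκ : 0 < κ) (s : ℝ) :
    curvatureMap he hα hαβ hβ (HolderSpace.const 1 β κ) s =
      2 / α * κ ^ (-α) * ∫ q : ℝ × Metric.sphere (0 : V) 1,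
        sphereDefect e q.2 * ringKernel e (kernelExponent V α) q
        ∂(volume.prod (surfaceMeasure V)) := by
  have hn : 0 < Module.finrank ℝ V := Module.finrank_pos
  obtain ⟨hint, h⟩ := curvatureMap_apply he hα hαβ hβ (const_mem_positiveCone hκ) s
  have hint' := integrable_sphereDefect_mul_ringKernel he (one_lt_kernelExponent (V := V) hα)
    (by unfold kernelExponent; linarith) (by unfold kernelExponent; linarith)
  rw [h, integral_prod _ hint, integral_prod _ hint', mul_assoc]
  congr 1
  have h1 := Measure.integral_comp_mul_left (fun τ => ∫ σ, surfaceIntegrand e α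
    (HolderSpace.const 1 β κ) s (τ, σ) ∂(surfaceMeasure V)) κ
  rw [smul_eq_mul, abs_of_pos (inv_pos.2 hκ), eq_inv_mul_iff_mul_eq₀ hκ.ne'] at h1
  rw [← h1, ← integral_const_mul, ← integral_const_mul]
  refine integral_congr_ae (Eventually.of_forall fun τ => ?_)
  simp only
  rw [← integral_const_mul, ← integral_const_mul]
  refine integral_congr_ae (Eventually.of_forall fun σ => ?_)
  have hc := sphereDefect_nonneg he σ
  have e1 : ∀ t, (HolderSpace.const 1 β κ) t = κ := fun t => rfl
  have e2 : cylinderDistance e κ (κ * τ, σ) = κ ^ 2 * (τ ^ 2 + 2 * sphereDefect e σ) := by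
    simp only [cylinderDistance]; ring
  simp only [surfaceIntegrand, taylorRemainder_const, ringDistance_const, e1, e2, ringKernel]
  rw [Real.mul_rpow (by positivity) (by positivity), sq_rpow_neg, abs_of_pos hκ]
  -- Powers of κ: one from dτ, one from u(s), n - 1 from the density and -2p from the distance; in
  -- total n + 1 - 2p = -α.
  have e3 : κ ^ (-α) = κ * κ * κ ^ (Module.finrank ℝ V - 1) *
      κ ^ (-(2 * kernelExponent V α)) := by
    rw [← pow_two, ← pow_add, ← Real.rpow_natCast, ← Real.rpow_add hκ]
    congr 1
    rw [kernelExponent, show 2 + (Module.finrank ℝ V - 1) = Module.finrank ℝ V + 1 by omega]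
    push_cast; ring
  rw [e3]
  ring

/-- The constants form a line with velocity the constant 1, along which the curvature is a multiple
of κ^{-α}. Differentiating in κ cancels the α of the prefactor 2/α. -/
theorem fderiv_curvatureMap_const_one (he : ‖e‖ = 1) (hα : 0 < α) (hαβ : α < β) (hβ : β < 1)
    (hκ : 0 < κ) (s : ℝ) :
    fderiv ℝ (curvatureMap he hα hαβ hβ) (HolderSpace.const 1 β κ) (HolderSpace.const 1 β 1) s =
      -2 * κ ^ (-1 - α) * ∫ q : ℝ × Metric.sphere (0 : V) 1,
        sphereDefect e q.2 * ringKernel e (kernelExponent V α) q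
        ∂(volume.prod (surfaceMeasure V)) := by
  set I := ∫ q : ℝ × Metric.sphere (0 : V) 1,
        sphereDefect e q.2 * ringKernel e (kernelExponent V α) q
        ∂(volume.prod (surfaceMeasure V)) with hI
  have hline : HasDerivAt (fun t : ℝ => HolderSpace.const 1 β t) (HolderSpace.const 1 β 1) κ := by
    have h1 := (hasDerivAt_id κ).smul_const (HolderSpace.const 1 β 1)
    rw [one_smul] at h1
    refine h1.congr_of_eventuallyEq (Eventually.of_forall fun t => HolderSpace.ext fun x => ?_)
    change t = t * 1
    rw [mul_one]
  have hd := ((contDiffAt_curvatureMap he hα hαβ hβ (const_mem_positiveCone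
    (β := β) hκ)).differentiableAt (by simp)).hasFDerivAt
  have h2 := (HolderSpace.evalCLM s).hasFDerivAt.comp_hasDerivAt κ (hd.comp_hasDerivAt κ hline)
  have h3 : HasDerivAt (fun t : ℝ => 2 / α * t ^ (-α) * I) (2 / α * (-α * κ ^ (-α - 1)) * I) κ :=
    ((Real.hasDerivAt_rpow_const (p := -α) (Or.inl hκ.ne')).const_mul (2 / α)).mul_const I
  have h4 := h3.congr_of_eventuallyEq (f₁ := fun t : ℝ =>
    curvatureMap he hα hαβ hβ (HolderSpace.const 1 β t) s) (by
      filter_upwards [eventually_gt_nhds hκ] with t ht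
      exact curvatureMap_const he hα hαβ hβ ht s)
  have h5 := h2.unique h4
  have h6 : fderiv ℝ (curvatureMap he hα hαβ hβ) (HolderSpace.const 1 β κ)
      (HolderSpace.const 1 β 1) s = 2 / α * (-α * κ ^ (-α - 1)) * I := h5
  rw [h6, show -α - 1 = -1 - α by ring]
  field_simp

/-- Scaling of principal values at the origin of the line. -/
theorem HasPrincipalValue.comp_mul_left {f : ℝ → ℝ} {L : ℝ} (h : HasPrincipalValue f 0 L)
    (hκ : 0 < κ) : HasPrincipalValue (fun τ => f (κ * τ)) 0 (κ⁻¹ * L) := by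
  have hm : ∀ δ : ℝ, MeasurableSet {τ : ℝ | δ ≤ ‖τ - 0‖} := fun δ =>
    measurableSet_le measurable_const (by fun_prop)
  have hind : ∀ δ τ : ℝ, {τ : ℝ | δ ≤ ‖τ - 0‖}.indicator (fun τ => f (κ * τ)) τ =
      {τ : ℝ | κ * δ ≤ ‖τ - 0‖}.indicator f (κ * τ) := by
    intro δ τ
    have h1 : ‖κ * τ - 0‖ = κ * ‖τ - 0‖ := by simp [abs_of_pos hκ]
    by_cases hτ : δ ≤ ‖τ - 0‖
    · rw [indicator_of_mem (show τ ∈ {τ : ℝ | δ ≤ ‖τ - 0‖} from hτ),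
        indicator_of_mem (show κ * τ ∈ {τ : ℝ | κ * δ ≤ ‖τ - 0‖} by
          change κ * δ ≤ ‖κ * τ - 0‖
          rw [h1]; exact mul_le_mul_of_nonneg_left hτ hκ.le)]
    · rw [indicator_of_notMem (show τ ∉ {τ : ℝ | δ ≤ ‖τ - 0‖} from hτ),
        indicator_of_notMem (show κ * τ ∉ {τ : ℝ | κ * δ ≤ ‖τ - 0‖} by
          change ¬ κ * δ ≤ ‖κ * τ - 0‖
          rw [h1]; exact fun h => hτ (le_of_mul_le_mul_left h hκ))]
  refine ⟨fun δ hδ => ?_, ?_⟩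
  · rw [← integrable_indicator_iff (hm δ)]
    have h2 := (integrable_indicator_iff (hm _)).2 (h.1 (κ * δ) (mul_pos hκ hδ))
    exact (h2.comp_mul_left' hκ.ne').congr (Eventually.of_forall fun τ => (hind δ τ).symm)
  · have h3 : Tendsto (fun δ : ℝ => κ * δ) (𝓝[>] 0) (𝓝[>] 0) := by
      refine tendsto_nhdsWithin_iff.2 ⟨?_, ?_⟩
      · have : Tendsto (fun δ : ℝ => κ * δ) (𝓝 0) (𝓝 (κ * 0)) := by
          exact (continuous_const_mul κ).tendsto 0
        rw [mul_zero] at this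
        exact this.mono_left nhdsWithin_le_nhds
      · filter_upwards [self_mem_nhdsWithin] with δ hδ using mul_pos hκ hδ
    refine ((h.2.comp h3).const_mul κ⁻¹).congr fun δ => ?_
    rw [← integral_indicator (hm δ)]
    simp only [hind, Function.comp_apply]
    rw [Measure.integral_comp_mul_left, integral_indicator (hm _), abs_of_pos (inv_pos.2 hκ),
      smul_eq_mul]

theorem HasPrincipalValue.const_mul {F : Type*} [NormedAddCommGroup F] [MeasureSpace F]
    {f : F → ℝ} {x : F} {L : ℝ} (h : HasPrincipalValue f x L) (c : ℝ) :
    HasPrincipalValue (fun y => c * f y) x (c * L) :=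
  ⟨fun ε hε => (h.1 ε hε).const_mul c, by
    simp only [integral_const_mul]; exact h.2.const_mul c⟩

end CylinderPrincipalValue

/-! ### Translation to the concrete Euclidean kernels -/

section Euclidean

variable {N : ℕ} {α : ℝ}

theorem finrank_euclidean_add_one (hN : 2 ≤ N) :
    Module.finrank ℝ (EuclideanSpace ℝ (Fin (N - 1))) + 1 = N := by
  rw [finrank_euclideanSpace_fin]; omega

theorem kernelExponent_euclidean (hN : 2 ≤ N) (α : ℝ) :
    kernelExponent (EuclideanSpace ℝ (Fin (N - 1))) α = ((N : ℝ) + α) / 2 := by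
  have h : ((Module.finrank ℝ (EuclideanSpace ℝ (Fin (N - 1))) : ℕ) : ℝ) + 1 = N := by
    exact_mod_cast finrank_euclidean_add_one hN
  rw [kernelExponent, h]

instance (N : ℕ) : IsFiniteMeasure (sphereMeasure N) :=
  inferInstanceAs (IsFiniteMeasure (surfaceMeasure _))

/-- The first basis vector. -/
def firstVector (hN : 2 ≤ N) : EuclideanSpace ℝ (Fin (N - 1)) :=
  EuclideanSpace.single ⟨0, by omega⟩ 1

theorem norm_firstVector (hN : 2 ≤ N) : ‖firstVector hN‖ = 1 := by simp [firstVector]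

theorem sphereDefect_firstVector (hN : 2 ≤ N) (σ : UnitSphere N) :
    sphereDefect (firstVector hN) σ = 1 - sphereCoord hN σ := by
  rw [sphereDefect, firstVector, EuclideanSpace.inner_single_right]
  simp [sphereCoord]

theorem one_div_rpow_eq_ringKernel (hN : 2 ≤ N) (τ : ℝ) (σ : UnitSphere N) :
    1 / (τ ^ 2 + 2 * (1 - sphereCoord hN σ)) ^ (((N : ℝ) + α) / 2) =
      ringKernel (firstVector hN) (kernelExponent (EuclideanSpace ℝ (Fin (N - 1))) α) (τ, σ) := by
  have hc := sphereDefect_nonneg (norm_firstVector hN) σ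
  rw [ringKernel, kernelExponent_euclidean hN, Real.rpow_neg (by positivity),
    sphereDefect_firstVector, one_div]

theorem integrandB_eq (hN : 2 ≤ N) (q : ℝ × UnitSphere N) :
    integrandB hN α q.1 q.2 = sphereDefect (firstVector hN) q.2 *
      ringKernel (firstVector hN) (kernelExponent (EuclideanSpace ℝ (Fin (N - 1))) α) q := by
  rw [integrandB, div_eq_mul_one_div, one_div_rpow_eq_ringKernel, sphereDefect_firstVector]

/-- Rescaling τ by κ multiplies the cylinder distance by κ², hence the kernel by κ^{-(N+α)}; the
factor 2 is the one in the definition of G_α. -/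
theorem kernelG_eq (hN : 2 ≤ N) {κ : ℝ} (hκ : 0 < κ) (τ : ℝ) :
    kernelG hN α τ = 2 * κ ^ ((N : ℝ) + α) * cylinderKernel (firstVector hN) α κ (κ * τ) := by
  rw [kernelG, cylinderKernel, mul_assoc, ← integral_const_mul (κ ^ ((N : ℝ) + α))]
  congr 1
  refine integral_congr_ae (Eventually.of_forall fun σ => ?_)
  simp only
  rw [one_div_rpow_eq_ringKernel]
  have hc := sphereDefect_nonneg (norm_firstVector hN) σ
  have h1 : cylinderDistance (firstVector hN) κ (κ * τ, σ) =
      κ ^ 2 * (τ ^ 2 + 2 * sphereDefect (firstVector hN) σ) := by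
    simp only [cylinderDistance]; ring
  rw [h1, Real.mul_rpow (by positivity) (by positivity), sq_rpow_neg, abs_of_pos hκ, ← mul_assoc,
    ← Real.rpow_add hκ, kernelExponent_euclidean hN, show (N : ℝ) + α + -(2 * ((N + α) / 2)) = 0 by
      ring, Real.rpow_zero, one_mul]
  rfl

end Euclidean

end

theorem proposition2p3 (N : ℕ) (hN : 2 ≤ N) (α β : ℝ) (hα : 0 < α) (hαβ : α < β) (hβ : β < 1) :
    IsOpen (positiveCone β) ∧
    ∃ H : HolderSpace 1 β → HolderSpace 0 (β - α),
      (∀ u ∈ positiveCone β, ∀ (s : ℝ) (θ : UnitSphere N),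
        HasNonlocalMeanCurvature N α (cylindricalGraph N u) (boundaryPoint N u s θ) (H u s)) ∧
      ContDiffOn ℝ ∞ H (positiveCone β) ∧
      (3 ≤ N →
        Integrable (fun q : ℝ × UnitSphere N => integrandB hN α q.1 q.2)
          (volume.prod (sphereMeasure N)) ∧
        ∀ κ : ℝ, 0 < κ → ∀ (v : HolderSpace 1 β) (s : ℝ), ∃ L : ℝ,
          HasPrincipalValue (fun τ : ℝ => (v s - v (s - κ * τ)) * kernelG hN α τ) 0 L ∧
          fderiv ℝ H (HolderSpace.const 1 β κ) v s =
            κ ^ (-1 - α) * (L - constB hN α * v s)) := by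
  have hfr := finrank_euclidean_add_one hN
  have : Nontrivial (EuclideanSpace ℝ (Fin (N - 1))) :=
    Module.nontrivial_of_finrank_pos (R := ℝ) (by omega)
  have he := norm_firstVector hN
  refine ⟨isOpen_positiveCone β, curvatureMap he hα hαβ hβ, fun u hu s θ => ?_, fun u hu =>
    (contDiffAt_curvatureMap he hα hαβ hβ hu).contDiffWithinAt, fun _ => ?_⟩
  -- The principal value is computed with pole θ and then transferred to the fixed pole used to
  -- define the map.
  · have hθ : ‖(θ : EuclideanSpace ℝ (Fin (N - 1)))‖ = 1 := norm_eq_of_mem_sphere θ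
    have h := hasPrincipalValue_graphSign hθ hα hαβ hβ hu s
    rw [hfr, curvatureMap_apply_eq hθ he hα hαβ hβ hu s] at h
    exact h
  have hint := integrable_sphereDefect_mul_ringKernel he
    (one_lt_kernelExponent (V := EuclideanSpace ℝ (Fin (N - 1))) hα)
    (by unfold kernelExponent; linarith) (by unfold kernelExponent; linarith)
  have hint' : Integrable (fun q : ℝ × UnitSphere N => integrandB hN α q.1 q.2)
      (volume.prod (sphereMeasure N)) := by
    simp only [integrandB_eq]
    exact hint
  -- The witness is the principal value against the cylinder kernel, after the substitution τ ↦ κτ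
  -- (factor κ⁻¹) and the normalization of G_α (factor 2κ^{N+α}). It equals κ^{1+α}(DH(κ)v -
  -- v(s)·DH(κ)1)(s).
  refine ⟨hint', fun κ hκ v s => ⟨2 * κ ^ ((N : ℝ) + α) * (κ⁻¹ *
      ((fderiv ℝ (curvatureMap he hα hαβ hβ) (HolderSpace.const 1 β κ) v s -
        v s * fderiv ℝ (curvatureMap he hα hαβ hβ) (HolderSpace.const 1 β κ)
          (HolderSpace.const 1 β 1) s) /
        (2 * κ ^ (Module.finrank ℝ (EuclideanSpace ℝ (Fin (N - 1))) - 1)))), ?_, ?_⟩⟩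
  · have h := ((hasPrincipalValue_cylinderKernel he hα hαβ hβ hκ v s).comp_mul_left hκ).const_mul
      (2 * κ ^ ((N : ℝ) + α))
    simp only [kernelG_eq hN hκ]
    refine (congrArg (HasPrincipalValue · 0 _) (funext fun τ => ?_)).mp h
    ring
  · have hB : constB hN α = 2 * ∫ q, sphereDefect (firstVector hN) q.2 *
        ringKernel (firstVector hN) (kernelExponent (EuclideanSpace ℝ (Fin (N - 1))) α) q
        ∂(volume.prod (surfaceMeasure (EuclideanSpace ℝ (Fin (N - 1))))) := by
      rw [constB, ← integral_prod (fun q : ℝ × UnitSphere N => integrandB hN α q.1 q.2) hint']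
      simp only [integrandB_eq]
      rfl
    rw [fderiv_curvatureMap_const_one he hα hαβ hβ hκ s, hB]
    set I := ∫ q, sphereDefect (firstVector hN) q.2 *
        ringKernel (firstVector hN) (kernelExponent (EuclideanSpace ℝ (Fin (N - 1))) α) q
        ∂(volume.prod (surfaceMeasure (EuclideanSpace ℝ (Fin (N - 1)))))
    -- N + α = 1 + (1 + α) + (n - 1): the first factor cancels κ⁻¹ and the last cancels κ^{n-1},
    -- leaving κ^{1+α} against κ^{-1-α}.
    have hpow : κ ^ ((N : ℝ) + α) = κ * κ ^ (1 + α) *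
        κ ^ (Module.finrank ℝ (EuclideanSpace ℝ (Fin (N - 1))) - 1) := by
      rw [← Real.rpow_natCast, ← Real.rpow_one_add' hκ.le (by positivity), ← Real.rpow_add hκ,
        Nat.cast_sub (by omega)]
      congr 1
      have : (N : ℝ) = (Module.finrank ℝ (EuclideanSpace ℝ (Fin (N - 1))) : ℝ) + 1 := by
        exact_mod_cast hfr.symm
      rw [this]; push_cast; ring
    have hinv : κ ^ (-1 - α) = (κ ^ (1 + α))⁻¹ := by
      rw [← Real.rpow_neg hκ.le]; congr 1; ring
    have h1 : 0 < κ ^ (1 + α) := by positivity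
    rw [hpow, hinv]
    field_simp
    ring
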